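/- Let $H$ be a finite-dimensional Hopf algebra, with unit map $u$, comultiplication $\Delta$ and counit $\varepsilon$, over a field $\Bbbk$ of positive characteristic. For $n\ge 1$ let $m_n\colon H^{\otimes n}\to H$, $h_1\otimes\cdots\otimes h_n\mapsto h_1\cdots h_n$, be the iterated multiplication, let $\Delta_n\colon H\to H^{\otimes n}$, $h\mapsto\sum h_{(1)}\otimes\cdots\otimes h_{(n)}$, be the iterated comultiplication, and set $$\exp_0(H):=\min\{n\ge 1 \mid m_n\circ\Delta_n=u\circ\varepsilon\},$$ where $\min\varnothing=\infty$. Then $\exp_0(H)<\infty$. -/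

import Mathlib

open scoped TensorProduct

noncomputable section

namespace HopfExponent

variable (k : Type*) (H : Type*) [Field k] [Ring H] [HopfAlgebra k H]

/-- The multiplication map `m_n : H^{⊗n} → H`, `h₁ ⊗ ⋯ ⊗ hₙ ↦ h₁ h₂ ⋯ hₙ`. -/
def mulN (n : ℕ) : (⨂[k]^n H) →ₗ[k] H :=
  PiTensorProduct.lift (MultilinearMap.mkPiAlgebraFin k n H)

/-- The iterated comultiplication `Δ_n : H → H^{⊗n}`, `h ↦ ∑ h₍₁₎ ⊗ ⋯ ⊗ h₍ₙ₎`, given by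
`Δ_0 = ε` (with `H^{⊗0} = k`) and `Δ_{n+1} = (Δ_n ⊗ id) ∘ Δ`, where `H^{⊗n} ⊗ H` is identified
with `H^{⊗(n+1)}`. In particular `Δ_1 = id` and `Δ_2 = Δ`. -/
def comulN : (n : ℕ) → H →ₗ[k] (⨂[k]^n H)
  | 0 => (PiTensorProduct.isEmptyEquiv (Fin 0)).symm.toLinearMap ∘ₗ Coalgebra.counit
  | n + 1 =>
    TensorPower.mulEquiv.toLinearMap ∘ₗ
      TensorProduct.map (comulN n)
        (PiTensorProduct.subsingletonEquiv (0 : Fin 1)).symm.toLinearMap ∘ₗ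
      Coalgebra.comul

/-- The `n`-th Sweedler power `[n] = m_n ∘ Δ_n : H → H`. -/
def sweedlerPower (n : ℕ) : H →ₗ[k] H :=
  mulN k H n ∘ₗ comulN k H n

/-- The exponent `exp₀(H) = min {n ≥ 1 | [n] = u ∘ ε}`, with `min ∅ = ∞`. -/
def exp₀ : ℕ∞ :=
  sInf {N : ℕ∞ | ∃ n : ℕ, 1 ≤ n ∧
    sweedlerPower k H n = Algebra.linearMap k H ∘ₗ Coalgebra.counit ∧ N = (n : ℕ∞)}

end HopfExponent

end

open scoped TensorProduct

noncomputable section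

namespace HopfExponent

open WithConv LinearMap Coalgebra HopfAlgebra MulOpposite

/-! ### Convolution calculus -/

section Convolution

variable {k H A B : Type*} [Field k] [Ring H] [HopfAlgebra k H] [Ring A] [Algebra k A]
  [Ring B] [Algebra k B]

/-! Write id^{*n} for convolution powers; the n-th Sweedler power is id^{*n}
(`sweedlerPower_eq_convPow`), and convolution powers survive base change, so the field may be taken
algebraically closed of characteristic p. It then suffices that the Drinfeld element u : v ↦
S(v₋₁)v₀ has finite order on every finite-dimensional Yetter–Drinfeld structure
(`YD.isOfFinOrder_u`).

For this, u is compared with a companion s. Both behave under tensor products like a twist: with Q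
the double braiding, Q·u_{Y⊗Z} = u_Y u_Z and s_{Y⊗Z}·Q = s_Y s_Z (`YD.Q_mul_tensor_u`,
`YD.tensor_s_mul_Q`). Moreover a regular structure F absorbs every Y: the elements u and s of Y ⊗ F
are conjugate, by one unit, to those of F (`YD.isAbsorbed_reg`). This has two consequences. A
pentagon relation makes the determinant of a braiding a root of unity, so taking determinants in the
first formula shows that det u_Y is a root of unity. In u s⁻¹ the double braiding cancels, so (u
s⁻¹)_Y ⊗ (u s⁻¹)_F is conjugate to 1 ⊗ (u s⁻¹)_F; multiplication by an eigenvalue of (u s⁻¹)_Y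
therefore preserves the finite set of eigenvalues of (u s⁻¹)_F, and such an eigenvalue is a root of
unity.

The product us commutes with the whole structure. On an eigenspace of us with eigenvalue c,
determinants express a power of c through det u and det(u s⁻¹), so c is a root of unity too.
Positive characteristic enters here: an operator whose eigenvalues are roots of unity has finite
order, because its unipotent part is killed by a power of p (`isOfFinOrder_of_isEigenvalue`). Hence
u s⁻¹, us and their product u² have finite order.

On the regular structure, uⁿ = 1 says that S^{2n} = id and that a power map twisted by powers of S²
is trivial (`exists_twistedPower_eq_one`). To remove the twist, the result is applied again to the
smash product of H with the finite group generated by S²: there S² is conjugation by a group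
element, the twists telescope, and S^{*n} = 1 (`convPow_antipode_eq_one`). Since id and S are
inverse for convolution, id^{*n} = 1. -/

variable (k H) in
/-- The element `x` regarded as the function `h ↦ ε(h) x` in the convolution algebra. -/
def cst (x : A) : WithConv (H →ₗ[k] A) :=
  toConv ((LinearMap.toSpanSingleton k A x) ∘ₗ counit)

/-- A linear map regarded as a convolution element with values in the opposite algebra. -/
def opConv (f : H →ₗ[k] A) : WithConv (H →ₗ[k] Aᵐᵒᵖ) :=
  toConv ((opLinearEquiv k).toLinearMap ∘ₗ f)

lemma cst_apply (x : A) (h : H) : cst k H x h = counit (R := k) h • x := rfl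

lemma opConv_apply (f : H →ₗ[k] A) (h : H) : opConv f h = op (f h) := rfl

lemma cst_one : (cst k H 1 : WithConv (H →ₗ[k] A)) = 1 := by
  ext h
  change counit (R := k) h • (1 : A) = algebraMap k A (counit h)
  rw [Algebra.algebraMap_eq_smul_one]

lemma cst_mul_apply (x : A) (f : WithConv (H →ₗ[k] A)) (h : H) :
    (cst k H x * f) h = x * f h := by
  conv_rhs => rw [← one_mul f, ← cst_one, (ℛ k h).convMul_apply]
  rw [(ℛ k h).convMul_apply]
  simp [cst_apply, Finset.mul_sum]

lemma mul_cst_apply (x : A) (f : WithConv (H →ₗ[k] A)) (h : H) :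
    (f * cst k H x) h = f h * x := by
  conv_rhs => rw [← mul_one f, ← cst_one, (ℛ k h).convMul_apply]
  rw [(ℛ k h).convMul_apply]
  simp [cst_apply, Finset.sum_mul]

lemma cst_mul_cst (x y : A) : cst k H x * cst k H y = cst k H (x * y) := by
  ext h
  change (cst k H x * cst k H y) h = cst k H (x * y) h
  rw [cst_mul_apply]
  simp [cst_apply]

lemma conv_ext {f g : WithConv (H →ₗ[k] A)} (h : ∀ x, f x = g x) : f = g := by
  ext x; exact h x

lemma opConv_mul_apply (f g : H →ₗ[k] A) (h : H) :
    (opConv f * opConv g) h =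
      op (∑ i ∈ (ℛ k h).index, g ((ℛ k h).right i) * f ((ℛ k h).left i)) := by
  rw [(ℛ k h).convMul_apply]
  simp [opConv_apply]

/-- If values commute, convolution in the opposite algebra is convolution. -/
lemma opConv_mul_of_commute {f g : H →ₗ[k] A} (hfg : ∀ x y, f x * g y = g y * f x) :
    opConv f * opConv g = opConv (toConv f * toConv g).ofConv := by
  refine conv_ext fun h => ?_
  rw [opConv_mul_apply, opConv_apply]
  congr 1
  change _ = (toConv f * toConv g) h
  rw [(ℛ k h).convMul_apply]
  exact Finset.sum_congr rfl fun i _ => (hfg _ _).symm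

/-- Image of the antipode axiom under φ. Together with `antipode_mul_algHom` it makes φ invertible
for convolution, so that later identities follow from uniqueness of inverses. -/
lemma algHom_mul_antipode (φ : H →ₐ[k] A) :
    toConv φ.toLinearMap * toConv (φ.toLinearMap ∘ₗ antipode k) = 1 := by
  refine conv_ext fun h => ?_
  rw [(ℛ k h).convMul_apply]
  have := congr(φ $(sum_mul_antipode_eq_algebraMap_counit (ℛ k h)))
  simpa using this

lemma antipode_mul_algHom (φ : H →ₐ[k] A) :
    toConv (φ.toLinearMap ∘ₗ antipode k) * toConv φ.toLinearMap = 1 := by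
  refine conv_ext fun h => ?_
  rw [(ℛ k h).convMul_apply]
  have := congr(φ $(sum_antipode_mul_eq_algebraMap_counit (ℛ k h)))
  simpa using this

/-- `op ∘ φ ∘ S` as an algebra homomorphism to the opposite algebra. -/
def opAntipode (φ : H →ₐ[k] A) : H →ₐ[k] Aᵐᵒᵖ :=
  (AlgHom.op φ).comp (antipodeAlgHomOp k H)

lemma opAntipode_apply (φ : H →ₐ[k] A) (h : H) :
    opAntipode φ h = op (φ (antipode k h)) := rfl

/-- φ ∘ S is an algebra homomorphism into the opposite algebra, so its inverse in that convolution
algebra is φ ∘ S². -/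
lemma opConv_antipode_mul (φ : H →ₐ[k] A) :
    opConv (φ.toLinearMap ∘ₗ antipode k) *
      opConv (φ.toLinearMap ∘ₗ antipode k ∘ₗ antipode k) = 1 :=
  algHom_mul_antipode (opAntipode φ)

lemma opConv_mul_antipode (φ : H →ₐ[k] A) :
    opConv (φ.toLinearMap ∘ₗ antipode k ∘ₗ antipode k) *
      opConv (φ.toLinearMap ∘ₗ antipode k) = 1 :=
  antipode_mul_algHom (opAntipode φ)

variable (k H) in
/-- The square of the antipode as an algebra endomorphism. -/
def antipodeSq : H →ₐ[k] H :=
  AlgHom.ofLinearMap (antipode k ∘ₗ antipode k) (by simp)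
    (fun x y => by simp [antipode_mul_antidistrib])

lemma antipodeSq_apply (h : H) : antipodeSq k H h = antipode k (antipode k h) := rfl

end Convolution

/-! ### Bijectivity of the antipode -/

section AntipodeBijective

variable {k H A : Type*} [Field k] [Ring H] [HopfAlgebra k H] [Ring A] [Algebra k A]

/-- Since π commutes with S, the hypothesis says that φ ∘ π and φ have the same convolution inverse.
This cancels one S on the left. -/
lemma comp_eq_of_antipode_comp_eq (φ : H →ₐ[k] A) (π : H →ₐ[k] H)
    (hπ : ∀ x, π (antipode k x) = antipode k (π x))
    (h : ∀ x, φ (antipode k (π x)) = φ (antipode k x)) (x : H) : φ (π x) = φ x := by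
  have e : (φ.comp π).toLinearMap ∘ₗ antipode k = φ.toLinearMap ∘ₗ antipode k := by
    ext y
    simp [hπ, h]
  have h1 := algHom_mul_antipode (φ.comp π)
  rw [e] at h1
  have := left_inv_eq_right_inv h1 (antipode_mul_algHom φ)
  exact congr($this x)

open Polynomial in
-- Fitting decomposition by polynomials: write the minimal polynomial as X^m q with q prime to X,
-- and take a Bézout inverse of a high power of X modulo q. The exponent is even so that the power
-- of the antipode is multiplicative rather than antimultiplicative.
lemma exists_drazin {V : Type*} [AddCommGroup V] [Module k V] [FiniteDimensional k V]
    (f : Module.End k V) : ∃ (n : ℕ) (q : k[X]), 0 < n ∧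
      (aeval f q) * f ^ (2 * n) * f ^ (2 * n) = f ^ (2 * n) := by
  have h0 : minpoly k f ≠ 0 := minpoly.ne_zero (Algebra.IsIntegral.isIntegral f)
  obtain ⟨q, hq, hdvd⟩ := Polynomial.exists_eq_pow_rootMultiplicity_mul_and_not_dvd _ h0 0
  set m := rootMultiplicity 0 (minpoly k f)
  rw [C_0, sub_zero] at hq hdvd
  have hc : IsCoprime ((X : k[X]) ^ (2 * (m + 1))) q :=
    ((irreducible_X.coprime_iff_not_dvd).2 hdvd).pow_left
  obtain ⟨a, b, hab⟩ := hc
  refine ⟨m + 1, a, Nat.succ_pos m, ?_⟩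
  have h1 : aeval f (b * q * X ^ (2 * (m + 1))) = 0 := by
    have : b * q * X ^ (2 * (m + 1)) = (b * X ^ (m + 2)) * minpoly k f := by
      rw [hq]; ring
    rw [this, map_mul, minpoly.aeval, mul_zero]
  have h2 : a * X ^ (2 * (m + 1)) * X ^ (2 * (m + 1)) =
      X ^ (2 * (m + 1)) - b * q * X ^ (2 * (m + 1)) := by
    linear_combination (X ^ (2 * (m + 1))) * hab
  have h3 := congrArg (aeval f) h2
  rw [map_sub, h1, sub_zero] at h3
  simpa using h3

variable (k H) in
-- The Fitting projection π onto the stable image of S satisfies S^{2n} ∘ π = S^{2n}. Cancelling the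
-- factors S one at a time gives π = id, so S has no nilpotent part.
lemma antipode_bijective [FiniteDimensional k H] :
    Function.Bijective (antipode k : H →ₗ[k] H) := by
  obtain ⟨n, q, hn, hq⟩ := exists_drazin (antipode k : Module.End k H)
  set S : Module.End k H := antipode k with hS
  set r : Module.End k H := Polynomial.aeval S q
  have hcomm : Commute r S := by
    have := (Commute.all q Polynomial.X).map (Polynomial.aeval S)
    rwa [Polynomial.aeval_X] at this
  have hrs : Commute r (S ^ (2 * n)) := hcomm.pow_right _
  have hpow (j : ℕ) (x : H) : ((antipodeSq k H) ^ j) x = (S ^ (2 * j)) x := by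
    induction j generalizing x with
    | zero => rfl
    | succ j ih =>
      rw [pow_succ, AlgHom.mul_apply, ih, mul_add, mul_one, pow_add, Module.End.mul_apply]
      rfl
  have hs (x y : H) : (S ^ (2 * n)) (x * y) = (S ^ (2 * n)) x * (S ^ (2 * n)) y := by
    rw [← hpow, map_mul, hpow, hpow]
  have hs1 : (S ^ (2 * n)) 1 = 1 := by rw [← hpow, map_one]
  set s := S ^ (2 * n) with hsdef
  have e1 (x : H) : r (s (s x)) = s x := congr($hq x)
  have e2 (x : H) : s (r (s x)) = s x := by
    rw [← Module.End.mul_apply s r, ← hrs.eq, Module.End.mul_apply, e1 x]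
  have e3 (x : H) : r (s x) = s (r x) := congr($(hrs.eq) x)
  -- On the image of s the map r inverts s, so r ∘ s inherits multiplicativity from s.
  let π : H →ₐ[k] H := AlgHom.ofLinearMap (r * s)
    (by
      change r (s 1) = 1
      have := e1 1
      rw [hs1, hs1] at this
      rw [hs1, this])
    (fun x y => by
      change r (s (x * y)) = r (s x) * r (s y)
      rw [hs, ← e2 x, ← e2 y, e3 x, e3 y, ← hs, ← hs, e1, e3, e2, e3, e2, hs])
  have hπS (x : H) : π (S x) = S (π x) := by
    have : Commute (r * s) S := hcomm.mul_left ((Commute.refl S).pow_left _)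
    exact congr($(this.eq) x)
  -- Each step removes S² in two cancellations: the first for an algebra map into the opposite
  -- algebra, the second for an ordinary one.
  have key (j : ℕ) (hj : j ≤ n) (x : H) :
      ((antipodeSq k H) ^ (n - j)) (π x) = ((antipodeSq k H) ^ (n - j)) x := by
    induction j generalizing x with
    | zero => rw [Nat.sub_zero, hpow, hpow]; exact e2 x
    | succ j ih =>
      obtain ⟨m, hm⟩ : ∃ m, n - j = m + 1 := ⟨n - j - 1, by omega⟩
      have hm' : n - (j + 1) = m := by omega
      rw [hm'] at *
      have ih' := ih (by omega)
      rw [hm] at ih'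
      have h1 := comp_eq_of_antipode_comp_eq (opAntipode ((antipodeSq k H) ^ m)) π hπS
        (fun x => by
          rw [opAntipode_apply, opAntipode_apply]
          congr 1
          have := ih' x
          rw [pow_succ, AlgHom.mul_apply, AlgHom.mul_apply] at this
          exact this)
      refine comp_eq_of_antipode_comp_eq ((antipodeSq k H) ^ m) π hπS (fun x => ?_) x
      exact op_injective (h1 x)
  have hid (x : H) : π x = x := by simpa using key n le_rfl x
  have hinj : Function.Injective S := by
    intro x y hxy
    rw [← hid x, ← hid y]
    change r (s x) = r (s y)
    congr 1
    obtain ⟨m, hm⟩ : ∃ m, 2 * n = m + 1 := ⟨2 * n - 1, by omega⟩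
    rw [hsdef, hm, pow_succ, Module.End.mul_apply, Module.End.mul_apply, hxy]
  exact ⟨hinj, LinearMap.injective_iff_surjective.1 hinj⟩

variable (k H) in
/-- The antipode of a finite-dimensional Hopf algebra as a linear equivalence. -/
def antipodeEquiv [FiniteDimensional k H] : H ≃ₗ[k] H :=
  LinearEquiv.ofBijective (antipode k) (antipode_bijective k H)

variable (k H) in
/-- The inverse of the antipode. -/
def antipodeInv [FiniteDimensional k H] : H →ₗ[k] H := (antipodeEquiv k H).symm.toLinearMap

section

variable [FiniteDimensional k H]

@[simp] lemma antipode_antipodeInv (h : H) : antipode k (antipodeInv k H h) = h :=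
  (antipodeEquiv k H).apply_symm_apply h

@[simp] lemma antipodeInv_antipode (h : H) : antipodeInv k H (antipode k h) = h :=
  (antipodeEquiv k H).symm_apply_apply h

lemma antipodeInv_mul (x y : H) :
    antipodeInv k H (x * y) = antipodeInv k H y * antipodeInv k H x := by
  apply (antipode_bijective k H).1
  simp [antipode_mul_antidistrib]

@[simp] lemma antipodeInv_one : antipodeInv k H (1 : H) = 1 := by
  apply (antipode_bijective k H).1
  simp

/-- S⁻¹ is the antipode for the opposite multiplication: apply S⁻¹ to the antipode axiom. -/
lemma opConv_antipodeInv_mul (φ : H →ₐ[k] A) :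
    opConv (φ.toLinearMap ∘ₗ antipodeInv k H) * opConv φ.toLinearMap = 1 := by
  refine conv_ext fun h => ?_
  rw [opConv_mul_apply]
  apply unop_injective
  have := congr(φ (antipodeInv k H $(sum_mul_antipode_eq_algebraMap_counit (ℛ k h))))
  simp only [map_sum, antipodeInv_mul, antipodeInv_antipode, map_mul,
    Algebra.algebraMap_eq_smul_one, map_smul, antipodeInv_one, map_one] at this
  simpa [Algebra.algebraMap_eq_smul_one] using this

end

end AntipodeBijective

/-! ### Convolution products of commuting algebra homomorphisms -/

section ConvHom

variable {k H A : Type*} [Field k] [Ring H] [HopfAlgebra k H] [Ring A] [Algebra k A]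

/-- The convolution product of two algebra homomorphisms with commuting images. -/
def convHom (φ ψ : H →ₐ[k] A) (hc : ∀ x y, Commute (φ x) (ψ y)) : H →ₐ[k] A :=
  (Algebra.TensorProduct.lift φ ψ hc).comp (Bialgebra.comulAlgHom k H)

lemma toConv_convHom (φ ψ : H →ₐ[k] A) (hc : ∀ x y, Commute (φ x) (ψ y)) :
    toConv (convHom φ ψ hc).toLinearMap = toConv φ.toLinearMap * toConv ψ.toLinearMap := by
  refine conv_ext fun h => ?_
  rw [(ℛ k h).convMul_apply]
  change (Algebra.TensorProduct.lift φ ψ hc) (comul h) = _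
  conv_lhs => rw [← (ℛ k h).eq, map_sum]
  simp

/-- Both sides invert the convolution product φ * ψ, and the inverse of a product reverses the
factors. -/
lemma toConv_convHom_antipode (φ ψ : H →ₐ[k] A) (hc : ∀ x y, Commute (φ x) (ψ y)) :
    toConv ((convHom φ ψ hc).toLinearMap ∘ₗ antipode k) =
      toConv (ψ.toLinearMap ∘ₗ antipode k) * toConv (φ.toLinearMap ∘ₗ antipode k) := by
  refine left_inv_eq_right_inv (antipode_mul_algHom (convHom φ ψ hc)) ?_
  rw [toConv_convHom, mul_assoc, ← mul_assoc (toConv ψ.toLinearMap), algHom_mul_antipode, one_mul,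
    algHom_mul_antipode]

/-- The comultiplication is the convolution product of the two inclusions H → H ⊗ H, so the formula
for the inverse of a product applies. -/
lemma comul_antipode (h : H) : comul (R := k) (antipode k h) =
    TensorProduct.map (antipode k) (antipode k) (TensorProduct.comm k H H (comul h)) := by
  have hc (x y : H) : Commute ((Algebra.TensorProduct.includeLeft : H →ₐ[k] H ⊗[k] H) x)
      ((Algebra.TensorProduct.includeRight : H →ₐ[k] H ⊗[k] H) y) := by
    simp [Commute, SemiconjBy]
  have h1 := congr($(toConv_convHom_antipode _ _ hc) h)
  rw [(ℛ k h).convMul_apply] at h1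
  have h2 : ∀ x : H, convHom _ _ hc x = comul (R := k) x := by
    intro x
    change Algebra.TensorProduct.lift _ _ hc (comul x) = _
    conv_lhs => rw [← (ℛ k x).eq, map_sum]
    conv_rhs => rw [← (ℛ k x).eq]
    simp
  change convHom _ _ hc (antipode k h) = _ at h1
  rw [h2] at h1
  rw [h1]
  conv_rhs => rw [← (ℛ k h).eq, map_sum, map_sum]
  simp

end ConvHom

end HopfExponent
end

open scoped TensorProduct

noncomputable section

namespace HopfExponent

open WithConv LinearMap Coalgebra HopfAlgebra MulOpposite

/-! ### Coaction elements -/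

section Coact

variable {k H C D B : Type*} [Field k] [Ring H] [HopfAlgebra k H]
  [Ring C] [Algebra k C] [Ring D] [Algebra k D] [Ring B] [Algebra k B]

/-- An element of `H ⊗ C` encoding a left coaction by operators from `C`. -/
structure IsCoact (δ : H ⊗[k] C) : Prop where
  coassoc : Algebra.TensorProduct.map (Bialgebra.comulAlgHom k H) (AlgHom.id k C) δ =
    Algebra.TensorProduct.map
      (Algebra.TensorProduct.includeRight : H →ₐ[k] H ⊗[k] H) (AlgHom.id k C) δ *
    Algebra.TensorProduct.map
      (Algebra.TensorProduct.includeLeft : H →ₐ[k] H ⊗[k] H) (AlgHom.id k C) δ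
  counit : Algebra.TensorProduct.lid k C
    (Algebra.TensorProduct.map (Bialgebra.counitAlgHom k H) (AlgHom.id k C) δ) = 1

lemma map_id_comp_map {H₁ H₂ : Type*} [Ring H₁] [Algebra k H₁] [Ring H₂] [Algebra k H₂]
    (f : H₁ →ₐ[k] H₂) (j : C →ₐ[k] D) (x : H₁ ⊗[k] C) :
    Algebra.TensorProduct.map f (AlgHom.id k D) (Algebra.TensorProduct.map (AlgHom.id k H₁) j x) =
    Algebra.TensorProduct.map (AlgHom.id k H₂) j
      (Algebra.TensorProduct.map f (AlgHom.id k C) x) := by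
  induction x with
  | zero => simp
  | tmul a b => simp
  | add a b ha hb => simp [ha, hb]

lemma lid_map_id (j : C →ₐ[k] D) (x : k ⊗[k] C) :
    Algebra.TensorProduct.lid k D (Algebra.TensorProduct.map (AlgHom.id k k) j x) =
      j (Algebra.TensorProduct.lid k C x) := by
  induction x with
  | zero => simp
  | tmul a b => simp
  | add a b ha hb => simp [ha, hb]

lemma IsCoact.map {δ : H ⊗[k] C} (hδ : IsCoact δ) (j : C →ₐ[k] D) :
    IsCoact (Algebra.TensorProduct.map (AlgHom.id k H) j δ) where
  coassoc := by
    rw [map_id_comp_map, map_id_comp_map, map_id_comp_map, hδ.coassoc, map_mul]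
  counit := by
    rw [map_id_comp_map, lid_map_id, hδ.counit, map_one]

/-- Both axioms are equations in tensor products, and over a field tensoring preserves the
injectivity of j. This is used to restrict structures to subalgebras. -/
lemma IsCoact.of_map_injective {δ : H ⊗[k] C} (j : C →ₐ[k] D) (hj : Function.Injective j)
    (h : IsCoact (Algebra.TensorProduct.map (AlgHom.id k H) j δ)) : IsCoact δ where
  coassoc := by
    have hinj : Function.Injective (Algebra.TensorProduct.map (AlgHom.id k (H ⊗[k] H)) j) :=
      Module.Flat.lTensor_preserves_injective_linearMap (M := H ⊗[k] H) j.toLinearMap hj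
    apply hinj
    have := h.coassoc
    rwa [map_id_comp_map, map_id_comp_map, map_id_comp_map, ← map_mul] at this
  counit := by
    apply hj
    have := h.counit
    rwa [map_id_comp_map, lid_map_id, ← map_one j] at this

lemma IsCoact.mul {δ δ' : H ⊗[k] C} (hδ : IsCoact δ) (hδ' : IsCoact δ')
    (hc : Commute (Algebra.TensorProduct.map
        (Algebra.TensorProduct.includeLeft : H →ₐ[k] H ⊗[k] H) (AlgHom.id k C) δ)
      (Algebra.TensorProduct.map
        (Algebra.TensorProduct.includeRight : H →ₐ[k] H ⊗[k] H) (AlgHom.id k C) δ')) :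
    IsCoact (δ * δ') where
  coassoc := by
    rw [map_mul, map_mul, map_mul, hδ.coassoc, hδ'.coassoc, mul_assoc, mul_assoc,
      ← mul_assoc _ _ (Algebra.TensorProduct.map Algebra.TensorProduct.includeLeft _ δ'),
      hc.eq, mul_assoc]
  counit := by
    rw [map_mul, map_mul, hδ.counit, hδ'.counit, one_mul]

variable [FiniteDimensional k H]

variable (k H) in
/-- A chosen basis of `H`. -/
def bas : Module.Basis (Fin (Module.finrank k H)) k H := Module.finBasis k H

/-- The coefficients of an element of `H ⊗ C` with respect to the chosen basis of `H`. -/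
def cf (δ : H ⊗[k] C) (i : Fin (Module.finrank k H)) : C :=
  TensorProduct.lid k C (((bas k H).coord i).rTensor C δ)

lemma sum_cf (δ : H ⊗[k] C) : ∑ i, bas k H i ⊗ₜ[k] cf δ i = δ := by
  induction δ with
  | zero => simp [cf]
  | tmul a b =>
    simp only [cf, rTensor_tmul, Module.Basis.coord_apply, TensorProduct.lid_tmul]
    conv_rhs => rw [← (bas k H).sum_repr a, TensorProduct.sum_tmul]
    simp [TensorProduct.smul_tmul]
  | add a b ha hb =>
    conv_rhs => rw [← ha, ← hb]
    simp [cf, TensorProduct.tmul_add, Finset.sum_add_distrib]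

lemma cf_map (j : C →ₐ[k] D) (δ : H ⊗[k] C) (i) :
    cf (Algebra.TensorProduct.map (AlgHom.id k H) j δ) i = j (cf δ i) := by
  induction δ with
  | zero => simp [cf]
  | tmul a b => simp [cf]
  | add a b ha hb =>
    rw [map_add]
    simp only [cf, map_add] at ha hb ⊢
    rw [ha, hb]

/-- Coassociativity in coordinates. The order of the coefficients is reversed because δ acts by
operators: the leg of the coaction applied first is the left one. -/
lemma IsCoact.sum_apply {M : Type*} [AddCommGroup M] [Module k M] {δ : H ⊗[k] C}
    (hδ : IsCoact δ) (Φ : (H ⊗[k] H) ⊗[k] C →ₗ[k] M) :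
    ∑ i, Φ (comul (bas k H i) ⊗ₜ cf δ i) =
      ∑ i, ∑ j, Φ ((bas k H i ⊗ₜ bas k H j) ⊗ₜ (cf δ j * cf δ i)) := by
  have h := congrArg Φ hδ.coassoc
  conv_lhs at h => rw [← sum_cf δ]
  conv_rhs at h => rw [← sum_cf δ]
  simp only [map_sum, Finset.sum_mul_sum] at h
  rw [Finset.sum_comm] at h
  simpa using h

lemma IsCoact.sum_counit {δ : H ⊗[k] C} (hδ : IsCoact δ) :
    ∑ i, Coalgebra.counit (R := k) (bas k H i) • cf δ i = 1 := by
  have h := hδ.counit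
  conv_lhs at h => rw [← sum_cf δ]
  simpa using h

lemma IsCoact.sum_left {δ : H ⊗[k] C} (hδ : IsCoact δ) (f g : WithConv (H →ₗ[k] B))
    (m : C →ₗ[k] B) : ∑ i, (f * g) (bas k H i) * m (cf δ i) =
      ∑ i, ∑ j, f (bas k H i) * g (bas k H j) * m (cf δ j * cf δ i) :=
  hδ.sum_apply (mul' k B ∘ₗ TensorProduct.map (mul' k B ∘ₗ TensorProduct.map f.ofConv g.ofConv) m)

lemma IsCoact.sum_right {δ : H ⊗[k] C} (hδ : IsCoact δ) (f g : WithConv (H →ₗ[k] B))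
    (m : C →ₗ[k] B) : ∑ i, m (cf δ i) * (f * g) (bas k H i) =
      ∑ i, ∑ j, m (cf δ j * cf δ i) * (f (bas k H i) * g (bas k H j)) :=
  hδ.sum_apply (mul' k B ∘ₗ (TensorProduct.comm k B B).toLinearMap ∘ₗ
    TensorProduct.map (mul' k B ∘ₗ TensorProduct.map f.ofConv g.ofConv) m)

lemma IsCoact.sum_end {M : Type*} [AddCommGroup M] [Module k M] {δ : H ⊗[k] C} (hδ : IsCoact δ)
    (f g : WithConv (H →ₗ[k] Module.End k M)) (m : C →ₗ[k] M) :
    ∑ i, (f * g) (bas k H i) (m (cf δ i)) =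
      ∑ i, ∑ j, f (bas k H i) (g (bas k H j) (m (cf δ j * cf δ i))) :=
  hδ.sum_apply (TensorProduct.lift (LinearMap.id : Module.End k M →ₗ[k] M →ₗ[k] M) ∘ₗ
    TensorProduct.map (mul' k _ ∘ₗ TensorProduct.map f.ofConv g.ofConv) m)

lemma IsCoact.sum_end_op {M : Type*} [AddCommGroup M] [Module k M] {δ : H ⊗[k] C}
    (hδ : IsCoact δ) (f g : WithConv (H →ₗ[k] (Module.End k M)ᵐᵒᵖ)) (m : C →ₗ[k] M) :
    ∑ i, ((f * g) (bas k H i)).unop (m (cf δ i)) =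
      ∑ i, ∑ j, (g (bas k H j)).unop ((f (bas k H i)).unop (m (cf δ j * cf δ i))) :=
  hδ.sum_apply (TensorProduct.lift ((opLinearEquiv k).symm.toLinearMap :
      (Module.End k M)ᵐᵒᵖ →ₗ[k] M →ₗ[k] M) ∘ₗ
    TensorProduct.map (mul' k _ ∘ₗ TensorProduct.map f.ofConv g.ofConv) m)

end Coact

end HopfExponent
end

open scoped TensorProduct

noncomputable section

namespace HopfExponent

open WithConv LinearMap Coalgebra HopfAlgebra MulOpposite

/-! ### Yetter–Drinfeld structures on algebras -/

variable (k H E : Type*) [Field k] [Ring H] [HopfAlgebra k H] [Ring E] [Algebra k E]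

/-- A Yetter–Drinfeld structure on an algebra `E`: an action `ρ` of `H` and a coaction element
`δ ∈ H ⊗ E`, satisfying `(h₁ ⊗ ρ(h₂)) δ = δ (h₂ ⊗ ρ(h₁))`. -/
structure YD where
  ρ : H →ₐ[k] E
  δ : H ⊗[k] E
  coact : IsCoact δ
  compat : ∀ h : H, Algebra.TensorProduct.map (AlgHom.id k H) ρ (comul h) * δ =
    δ * Algebra.TensorProduct.map (AlgHom.id k H) ρ (TensorProduct.comm k H H (comul h))

namespace YD

variable {k H E}
variable {E' : Type*} [Ring E'] [Algebra k E']

/-- Push-forward of a Yetter–Drinfeld structure along an algebra homomorphism. -/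
@[simps]
def map (Y : YD k H E) (j : E →ₐ[k] E') : YD k H E' where
  ρ := j.comp Y.ρ
  δ := Algebra.TensorProduct.map (AlgHom.id k H) j Y.δ
  coact := Y.coact.map j
  compat h := by
    have h1 (x : H ⊗[k] H) : Algebra.TensorProduct.map (AlgHom.id k H) (j.comp Y.ρ) x =
        Algebra.TensorProduct.map (AlgHom.id k H) j
          (Algebra.TensorProduct.map (AlgHom.id k H) Y.ρ x) := by
      induction x with
      | zero => simp
      | tmul a b => simp
      | add a b ha hb => simp [ha, hb]
    rw [h1, h1, ← map_mul, ← map_mul, Y.compat]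

/-- The Drinfeld element `u = ∑ ρ(S(δ')) δ''`. -/
def u (Y : YD k H E) : E :=
  mul' k E (TensorProduct.map (Y.ρ.toLinearMap ∘ₗ antipode k) LinearMap.id Y.δ)

/-- The element `s = ∑ δ'' ρ(S(δ'))`. -/
def s (Y : YD k H E) : E :=
  mul' k E (TensorProduct.comm k E E
    (TensorProduct.map (Y.ρ.toLinearMap ∘ₗ antipode k) LinearMap.id Y.δ))

lemma map_u (Y : YD k H E) (j : E →ₐ[k] E') : (Y.map j).u = j Y.u := by
  simp only [u, map_ρ, map_δ]
  induction Y.δ with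
  | zero => simp
  | tmul a b => simp
  | add a b ha hb => simp only [map_add, ha, hb]

lemma map_s (Y : YD k H E) (j : E →ₐ[k] E') : (Y.map j).s = j Y.s := by
  simp only [s, map_ρ, map_δ]
  induction Y.δ with
  | zero => simp
  | tmul a b => simp
  | add a b ha hb => simp only [map_add, ha, hb]

variable [FiniteDimensional k H]

/-- The coefficients of the coaction element. -/
def d (Y : YD k H E) (i : Fin (Module.finrank k H)) : E := cf Y.δ i

lemma u_eq_sum (Y : YD k H E) : Y.u = ∑ i, Y.ρ (antipode k (bas k H i)) * Y.d i := by
  conv_lhs => rw [u, ← sum_cf Y.δ]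
  simp [d]

lemma s_eq_sum (Y : YD k H E) : Y.s = ∑ i, Y.d i * Y.ρ (antipode k (bas k H i)) := by
  conv_lhs => rw [s, ← sum_cf Y.δ]
  simp [d]

/-- The Yetter–Drinfeld condition in coordinates, tested against an arbitrary linear map. -/
lemma sum_compat (Y : YD k H E) (h : H) {M : Type*} [AddCommGroup M] [Module k M]
    (Φ : H ⊗[k] E →ₗ[k] M) :
    ∑ i, ∑ r ∈ (ℛ k h).index,
      Φ (((ℛ k h).left r * bas k H i) ⊗ₜ (Y.ρ ((ℛ k h).right r) * Y.d i)) =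
    ∑ i, ∑ r ∈ (ℛ k h).index,
      Φ ((bas k H i * (ℛ k h).right r) ⊗ₜ (Y.d i * Y.ρ ((ℛ k h).left r))) := by
  have h1 := congrArg Φ (Y.compat h)
  rw [← sum_cf Y.δ, ← (ℛ k h).eq] at h1
  simp only [map_sum, Finset.sum_mul_sum, TensorProduct.comm_tmul,
    Algebra.TensorProduct.map_tmul, AlgHom.coe_id, id_eq, Algebra.TensorProduct.tmul_mul_tmul]
    at h1
  rw [Finset.sum_comm] at h1
  exact h1

lemma sum_compat_left (Y : YD k H E) (h : H) {B : Type*} [Ring B] [Algebra k B]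
    (F : H →ₗ[k] B) (G : E →ₗ[k] B) :
    ∑ i, ∑ r ∈ (ℛ k h).index,
      F ((ℛ k h).left r * bas k H i) * G (Y.ρ ((ℛ k h).right r) * Y.d i) =
    ∑ i, ∑ r ∈ (ℛ k h).index,
      F (bas k H i * (ℛ k h).right r) * G (Y.d i * Y.ρ ((ℛ k h).left r)) :=
  Y.sum_compat h (mul' k B ∘ₗ TensorProduct.map F G)

lemma sum_compat_right (Y : YD k H E) (h : H) {B : Type*} [Ring B] [Algebra k B]
    (F : H →ₗ[k] B) (G : E →ₗ[k] B) :
    ∑ i, ∑ r ∈ (ℛ k h).index,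
      G (Y.ρ ((ℛ k h).right r) * Y.d i) * F ((ℛ k h).left r * bas k H i) =
    ∑ i, ∑ r ∈ (ℛ k h).index,
      G (Y.d i * Y.ρ ((ℛ k h).left r)) * F (bas k H i * (ℛ k h).right r) :=
  Y.sum_compat h (mul' k B ∘ₗ (TensorProduct.comm k B B).toLinearMap ∘ₗ TensorProduct.map F G)

/-- `∑ ρ(S(h₂)) u ρ(h₁) = ε(h) u`. -/
lemma opConv_u (Y : YD k H E) :
    opConv Y.ρ.toLinearMap * cst k H (op Y.u) * opConv (Y.ρ.toLinearMap ∘ₗ antipode k) =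
      cst k H (op Y.u) := by
  refine conv_ext fun h => unop_injective ?_
  rw [(ℛ k h).convMul_apply]
  simp only [mul_cst_apply, opConv_apply, cst_apply, unop_smul, unop_op,
    Finset.unop_sum, unop_mul, comp_apply, AlgHom.toLinearMap_apply]
  have h1 := Y.sum_compat_left h (Y.ρ.toLinearMap ∘ₗ antipode k) LinearMap.id
  simp only [comp_apply, AlgHom.toLinearMap_apply, antipode_mul_antidistrib, map_mul,
    LinearMap.id_apply] at h1
  rw [u_eq_sum]
  calc _ = _ := ?_
    _ = _ := h1.symm
    _ = _ := ?_
  · rw [Finset.sum_comm]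
    simp only [Finset.mul_sum, Finset.sum_mul, mul_assoc]
  · rw [Finset.smul_sum]
    refine Finset.sum_congr rfl fun i _ => ?_
    have h2 := congr(Y.ρ $(sum_antipode_mul_eq_smul (ℛ k h)))
    simp only [map_sum, map_mul, map_smul, map_one] at h2
    calc _ = Y.ρ (antipode k (bas k H i)) * (∑ r ∈ (ℛ k h).index,
        Y.ρ (antipode k ((ℛ k h).left r)) * Y.ρ ((ℛ k h).right r)) * Y.d i := by
          simp only [Finset.mul_sum, Finset.sum_mul, mul_assoc]
      _ = _ := by rw [h2]; simp

/-- `∑ ρ(h₂) s ρ(S(h₁)) = ε(h) s`. -/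
lemma opConv_s (Y : YD k H E) :
    opConv (Y.ρ.toLinearMap ∘ₗ antipode k) * cst k H (op Y.s) * opConv Y.ρ.toLinearMap =
      cst k H (op Y.s) := by
  refine conv_ext fun h => unop_injective ?_
  rw [(ℛ k h).convMul_apply]
  simp only [mul_cst_apply, opConv_apply, cst_apply, unop_smul, unop_op,
    Finset.unop_sum, unop_mul, comp_apply, AlgHom.toLinearMap_apply]
  have h1 := Y.sum_compat_right h (Y.ρ.toLinearMap ∘ₗ antipode k) LinearMap.id
  simp only [comp_apply, AlgHom.toLinearMap_apply, antipode_mul_antidistrib, map_mul,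
    LinearMap.id_apply] at h1
  rw [s_eq_sum]
  calc _ = _ := ?_
    _ = _ := h1
    _ = _ := ?_
  · rw [Finset.sum_comm]
    simp only [Finset.mul_sum, Finset.sum_mul, mul_assoc]
  · rw [Finset.smul_sum]
    refine Finset.sum_congr rfl fun i _ => ?_
    have h2 := congr(Y.ρ $(sum_mul_antipode_eq_smul (ℛ k h)))
    simp only [map_sum, map_mul, map_smul, map_one] at h2
    calc _ = Y.d i * (∑ r ∈ (ℛ k h).index,
        Y.ρ ((ℛ k h).left r) * Y.ρ (antipode k ((ℛ k h).right r))) *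
          Y.ρ (antipode k (bas k H i)) := by
          simp only [Finset.mul_sum, Finset.sum_mul, mul_assoc]
      _ = _ := by rw [h2]; simp

/-- Move the factor ρ ∘ S in `opConv_u` to the other side by its inverse ρ ∘ S² in the opposite
convolution algebra. -/
lemma u_mul_ρ (Y : YD k H E) (h : H) :
    Y.u * Y.ρ h = Y.ρ (antipode k (antipode k h)) * Y.u := by
  have h1 := congrArg
    (· * opConv (Y.ρ.toLinearMap ∘ₗ antipode k ∘ₗ antipode k)) Y.opConv_u
  simp only [mul_assoc, opConv_antipode_mul, mul_one] at h1
  have h2 := congr($h1 h)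
  rw [mul_cst_apply, cst_mul_apply] at h2
  exact op_injective h2

lemma ρ_mul_s (Y : YD k H E) (h : H) :
    Y.ρ h * Y.s = Y.s * Y.ρ (antipode k (antipode k h)) := by
  have h1 := congrArg
    (opConv (Y.ρ.toLinearMap ∘ₗ antipode k ∘ₗ antipode k) * ·) Y.opConv_s
  simp only [← mul_assoc, opConv_mul_antipode, one_mul] at h1
  have h2 := congr($h1 h)
  rw [mul_cst_apply, cst_mul_apply] at h2
  exact op_injective h2

/-- Right inverse of `u`. -/
lemma u_mul_inv (Y : YD k H E) :
    Y.u * ∑ i, Y.ρ (antipodeInv k H (antipodeInv k H (bas k H i))) * Y.d i = 1 := by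
  -- Write 1 = ∑ ε(b_i) d_i and replace ε by ρ * (ρ ∘ S). Coassociativity then makes u appear
  -- between ρ(b_i) and d_i, and commuting ρ(b_i) past u produces S⁻².
  have h1 := Y.coact.sum_left (toConv Y.ρ.toLinearMap) (toConv (Y.ρ.toLinearMap ∘ₗ antipode k))
    LinearMap.id
  rw [algHom_mul_antipode] at h1
  simp only [convOne_apply, LinearMap.id_apply, ← Algebra.smul_def, Y.coact.sum_counit] at h1
  rw [h1, Finset.mul_sum]
  refine Finset.sum_congr rfl fun i _ => ?_
  rw [← mul_assoc, u_mul_ρ, antipode_antipodeInv, antipode_antipodeInv, u_eq_sum,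
    Finset.mul_sum, Finset.sum_mul]
  simp [mul_assoc, d]

/-- Left inverse of `s`. -/
lemma inv_mul_s (Y : YD k H E) :
    (∑ i, Y.d i * Y.ρ (antipodeInv k H (antipodeInv k H (bas k H i)))) * Y.s = 1 := by
  have h1 := Y.coact.sum_right (toConv (Y.ρ.toLinearMap ∘ₗ antipode k)) (toConv Y.ρ.toLinearMap)
    LinearMap.id
  rw [antipode_mul_algHom] at h1
  simp only [convOne_apply, LinearMap.id_apply, ← Algebra.commutes, ← Algebra.smul_def,
    Y.coact.sum_counit] at h1
  rw [h1, Finset.sum_mul, Finset.sum_comm]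
  refine Finset.sum_congr rfl fun i _ => ?_
  rw [mul_assoc, ρ_mul_s, antipode_antipodeInv, antipode_antipodeInv, s_eq_sum,
    Finset.sum_mul, Finset.mul_sum]
  simp [mul_assoc, d]

end YD
end HopfExponent
end

open scoped TensorProduct

noncomputable section

namespace HopfExponent

open WithConv LinearMap Coalgebra HopfAlgebra MulOpposite

/-! ### Commutation of u and s with the coaction -/

namespace YD

variable {k H E : Type*} [Field k] [Ring H] [HopfAlgebra k H] [Ring E] [Algebra k E]

section Contract

variable {B : Type*} [Ring B] [Algebra k B]

/-- The compatibility condition after applying algebra homomorphisms to both legs. -/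
lemma conv_compat (Y : YD k H E) (f : H →ₐ[k] B) (j : E →ₐ[k] B)
    (hc : ∀ x y, Commute (f x) (j y)) :
    toConv f.toLinearMap * toConv (j.comp Y.ρ).toLinearMap *
        cst k H (Algebra.TensorProduct.lift f j hc Y.δ) =
      cst k H (Algebra.TensorProduct.lift f j hc Y.δ) *
        toConv (j.comp Y.ρ).toLinearMap * toConv f.toLinearMap := by
  refine conv_ext fun h => ?_
  rw [mul_cst_apply, mul_assoc, cst_mul_apply, (ℛ k h).convMul_apply, (ℛ k h).convMul_apply]
  have h1 := congrArg (Algebra.TensorProduct.lift f j hc) (Y.compat h)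
  rw [map_mul, map_mul, ← (ℛ k h).eq] at h1
  simp only [map_sum, TensorProduct.comm_tmul, Algebra.TensorProduct.map_tmul, AlgHom.coe_id,
    id_eq, Algebra.TensorProduct.lift_tmul] at h1
  have h2 : ∀ x y, f x * j y = j y * f x := fun x y => hc x y
  simp only [h2 ((ℛ k h).right _)] at h1
  exact h1

/-- Multiply abx = xba on both sides by b⁻¹a⁻¹ and a⁻¹b⁻¹, the inverses being obtained by composing
with S. -/
lemma conv_compat_inv (Y : YD k H E) (f : H →ₐ[k] B) (j : E →ₐ[k] B)
    (hc : ∀ x y, Commute (f x) (j y)) :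
    cst k H (Algebra.TensorProduct.lift f j hc Y.δ) *
        toConv (f.toLinearMap ∘ₗ antipode k) *
        toConv ((j.comp Y.ρ).toLinearMap ∘ₗ antipode k) =
      toConv ((j.comp Y.ρ).toLinearMap ∘ₗ antipode k) * toConv (f.toLinearMap ∘ₗ antipode k) *
        cst k H (Algebra.TensorProduct.lift f j hc Y.δ) := by
  have h1 := Y.conv_compat f j hc
  set a := toConv f.toLinearMap
  set b := toConv (j.comp Y.ρ).toLinearMap
  set a' := toConv (f.toLinearMap ∘ₗ antipode k)
  set b' := toConv ((j.comp Y.ρ).toLinearMap ∘ₗ antipode k)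
  set x := cst k H (Algebra.TensorProduct.lift f j hc Y.δ)
  have ha : a * a' = 1 := algHom_mul_antipode f
  have ha' : a' * a = 1 := antipode_mul_algHom f
  have hb : b * b' = 1 := algHom_mul_antipode (j.comp Y.ρ)
  have hb' : b' * b = 1 := antipode_mul_algHom (j.comp Y.ρ)
  calc x * a' * b' = b' * (a' * a) * b * x * a' * b' := by rw [ha', mul_one, hb', one_mul]
    _ = b' * a' * (a * b * x) * a' * b' := by simp only [mul_assoc]
    _ = b' * a' * x * b * (a * a') * b' := by rw [h1]; simp only [mul_assoc]
    _ = _ := by rw [ha, mul_one, mul_assoc, hb, mul_one]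

/-- The inverted compatibility condition in the opposite algebra. -/
lemma opConv_compat_inv (Y : YD k H E) (f : H →ₐ[k] B) (j : E →ₐ[k] B)
    (hc : ∀ x y, Commute (f x) (j y)) :
    opConv (f.toLinearMap ∘ₗ antipode k) * opConv ((j.comp Y.ρ).toLinearMap ∘ₗ antipode k) *
        cst k H (op (Algebra.TensorProduct.lift f j hc Y.δ)) =
      cst k H (op (Algebra.TensorProduct.lift f j hc Y.δ)) *
        opConv ((j.comp Y.ρ).toLinearMap ∘ₗ antipode k) *
        opConv (f.toLinearMap ∘ₗ antipode k) := by
  have h1 := Y.conv_compat_inv f j hc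
  rw [opConv_mul_of_commute, mul_assoc, opConv_mul_of_commute]
  · refine conv_ext fun h => ?_
    rw [mul_cst_apply, cst_mul_apply]
    have h2 := congr($h1 h)
    rw [mul_cst_apply, mul_assoc, cst_mul_apply] at h2
    exact congrArg op h2
  · exact fun x y => (hc _ _).symm
  · exact fun x y => hc _ _

end Contract

variable [FiniteDimensional k H]

open Algebra.TensorProduct (includeLeft includeRight)

omit [FiniteDimensional k H] in
lemma commute_include (x : H) (y : E) : Commute
    ((includeLeft : H →ₐ[k] H ⊗[k] E) x) ((includeRight : E →ₐ[k] H ⊗[k] E) y) := by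
  simp [Commute, SemiconjBy]

omit [FiniteDimensional k H] in
lemma lift_include (x : H ⊗[k] E) (hc) : Algebra.TensorProduct.lift
    (includeLeft : H →ₐ[k] H ⊗[k] E) (includeRight : E →ₐ[k] H ⊗[k] E) hc x = x := by
  induction x with
  | zero => simp
  | tmul a b => simp
  | add a b ha hb => rw [map_add, ha, hb]

/-- `δ (1 ⊗ u) = (1 ⊗ u) (S² ⊗ 1) δ`. -/
lemma δ_mul_u (Y : YD k H E) : Y.δ * (1 ⊗ₜ Y.u) =
    (1 ⊗ₜ Y.u) * Algebra.TensorProduct.map (antipodeSq k H) (AlgHom.id k E) Y.δ := by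
  let α : H →ₐ[k] (H ⊗[k] E) := includeLeft
  let j : E →ₐ[k] (H ⊗[k] E) := includeRight
  have hc : ∀ x y, Commute (α x) (j y) := commute_include
  let Lm : (H ⊗[k] E) →ₐ[k] Module.End k (H ⊗[k] E) := Algebra.lmul k (H ⊗[k] E)
  let R (f : H →ₗ[k] (H ⊗[k] E)) : WithConv (H →ₗ[k] Module.End k (H ⊗[k] E)) := toConv ((LinearMap.mul k (H ⊗[k] E)).flip ∘ₗ f)
  let Lc (f : H →ₗ[k] (H ⊗[k] E)) : WithConv (H →ₗ[k] Module.End k (H ⊗[k] E)) := toConv (Lm.toLinearMap ∘ₗ f)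
  have hL (f g : H →ₗ[k] (H ⊗[k] E)) : Lc (toConv f * toConv g).ofConv = Lc f * Lc g :=
    ofConv_injective (algHom_comp_convMul_distrib Lm (toConv f) (toConv g))
  have h1 := Y.opConv_compat_inv α j hc
  rw [lift_include] at h1
  set sa := α.toLinearMap ∘ₗ antipode k
  set sb := (j.comp Y.ρ).toLinearMap ∘ₗ antipode k
  set saa := α.toLinearMap ∘ₗ antipode k ∘ₗ antipode k with hsaa
  have h2 := congrArg (opConv saa * ·) h1
  simp only [← mul_assoc] at h2
  rw [opConv_mul_antipode, one_mul, mul_assoc _ (opConv sb) (opConv sa),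
    opConv_mul_of_commute (f := sb) (g := sa) (fun x y => (hc _ _).symm)] at h2
  set g := (toConv sb * toConv sa).ofConv
  -- In Sweedler notation: δ (1 ⊗ ρ(S h)) = ∑ (S(h₃) ⊗ ρ(S h₂)) δ (S²(h₁) ⊗ 1). Left and right
  -- multiplications become operators so that the right side is a convolution product evaluated at
  -- δ.
  have h3 (h : H) : Y.δ * sb h = (R saa * Lc g) h Y.δ := by
    have := congr(($h2 h).unop)
    rw [mul_cst_apply, mul_assoc, (ℛ k h).convMul_apply] at this
    simp only [cst_mul_apply, Finset.unop_sum] at this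
    rw [(ℛ k h).convMul_apply, LinearMap.sum_apply]
    refine this.trans (Finset.sum_congr rfl fun i _ => ?_)
    rfl
  have h4 (h : H) (x : (H ⊗[k] E)) (e : E) : (R saa * Lc g) h x * j e = (R saa * Lc g) h (x * j e) := by
    rw [(ℛ k h).convMul_apply, LinearMap.sum_apply, LinearMap.sum_apply, Finset.sum_mul]
    refine Finset.sum_congr rfl fun i _ => ?_
    change g _ * x * saa _ * j e = g _ * (x * j e) * saa _
    rw [mul_assoc _ (saa _), mul_assoc, mul_assoc, mul_assoc]
    congr 2
    exact hc _ _
  have hαj (x : H) (e : E) : α x * j e = x ⊗ₜ e := by simp [α, j]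
  have hδ : Y.δ = ∑ i, α (bas k H i) * j (Y.d i) := by
    conv_lhs => rw [← sum_cf Y.δ]
    simp only [hαj, d]
  -- After coassociativity the H-leg of δ stands next to the factor S(h₃) and cancels it.
  have hLα : Lc sa * Lc α.toLinearMap = 1 := antipode_mul_algHom (Lm.comp α)
  calc Y.δ * (1 ⊗ₜ Y.u) = ∑ i, Y.δ * sb (bas k H i) * j (Y.d i) := by
        rw [u_eq_sum, TensorProduct.tmul_sum, Finset.mul_sum]
        refine Finset.sum_congr rfl fun i _ => ?_
        rw [mul_assoc]
        congr 1
        exact map_mul j _ _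
    _ = ∑ i, (R saa * Lc g) (bas k H i) (∑ l, α (bas k H l) * j (Y.d l * Y.d i)) := by
        refine Finset.sum_congr rfl fun i _ => ?_
        rw [h3, h4]
        congr 1
        conv_lhs => rw [hδ, Finset.sum_mul]
        simp only [mul_assoc, map_mul]
    _ = ∑ i, (R saa * Lc g * Lc α.toLinearMap) (bas k H i) (j (Y.d i)) := by
        refine Eq.trans ?_ (Y.coact.sum_end (R saa * Lc g) (Lc α.toLinearMap) j.toLinearMap).symm
        simp only [map_sum]
        rfl
    _ = ∑ i, (R saa * Lc sb) (bas k H i) (j (Y.d i)) := by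
        rw [hL, mul_assoc, mul_assoc, hLα, mul_one]
    _ = ∑ i, ∑ l, sb (bas k H l) * j (Y.d l * Y.d i) * saa (bas k H i) :=
        Y.coact.sum_end (R saa) (Lc sb) j.toLinearMap
    _ = ∑ i, j Y.u * (saa (bas k H i) * j (Y.d i)) := by
        refine Finset.sum_congr rfl fun i _ => ?_
        have : saa (bas k H i) * j (Y.d i) = j (Y.d i) * saa (bas k H i) := hc _ _
        rw [this, u_eq_sum, map_sum, Finset.sum_mul]
        refine Finset.sum_congr rfl fun l _ => ?_
        simp only [map_mul, sb, ← mul_assoc]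
        rfl
    _ = _ := by
        rw [← Finset.mul_sum]
        congr 1
        conv_rhs => rw [← sum_cf Y.δ]
        rw [map_sum]
        exact Finset.sum_congr rfl fun i _ => hαj _ _

variable (k) in
/-- Right multiplication, as an algebra homomorphism. -/
def rmulOp (A : Type*) [Ring A] [Algebra k A] : A →ₐ[k] (Module.End k A)ᵐᵒᵖ :=
  AlgHom.ofLinearMap ((opLinearEquiv k).toLinearMap ∘ₗ (LinearMap.mul k A).flip)
    (unop_injective (by ext; simp))
    (fun x y => unop_injective (by ext; simp [mul_assoc]))

/-- `(1 ⊗ s) δ = (S² ⊗ 1) δ (1 ⊗ s)`. -/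
lemma s_mul_δ (Y : YD k H E) : (1 ⊗ₜ Y.s) * Y.δ =
    Algebra.TensorProduct.map (antipodeSq k H) (AlgHom.id k E) Y.δ * (1 ⊗ₜ Y.s) := by
  let α : H →ₐ[k] (H ⊗[k] E) := includeLeft
  let j : E →ₐ[k] (H ⊗[k] E) := includeRight
  have hc : ∀ x y, Commute (α x) (j y) := commute_include
  let Rm := rmulOp k (H ⊗[k] E)
  let Rc (f : H →ₗ[k] (H ⊗[k] E)) : WithConv (H →ₗ[k] (Module.End k (H ⊗[k] E))ᵐᵒᵖ) :=
    toConv (Rm.toLinearMap ∘ₗ f)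
  let Lo (f : H →ₗ[k] (H ⊗[k] E)) : WithConv (H →ₗ[k] (Module.End k (H ⊗[k] E))ᵐᵒᵖ) :=
    toConv ((opLinearEquiv k).toLinearMap ∘ₗ LinearMap.mul k (H ⊗[k] E) ∘ₗ f)
  have hR (f g : H →ₗ[k] (H ⊗[k] E)) : Rc (toConv f * toConv g).ofConv = Rc f * Rc g :=
    ofConv_injective (algHom_comp_convMul_distrib Rm (toConv f) (toConv g))
  have h1 := Y.opConv_compat_inv α j hc
  rw [lift_include] at h1
  set sa := α.toLinearMap ∘ₗ antipode k
  set sb := (j.comp Y.ρ).toLinearMap ∘ₗ antipode k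
  set saa := α.toLinearMap ∘ₗ antipode k ∘ₗ antipode k with hsaa
  have h2 := congrArg (· * opConv saa) h1
  simp only [mul_assoc] at h2
  rw [opConv_antipode_mul, mul_one, ← mul_assoc (opConv sa) (opConv sb),
    opConv_mul_of_commute (f := sa) (g := sb) (fun x y => hc _ _)] at h2
  set g := (toConv sa * toConv sb).ofConv
  -- Mirror formula: (1 ⊗ ρ(S h)) δ = ∑ (S²(h₃) ⊗ 1) δ (S(h₁) ⊗ ρ(S h₂)).
  have h3 (h : H) : sb h * Y.δ = ((Rc g * Lo saa) h).unop Y.δ := by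
    have := congr(($h2 h).unop)
    rw [cst_mul_apply, (ℛ k h).convMul_apply] at this
    simp only [cst_mul_apply, Finset.unop_sum] at this
    rw [(ℛ k h).convMul_apply, Finset.unop_sum, LinearMap.sum_apply]
    refine this.symm.trans (Finset.sum_congr rfl fun i _ => ?_)
    exact mul_assoc _ _ _
  have h4 (h : H) (x : (H ⊗[k] E)) (e : E) : j e * ((Rc g * Lo saa) h).unop x =
      ((Rc g * Lo saa) h).unop (j e * x) := by
    rw [(ℛ k h).convMul_apply, Finset.unop_sum, LinearMap.sum_apply, LinearMap.sum_apply,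
      Finset.mul_sum]
    refine Finset.sum_congr rfl fun i _ => ?_
    change j e * (saa _ * (x * g _)) = saa _ * (j e * x * g _)
    rw [← mul_assoc, ← mul_assoc, ← mul_assoc, ← mul_assoc]
    congr 2
    exact (hc _ _).symm
  have hαj (x : H) (e : E) : j e * α x = x ⊗ₜ e := by simp [α, j]
  have hδ : Y.δ = ∑ i, j (Y.d i) * α (bas k H i) := by
    conv_lhs => rw [← sum_cf Y.δ]
    simp only [hαj, d]
  have hRα : Rc α.toLinearMap * Rc sa = 1 := algHom_mul_antipode (Rm.comp α)
  calc (1 ⊗ₜ Y.s) * Y.δ = ∑ i, j (Y.d i) * (sb (bas k H i) * Y.δ) := by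
        rw [s_eq_sum, TensorProduct.tmul_sum, Finset.sum_mul]
        refine Finset.sum_congr rfl fun i _ => ?_
        rw [← mul_assoc]
        congr 1
        exact map_mul j _ _
    _ = ∑ i, ((Rc g * Lo saa) (bas k H i)).unop
          (∑ l, j (Y.d i * Y.d l) * α (bas k H l)) := by
        refine Finset.sum_congr rfl fun i _ => ?_
        rw [h3, h4]
        congr 1
        conv_lhs => rw [hδ, Finset.mul_sum]
        simp only [mul_assoc, map_mul]
    _ = ∑ i, ((Rc α.toLinearMap * (Rc g * Lo saa)) (bas k H i)).unop (j (Y.d i)) := by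
        refine Eq.trans ?_
          (Y.coact.sum_end_op (Rc α.toLinearMap) (Rc g * Lo saa) j.toLinearMap).symm
        simp only [map_sum]
        rw [Finset.sum_comm]
        rfl
    _ = ∑ i, ((Rc sb * Lo saa) (bas k H i)).unop (j (Y.d i)) := by
        rw [hR, ← mul_assoc, ← mul_assoc, hRα, one_mul]
    _ = ∑ i, ∑ l, saa (bas k H l) * (j (Y.d l * Y.d i) * sb (bas k H i)) :=
        Y.coact.sum_end_op (Rc sb) (Lo saa) j.toLinearMap
    _ = ∑ l, (saa (bas k H l) * j (Y.d l)) * j Y.s := by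
        rw [Finset.sum_comm]
        refine Finset.sum_congr rfl fun i _ => ?_
        rw [s_eq_sum, map_sum, Finset.mul_sum]
        refine Finset.sum_congr rfl fun l _ => ?_
        simp only [map_mul, sb, mul_assoc]
        rfl
    _ = _ := by
        rw [← Finset.sum_mul]
        congr 1
        conv_rhs => rw [← sum_cf Y.δ]
        rw [map_sum]
        exact Finset.sum_congr rfl fun i _ => (hc _ _).eq.trans (hαj _ _)

end YD
end HopfExponent
end

open scoped TensorProduct

noncomputable section

namespace HopfExponent

open WithConv LinearMap Coalgebra HopfAlgebra MulOpposite

/-! ### Tensor products of Yetter–Drinfeld structures and the double braiding -/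

namespace YD

open Algebra.TensorProduct (includeLeft includeRight)

variable {k H B : Type*} [Field k] [Ring H] [HopfAlgebra k H] [Ring B] [Algebra k B]

lemma compat_of_conv (ρ : H →ₐ[k] B) (δ : H ⊗[k] B)
    (h1 : toConv (includeLeft : H →ₐ[k] H ⊗[k] B).toLinearMap *
        toConv ((includeRight : B →ₐ[k] H ⊗[k] B).comp ρ).toLinearMap * cst k H δ =
      cst k H δ * toConv ((includeRight : B →ₐ[k] H ⊗[k] B).comp ρ).toLinearMap *
        toConv (includeLeft : H →ₐ[k] H ⊗[k] B).toLinearMap) (h : H) :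
    Algebra.TensorProduct.map (AlgHom.id k H) ρ (comul h) * δ =
    δ * Algebra.TensorProduct.map (AlgHom.id k H) ρ (TensorProduct.comm k H H (comul h)) := by
  have h2 := congr($h1 h)
  rw [mul_cst_apply, mul_assoc, cst_mul_apply, (ℛ k h).convMul_apply, (ℛ k h).convMul_apply] at h2
  rw [← (ℛ k h).eq]
  simp only [map_sum, TensorProduct.comm_tmul, Algebra.TensorProduct.map_tmul, AlgHom.coe_id,
    id_eq]
  simpa using h2

variable [FiniteDimensional k H]

/-- Two Yetter–Drinfeld structures on the same algebra commute. -/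
structure Comm (Y Z : YD k H B) : Prop where
  ρρ : ∀ x y, Commute (Y.ρ x) (Z.ρ y)
  ρd : ∀ x i, Commute (Y.ρ x) (Z.d i)
  dρ : ∀ i x, Commute (Y.d i) (Z.ρ x)
  dd : ∀ i l, Commute (Y.d i) (Z.d l)

lemma Comm.symm {Y Z : YD k H B} (hc : Comm Y Z) : Comm Z Y where
  ρρ x y := (hc.ρρ y x).symm
  ρd x i := (hc.dρ i x).symm
  dρ i x := (hc.ρd x i).symm
  dd i l := (hc.dd l i).symm

/-- The tensor product of two commuting Yetter–Drinfeld structures. -/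
@[simps]
def tensor (Y Z : YD k H B) (hc : Comm Y Z) : YD k H B where
  ρ := convHom Y.ρ Z.ρ hc.ρρ
  δ := Y.δ * Z.δ
  coact := by
    refine Y.coact.mul Z.coact ?_
    rw [← sum_cf Y.δ, ← sum_cf Z.δ, map_sum, map_sum]
    refine Commute.sum_left _ _ _ fun i _ => Commute.sum_right _ _ _ fun l _ => ?_
    have := (hc.dd i l).eq
    simp only [d] at this
    simp [Commute, SemiconjBy, this]
  compat := by
    refine compat_of_conv _ _ ?_
    set a := toConv (includeLeft : H →ₐ[k] H ⊗[k] B).toLinearMap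
    set b₁ := toConv ((includeRight : B →ₐ[k] H ⊗[k] B).comp Y.ρ).toLinearMap with hb₁
    set b₂ := toConv ((includeRight : B →ₐ[k] H ⊗[k] B).comp Z.ρ).toLinearMap with hb₂
    have hb : toConv ((includeRight : B →ₐ[k] H ⊗[k] B).comp
        (convHom Y.ρ Z.ρ hc.ρρ)).toLinearMap = b₁ * b₂ := by
      have h1 := algHom_comp_convMul_distrib (includeRight : B →ₐ[k] H ⊗[k] B)
        (toConv Y.ρ.toLinearMap) (toConv Z.ρ.toLinearMap)
      rw [← toConv_convHom _ _ hc.ρρ] at h1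
      exact ofConv_injective h1
    have hY : a * b₁ * cst k H Y.δ = cst k H Y.δ * b₁ * a := by
      have := Y.conv_compat includeLeft (includeRight : B →ₐ[k] H ⊗[k] B) commute_include
      rwa [lift_include] at this
    have hZ : a * b₂ * cst k H Z.δ = cst k H Z.δ * b₂ * a := by
      have := Z.conv_compat includeLeft (includeRight : B →ₐ[k] H ⊗[k] B) commute_include
      rwa [lift_include] at this
    have c2 : cst k H Y.δ * b₂ = b₂ * cst k H Y.δ := by
      refine conv_ext fun h => ?_
      rw [cst_mul_apply, mul_cst_apply, ← sum_cf Y.δ, Finset.sum_mul, Finset.mul_sum]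
      refine Finset.sum_congr rfl fun i _ => ?_
      have := (hc.dρ i h).eq
      simp only [d] at this
      simp [hb₂, this]
    have c1 : cst k H Z.δ * b₁ = b₁ * cst k H Z.δ := by
      refine conv_ext fun h => ?_
      rw [cst_mul_apply, mul_cst_apply, ← sum_cf Z.δ, Finset.sum_mul, Finset.mul_sum]
      refine Finset.sum_congr rfl fun i _ => ?_
      have := (hc.ρd h i).eq
      simp only [d] at this
      simp [hb₁, this]
    rw [hb, ← cst_mul_cst]
    calc a * (b₁ * b₂) * (cst k H Y.δ * cst k H Z.δ)
        = a * b₁ * (b₂ * cst k H Y.δ) * cst k H Z.δ := by simp only [mul_assoc]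
      _ = (a * b₁ * cst k H Y.δ) * b₂ * cst k H Z.δ := by rw [← c2]; simp only [mul_assoc]
      _ = cst k H Y.δ * b₁ * (a * b₂ * cst k H Z.δ) := by rw [hY]; simp only [mul_assoc]
      _ = cst k H Y.δ * (b₁ * cst k H Z.δ) * b₂ * a := by rw [hZ]; simp only [mul_assoc]
      _ = _ := by rw [← c1]; simp only [mul_assoc]

/-- The element `∑ δ_Y'' ρ_Z(δ_Y')`. -/
def r (Y Z : YD k H B) : B := ∑ i, Y.d i * Z.ρ (bas k H i)

variable {Y Z : YD k H B}

/-- This is H-linearity of the braiding up to the flip: push the H-leg of the compatibility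
condition of Y into the action of Z. -/
lemma conv_ρ_r (hc : Comm Y Z) :
    toConv Z.ρ.toLinearMap * toConv Y.ρ.toLinearMap * cst k H (r Y Z) =
      cst k H (r Y Z) * toConv Y.ρ.toLinearMap * toConv Z.ρ.toLinearMap := by
  refine conv_ext fun h => ?_
  rw [mul_cst_apply, mul_assoc, cst_mul_apply, (ℛ k h).convMul_apply, (ℛ k h).convMul_apply, r]
  have h1 := Y.sum_compat_left h Z.ρ.toLinearMap LinearMap.id
  simp only [AlgHom.toLinearMap_apply, map_mul, LinearMap.id_apply] at h1
  calc _ = _ := ?_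
    _ = _ := h1
    _ = _ := ?_
  · rw [Finset.sum_mul_sum, Finset.sum_comm]
    refine Finset.sum_congr rfl fun i _ => Finset.sum_congr rfl fun l _ => ?_
    rw [(hc.dρ _ _).eq, mul_assoc, mul_assoc, ← mul_assoc (Z.ρ (bas k H i)), ← (hc.ρρ _ _).eq,
      mul_assoc]
    rfl
  · rw [Finset.sum_mul_sum]
    refine Finset.sum_congr rfl fun i _ => Finset.sum_congr rfl fun l _ => ?_
    change _ = Y.d i * Z.ρ (bas k H i) * (Y.ρ _ * Z.ρ _)
    rw [(hc.ρρ _ _).eq, mul_assoc (Y.d i), ← mul_assoc (Z.ρ _) (Z.ρ _), ← mul_assoc (Y.d i),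
      ← map_mul, (hc.dρ _ _).eq, mul_assoc]

/-- Two applications of `conv_ρ_r`: the first exchanges the order of the two actions and the second
restores it. -/
lemma Q_commute (hc : Comm Y Z) (h : H) :
    (r Z Y * r Y Z) * (tensor Y Z hc).ρ h = (tensor Y Z hc).ρ h * (r Z Y * r Y Z) := by
  have h1 := conv_ρ_r hc
  have h2 := conv_ρ_r hc.symm
  have h3 : cst k H (r Z Y * r Y Z) * toConv (convHom Y.ρ Z.ρ hc.ρρ).toLinearMap =
      toConv (convHom Y.ρ Z.ρ hc.ρρ).toLinearMap * cst k H (r Z Y * r Y Z) := by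
    rw [toConv_convHom, ← cst_mul_cst, mul_assoc, ← mul_assoc (cst k H (r Y Z)), ← h1,
      ← mul_assoc, ← mul_assoc, ← h2]
    simp only [mul_assoc]
  have h4 := congr($h3 h)
  rwa [cst_mul_apply, mul_cst_apply] at h4

lemma tensor_u_eq_sum (hc : Comm Y Z) : (tensor Y Z hc).u = ∑ k', ∑ i,
    (tensor Y Z hc).ρ (antipode k (bas k H k')) * (tensor Y Z hc).ρ (antipode k (bas k H i)) *
      (Y.d i * Z.d k') := by
  conv_lhs => rw [u, tensor_δ, ← sum_cf Y.δ, ← sum_cf Z.δ, Finset.sum_mul_sum, Finset.sum_comm]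
  simp [d, antipode_mul_antidistrib]

lemma tensor_s_eq_sum (hc : Comm Y Z) : (tensor Y Z hc).s = ∑ i, ∑ k', (Y.d i * Z.d k') *
    ((tensor Y Z hc).ρ (antipode k (bas k H k')) *
      (tensor Y Z hc).ρ (antipode k (bas k H i))) := by
  conv_lhs => rw [s, tensor_δ, ← sum_cf Y.δ, ← sum_cf Z.δ, Finset.sum_mul_sum]
  simp [d, antipode_mul_antidistrib]

lemma opConv_tensor_antipode (hc : Comm Y Z) :
    opConv ((tensor Y Z hc).ρ.toLinearMap ∘ₗ antipode k) =
      opConv (Z.ρ.toLinearMap ∘ₗ antipode k) * opConv (Y.ρ.toLinearMap ∘ₗ antipode k) := by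
  rw [opConv_mul_of_commute]
  · rw [← toConv_convHom_antipode _ _ hc.ρρ]; rfl
  · exact fun x y => (hc.ρρ _ _).symm

lemma commute_u_right (hc : Comm Y Z) (i) : Commute (Y.d i) Z.u := by
  rw [u_eq_sum]
  exact Commute.sum_right _ _ _ fun l _ => (hc.dρ _ _).mul_right (hc.dd _ _)

lemma commute_s_left (hc : Comm Y Z) (i) : Commute Y.s (Z.d i) := by
  rw [s_eq_sum]
  exact Commute.sum_left _ _ _ fun l _ => (hc.dd _ _).mul_left (hc.ρd _ _)

/-- The element `r_{ZY} r_{YZ}` relates `u` of a tensor product to the product of the `u`. -/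
lemma Q_mul_tensor_u (hc : Comm Y Z) : (r Z Y * r Y Z) * (tensor Y Z hc).u = Y.u * Z.u := by
  set ρt := (tensor Y Z hc).ρ with hρt
  let f : WithConv (H →ₗ[k] B) :=
    toConv ((LinearMap.mul k B).flip (r Z Y) ∘ₗ ρt.toLinearMap ∘ₗ antipode k)
  let g : WithConv (H →ₗ[k] B) := toConv Z.ρ.toLinearMap
  -- Coassociativity of Y absorbs the factor `r Y Z`.
  have hA : ∑ i, ρt (antipode k (bas k H i)) * (r Z Y * r Y Z * Y.d i) =
      ∑ i, (f * g) (bas k H i) * Y.d i := by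
    refine Eq.trans ?_ (Y.coact.sum_left f g LinearMap.id).symm
    refine Finset.sum_congr rfl fun i _ => ?_
    have hr : r Y Z * Y.d i = ∑ l, Z.ρ (bas k H l) * (Y.d l * Y.d i) := by
      rw [r, Finset.sum_mul]
      refine Finset.sum_congr rfl fun l _ => ?_
      rw [(hc.dρ _ _).eq, mul_assoc]
    rw [mul_assoc, hr, Finset.mul_sum, Finset.mul_sum]
    refine Finset.sum_congr rfl fun l _ => ?_
    change _ = ρt (antipode k (bas k H i)) * r Z Y * Z.ρ (bas k H l) * (Y.d l * Y.d i)
    simp only [mul_assoc]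
  -- Coassociativity of Z turns `r Z Y` into an action of Y. It cancels the Y-part of the tensor
  -- action composed with S, and only the sum defining `Z.u` remains.
  have hW : ∑ l, ρt (antipode k (bas k H l)) * (r Z Y * Z.d l) = Z.u := by
    have h1 := Z.coact.sum_left (toConv (ρt.toLinearMap ∘ₗ antipode k))
      (toConv Y.ρ.toLinearMap) LinearMap.id
    have h2 : toConv (ρt.toLinearMap ∘ₗ antipode k) =
      toConv (Z.ρ.toLinearMap ∘ₗ antipode k) * toConv (Y.ρ.toLinearMap ∘ₗ antipode k) :=
      toConv_convHom_antipode _ _ hc.ρρ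
    rw [h2, mul_assoc, antipode_mul_algHom, mul_one, ← h2] at h1
    rw [u_eq_sum]
    refine Eq.trans ?_ h1.symm
    refine Finset.sum_congr rfl fun i _ => ?_
    have hr : r Z Y * Z.d i = ∑ l, Y.ρ (bas k H l) * (Z.d l * Z.d i) := by
      rw [r, Finset.sum_mul]
      refine Finset.sum_congr rfl fun l _ => ?_
      rw [← (hc.ρd _ _).eq, mul_assoc]
    rw [hr, Finset.mul_sum]
    refine Finset.sum_congr rfl fun l _ => ?_
    rw [← mul_assoc]
    rfl
  -- The compatibility of Z moves its action past d_l; then `hW` produces `Z.u` and `opConv_u` for Z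
  -- removes the Z-part of the action.
  have hN (h : H) : ∑ l, ρt (antipode k (bas k H l)) * ((f * g) h * Z.d l) =
      Y.ρ (antipode k h) * Z.u := by
    have h1 := Z.sum_compat_left h f.ofConv LinearMap.id
    have h2 : opConv Z.ρ.toLinearMap * cst k H (op Z.u) *
        opConv (ρt.toLinearMap ∘ₗ antipode k) =
        cst k H (op Z.u) * opConv (Y.ρ.toLinearMap ∘ₗ antipode k) := by
      rw [opConv_tensor_antipode, ← mul_assoc, Z.opConv_u]
    have h3 := congr(($h2 h).unop)
    rw [cst_mul_apply, (ℛ k h).convMul_apply] at h3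
    simp only [mul_cst_apply, Finset.unop_sum] at h3
    refine Eq.trans ?_ h3
    calc _ = _ := ?_
      _ = _ := h1
      _ = _ := ?_
    · refine Finset.sum_congr rfl fun l _ => ?_
      rw [(ℛ k h).convMul_apply, Finset.sum_mul, Finset.mul_sum]
      refine Finset.sum_congr rfl fun i _ => ?_
      change _ * (ρt (antipode k _) * r Z Y * Z.ρ _ * _) =
        ρt (antipode k (_ * _)) * r Z Y * (Z.ρ _ * _)
      rw [antipode_mul_antidistrib, map_mul]
      simp only [mul_assoc]
    · rw [Finset.sum_comm]
      refine Finset.sum_congr rfl fun i _ => ?_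
      change ∑ l, ρt (antipode k (_ * _)) * r Z Y * (Z.d l * Z.ρ _) =
        ρt (antipode k _) * (Z.u * Z.ρ _)
      rw [← hW, Finset.sum_mul, Finset.mul_sum]
      refine Finset.sum_congr rfl fun l _ => ?_
      rw [antipode_mul_antidistrib, map_mul]
      simp only [mul_assoc]
  calc (r Z Y * r Y Z) * (tensor Y Z hc).u
      = ∑ l, ρt (antipode k (bas k H l)) *
          ((∑ i, ρt (antipode k (bas k H i)) * (r Z Y * r Y Z * Y.d i)) * Z.d l) := by
        rw [tensor_u_eq_sum, Finset.mul_sum]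
        refine Finset.sum_congr rfl fun l _ => ?_
        rw [Finset.mul_sum, Finset.sum_mul, Finset.mul_sum]
        refine Finset.sum_congr rfl fun i _ => ?_
        rw [← map_mul, ← mul_assoc, Q_commute hc, map_mul]
        simp only [mul_assoc, hρt]
    _ = ∑ i, (∑ l, ρt (antipode k (bas k H l)) * ((f * g) (bas k H i) * Z.d l)) * Y.d i := by
        rw [hA]
        simp only [Finset.sum_mul, Finset.mul_sum]
        rw [Finset.sum_comm]
        refine Finset.sum_congr rfl fun i _ => Finset.sum_congr rfl fun l _ => ?_
        simp only [mul_assoc]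
        rw [(hc.dd _ _).eq]
    _ = _ := by
        rw [u_eq_sum Y, Finset.sum_mul]
        refine Finset.sum_congr rfl fun i _ => ?_
        rw [hN, mul_assoc, ← (commute_u_right hc i).eq, mul_assoc]

/-- Mirror image of `Q_mul_tensor_u`, with Q on the other side. Because of this, Q cancels from u
s⁻¹. -/
lemma tensor_s_mul_Q (hc : Comm Y Z) : (tensor Y Z hc).s * (r Z Y * r Y Z) = Y.s * Z.s := by
  set ρt := (tensor Y Z hc).ρ with hρt
  let f : WithConv (H →ₗ[k] B) := toConv Y.ρ.toLinearMap
  let g : WithConv (H →ₗ[k] B) :=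
    toConv (LinearMap.mul k B (r Y Z) ∘ₗ ρt.toLinearMap ∘ₗ antipode k)
  have hA : ∑ l, (Z.d l * (r Z Y * r Y Z)) * ρt (antipode k (bas k H l)) =
      ∑ l, Z.d l * (f * g) (bas k H l) := by
    refine Eq.trans ?_ (Z.coact.sum_right f g LinearMap.id).symm
    rw [Finset.sum_comm]
    refine Finset.sum_congr rfl fun i _ => ?_
    have hr : Z.d i * r Z Y = ∑ l, (Z.d i * Z.d l) * Y.ρ (bas k H l) := by
      simp only [r, Finset.mul_sum, mul_assoc]
    rw [← mul_assoc, hr, Finset.sum_mul, Finset.sum_mul]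
    refine Finset.sum_congr rfl fun l _ => ?_
    change _ = Z.d i * Z.d l * (Y.ρ (bas k H l) * (r Y Z * ρt (antipode k (bas k H i))))
    simp only [mul_assoc]
  have hW : ∑ i, (Y.d i * r Y Z) * ρt (antipode k (bas k H i)) = Y.s := by
    have h1 := Y.coact.sum_right (toConv Z.ρ.toLinearMap)
      (toConv (ρt.toLinearMap ∘ₗ antipode k)) LinearMap.id
    have h2 : toConv (ρt.toLinearMap ∘ₗ antipode k) =
      toConv (Z.ρ.toLinearMap ∘ₗ antipode k) * toConv (Y.ρ.toLinearMap ∘ₗ antipode k) :=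
      toConv_convHom_antipode _ _ hc.ρρ
    rw [h2, ← mul_assoc, algHom_mul_antipode, one_mul, ← h2] at h1
    rw [s_eq_sum]
    refine Eq.trans ?_ h1.symm
    rw [Finset.sum_comm]
    refine Finset.sum_congr rfl fun i _ => ?_
    have hr : Y.d i * r Y Z = ∑ l, (Y.d i * Y.d l) * Z.ρ (bas k H l) := by
      simp only [r, Finset.mul_sum, mul_assoc]
    rw [hr, Finset.sum_mul]
    refine Finset.sum_congr rfl fun l _ => ?_
    rw [mul_assoc]
    rfl
  have hN (h : H) : ∑ i, Y.d i * (f * g) h * ρt (antipode k (bas k H i)) =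
      Y.s * Z.ρ (antipode k h) := by
    have h1 := Y.sum_compat_right h g.ofConv LinearMap.id
    have h2 : opConv (ρt.toLinearMap ∘ₗ antipode k) * cst k H (op Y.s) *
        opConv Y.ρ.toLinearMap =
        opConv (Z.ρ.toLinearMap ∘ₗ antipode k) * cst k H (op Y.s) := by
      rw [opConv_tensor_antipode, mul_assoc, mul_assoc, ← mul_assoc (opConv (Y.ρ.toLinearMap ∘ₗ _)),
        Y.opConv_s]
    have h3 := congr(($h2 h).unop)
    rw [mul_cst_apply, (ℛ k h).convMul_apply] at h3
    simp only [mul_cst_apply, Finset.unop_sum] at h3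
    refine Eq.trans ?_ h3
    calc _ = _ := ?_
      _ = _ := h1.symm
      _ = _ := ?_
    · refine Finset.sum_congr rfl fun l _ => ?_
      rw [(ℛ k h).convMul_apply, Finset.mul_sum, Finset.sum_mul]
      refine Finset.sum_congr rfl fun i _ => ?_
      change _ * (Y.ρ _ * (r Y Z * ρt (antipode k _))) * _ =
        _ * Y.ρ _ * (r Y Z * ρt (antipode k (_ * _)))
      rw [antipode_mul_antidistrib, map_mul]
      simp only [mul_assoc]
    · rw [Finset.sum_comm]
      refine Finset.sum_congr rfl fun i _ => ?_
      change ∑ l, Y.ρ _ * Y.d l * (r Y Z * ρt (antipode k (_ * _))) =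
        Y.ρ _ * (Y.s * ρt (antipode k _))
      rw [← hW, Finset.sum_mul, Finset.mul_sum]
      refine Finset.sum_congr rfl fun l _ => ?_
      rw [antipode_mul_antidistrib, map_mul]
      simp only [mul_assoc]
  calc (tensor Y Z hc).s * (r Z Y * r Y Z)
      = ∑ i, Y.d i * (∑ l, (Z.d l * (r Z Y * r Y Z)) * ρt (antipode k (bas k H l))) *
          ρt (antipode k (bas k H i)) := by
        rw [tensor_s_eq_sum, Finset.sum_mul]
        refine Finset.sum_congr rfl fun i _ => ?_
        rw [Finset.mul_sum, Finset.sum_mul, Finset.sum_mul]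
        refine Finset.sum_congr rfl fun l _ => ?_
        rw [← map_mul, mul_assoc, ← Q_commute hc, map_mul]
        simp only [mul_assoc, hρt]
    _ = ∑ l, Z.d l * (∑ i, Y.d i * (f * g) (bas k H l) * ρt (antipode k (bas k H i))) := by
        rw [hA]
        simp only [Finset.sum_mul, Finset.mul_sum]
        rw [Finset.sum_comm]
        refine Finset.sum_congr rfl fun i _ => Finset.sum_congr rfl fun l _ => ?_
        simp only [← mul_assoc]
        rw [(hc.dd _ _).eq]
    _ = _ := by
        rw [s_eq_sum Z, Finset.mul_sum]
        refine Finset.sum_congr rfl fun i _ => ?_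
        rw [hN, ← mul_assoc, ← (commute_s_left hc i).eq, mul_assoc]

end YD
end HopfExponent
end

open scoped TensorProduct

noncomputable section

namespace HopfExponent

open WithConv LinearMap Coalgebra HopfAlgebra MulOpposite

/-! ### Finite-dimensional algebras -/

section FiniteDimensionalAlgebra

variable {K E F : Type*} [Field K] [Ring E] [Algebra K E] [FiniteDimensional K E]
  [Ring F] [Algebra K F] [FiniteDimensional K F]

variable (K) in
include K in
lemma mul_eq_one_symm_of_finite {x y : E} (h : x * y = 1) : y * x = 1 := by
  have : IsNoetherianRing E := IsNoetherianRing.of_finite K E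
  exact mul_eq_one_symm h

variable (K) in
include K in
lemma isUnit_of_mul_eq_one_of_finite {x y : E} (h : x * y = 1) : IsUnit x :=
  ⟨⟨x, y, h, mul_eq_one_symm_of_finite K h⟩, rfl⟩

variable (K) in
include K in
lemma isUnit_right_of_mul_eq_one_of_finite {x y : E} (h : x * y = 1) : IsUnit y :=
  ⟨⟨y, x, mul_eq_one_symm_of_finite K h, h⟩, rfl⟩

lemma det_tensorProduct_map (f : E →ₗ[K] E) (g : F →ₗ[K] F) :
    LinearMap.det (TensorProduct.map f g) =
      LinearMap.det f ^ Module.finrank K F * LinearMap.det g ^ Module.finrank K E := by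
  have b := Module.finBasis K E
  have c := Module.finBasis K F
  rw [← LinearMap.det_toMatrix (b.tensorProduct c), TensorProduct.toMatrix_map,
    Matrix.det_kronecker, LinearMap.det_toMatrix, LinearMap.det_toMatrix, Fintype.card_fin,
    Fintype.card_fin]

lemma norm_tmul_one (x : E) : Algebra.norm K (x ⊗ₜ[K] (1 : F)) =
    Algebra.norm K x ^ Module.finrank K F := by
  rw [Algebra.norm_apply, Algebra.norm_apply]
  have : Algebra.lmul K (E ⊗[K] F) (x ⊗ₜ 1) =
      TensorProduct.map (Algebra.lmul K E x) LinearMap.id := by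
    ext; simp
  rw [this, det_tensorProduct_map]
  simp

omit [FiniteDimensional K E] in
lemma norm_ne_zero_of_isUnit {x : E} (hx : IsUnit x) : Algebra.norm K x ≠ 0 :=
  (hx.map (Algebra.norm K)).ne_zero

lemma isOfFinOrder_of_pow {M : Type*} [Monoid M] {x : M} {n : ℕ} (hn : n ≠ 0)
    (h : IsOfFinOrder (x ^ n)) : IsOfFinOrder x := by
  rcases isOfFinOrder_pow.1 h with h | h
  · exact h
  · exact absurd h hn

/-- `c` is an eigenvalue of left multiplication by `x`. -/
abbrev IsEigenvalue (x : E) (c : K) : Prop := Module.End.HasEigenvalue (Algebra.lmul K E x) c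

omit [FiniteDimensional K E] in
lemma IsEigenvalue.exists_eq {x : E} {c : K} (h : IsEigenvalue x c) :
    ∃ y : E, y ≠ 0 ∧ x * y = c • y := by
  obtain ⟨y, hy⟩ := h.exists_hasEigenvector
  exact ⟨y, hy.2, hy.apply_eq_smul⟩

omit [FiniteDimensional K E] in
lemma isEigenvalue_of_eq {x y : E} {c : K} (hy : y ≠ 0) (h : x * y = c • y) :
    IsEigenvalue x c :=
  Module.End.hasEigenvalue_of_hasEigenvector (x := y)
    ⟨Module.End.mem_eigenspace_iff.2 h, hy⟩

lemma isEigenvalue_iff_isRoot {x : E} {c : K} : IsEigenvalue x c ↔ (minpoly K x).IsRoot c := by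
  rw [IsEigenvalue, Module.End.hasEigenvalue_iff_isRoot,
    minpoly.algHom_eq (Algebra.lmul K E) Algebra.lmul_injective]

/-- Eigenvalues of left multiplication are the roots of the minimal polynomial, which is unchanged
by the injective map y ↦ 1 ⊗ y. -/
lemma isEigenvalue_of_one_tmul {y : F} {c : K}
    (h : IsEigenvalue ((1 : E) ⊗ₜ[K] y) c) : IsEigenvalue y c := by
  have : Nontrivial E := by
    obtain ⟨w, hw, -⟩ := h.exists_eq
    by_contra hn
    rw [not_nontrivial_iff_subsingleton] at hn
    exact hw (Subsingleton.elim (α := E ⊗[K] F) _ _)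
  rw [isEigenvalue_iff_isRoot] at h ⊢
  have h1 := minpoly.algHom_eq (Algebra.TensorProduct.includeRight : F →ₐ[K] E ⊗[K] F)
    (Algebra.TensorProduct.includeRight_injective (algebraMap K E).injective) y
  rw [Algebra.TensorProduct.includeRight_apply] at h1
  rwa [← h1]

lemma IsEigenvalue.tmul {x : E} {y : F} {c d : K} (hx : IsEigenvalue x c)
    (hy : IsEigenvalue y d) : IsEigenvalue (x ⊗ₜ[K] y) (c * d) := by
  obtain ⟨v, hv, hxv⟩ := hx.exists_eq
  obtain ⟨w, hw, hyw⟩ := hy.exists_eq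
  refine isEigenvalue_of_eq (y := v ⊗ₜ w) ?_ ?_
  · intro h0
    obtain ⟨f, hf⟩ := not_forall.1 fun h => hv ((Module.forall_dual_apply_eq_zero_iff K v).1 h)
    obtain ⟨g, hg⟩ := not_forall.1 fun h => hw ((Module.forall_dual_apply_eq_zero_iff K w).1 h)
    have h1 := congrArg ((TensorProduct.lid K K).toLinearMap ∘ₗ TensorProduct.map f g) h0
    exact mul_ne_zero hf hg (by simpa using h1)
  · rw [Algebra.TensorProduct.tmul_mul_tmul, hxv, hyw, TensorProduct.smul_tmul_smul]

omit [FiniteDimensional K E] in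
lemma IsEigenvalue.of_semiconj {x y θ : E} (hθ : IsUnit θ) (h : x * θ = θ * y) {c : K}
    (hx : IsEigenvalue x c) : IsEigenvalue y c := by
  obtain ⟨t, rfl⟩ := hθ
  obtain ⟨v, hv, hxv⟩ := hx.exists_eq
  refine isEigenvalue_of_eq (y := ↑t⁻¹ * v) (fun h0 => hv ?_) ?_
  · simpa using h0
  · have : y = ↑t⁻¹ * (x * ↑t) := by rw [h]; simp
    rw [this]
    simp [mul_assoc, hxv]

lemma finite_isEigenvalue (x : E) : {c : K | IsEigenvalue x c}.Finite :=
  Module.End.finite_hasEigenvalue _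

omit [FiniteDimensional K E] in
lemma IsEigenvalue.ne_zero {x : E} (hx : IsUnit x) {c : K} (h : IsEigenvalue x c) : c ≠ 0 := by
  rintro rfl
  obtain ⟨v, hv, hxv⟩ := h.exists_eq
  rw [zero_smul] at hxv
  exact hv (hx.mul_right_eq_zero.1 hxv)

lemma exists_isEigenvalue [IsAlgClosed K] [Nontrivial E] (x : E) : ∃ c : K, IsEigenvalue x c :=
  Module.End.exists_eigenvalue _

/-- If multiplication by `c` preserves a finite nonempty set of nonzero scalars then `c` is a root
of unity. -/
lemma isOfFinOrder_of_mul_mem {s : Set K} (hs : s.Finite) (hne : s.Nonempty) (h0 : (0 : K) ∉ s)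
    {c : K} (hc : ∀ d ∈ s, c * d ∈ s) : IsOfFinOrder c := by
  obtain ⟨d, hd⟩ := hne
  have hmem (n : ℕ) : c ^ n * d ∈ s := by
    induction n with
    | zero => simpa
    | succ n ih => rw [pow_succ', mul_assoc]; exact hc _ ih
  have hd0 : d ≠ 0 := fun h => h0 (h ▸ hd)
  have hc0 : c ≠ 0 := fun h => h0 (by simpa [h] using hc d hd)
  have : Finite s := hs
  obtain ⟨m, n, hmn, hne⟩ : ∃ m n : ℕ, m < n ∧ c ^ m * d = c ^ n * d := by
    obtain ⟨m, n, hmn, h⟩ := Finite.exists_ne_map_eq_of_infinite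
      (fun n : ℕ => (⟨c ^ n * d, hmem n⟩ : s))
    have h' : c ^ m * d = c ^ n * d := congrArg Subtype.val h
    rcases lt_or_gt_of_ne hmn with h1 | h1
    · exact ⟨m, n, h1, h'⟩
    · exact ⟨n, m, h1, h'.symm⟩
  have h2 := mul_right_cancel₀ hd0 hne
  refine isOfFinOrder_iff_pow_eq_one.2 ⟨n - m, by omega, ?_⟩
  have h3 : c ^ m * c ^ (n - m) = c ^ m * 1 := by
    rw [← pow_add, mul_one, h2]; congr 1; omega
  exact mul_left_cancel₀ (pow_ne_zero _ hc0) h3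

open Polynomial in
open scoped Classical in
/-- Over an algebraically closed field of positive characteristic, an element all of whose
eigenvalues are roots of unity has finite order. -/
lemma isOfFinOrder_of_isEigenvalue [IsAlgClosed K] (p : ℕ) [Fact p.Prime] [CharP K p] (x : E)
    (h : ∀ c : K, IsEigenvalue x c → IsOfFinOrder c) : IsOfFinOrder x := by
  have h0 : minpoly K x ≠ 0 := minpoly.ne_zero (Algebra.IsIntegral.isIntegral x)
  obtain ⟨N, hN, hroot⟩ : ∃ N : ℕ, 0 < N ∧ ∀ c ∈ (minpoly K x).roots, c ^ N = 1 := by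
    refine ⟨∏ c ∈ (minpoly K x).roots.toFinset, orderOf c, ?_, fun c hc => ?_⟩
    · refine Finset.prod_pos fun c hc => ?_
      rw [Multiset.mem_toFinset, mem_roots h0] at hc
      exact (h c (isEigenvalue_iff_isRoot.2 hc)).orderOf_pos
    · exact orderOf_dvd_iff_pow_eq_one.1
        (Finset.dvd_prod_of_mem _ (Multiset.mem_toFinset.2 hc))
  set m := (minpoly K x).natDegree
  have hp : 1 < p := (Fact.out : p.Prime).one_lt
  -- Every root is an N-th root of unity of multiplicity at most m ≤ p^m. In characteristic p the
  -- right side equals X^{N p^m} - 1.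
  have hdvd : minpoly K x ∣ (X ^ N - 1) ^ p ^ m := by
    refine (IsAlgClosed.splits _).dvd_of_roots_le_roots h0 ?_
    rw [roots_pow, Multiset.le_iff_count]
    intro c
    rw [Multiset.count_nsmul]
    by_cases hc : c ∈ (minpoly K x).roots
    · have h1 : 1 ≤ Multiset.count c (X ^ N - 1 : K[X]).roots := by
        rw [Multiset.one_le_count_iff_mem, mem_roots (by simpa using X_pow_sub_C_ne_zero hN (1 : K))]
        simp [hroot c hc]
      calc _ ≤ Multiset.card (minpoly K x).roots := Multiset.count_le_card _ _
        _ ≤ m := card_roots' _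
        _ ≤ p ^ m := (Nat.lt_pow_self hp).le
        _ ≤ _ := Nat.le_mul_of_pos_right _ h1
    · rw [Multiset.count_eq_zero_of_notMem hc]
      exact Nat.zero_le _
  rw [sub_pow_char_pow] at hdvd
  obtain ⟨q, hq⟩ := hdvd
  have h1 := congrArg (aeval x) hq
  rw [map_mul, minpoly.aeval, zero_mul, one_pow, map_sub, map_one, sub_eq_zero, ← pow_mul] at h1
  refine isOfFinOrder_iff_pow_eq_one.2 ⟨N * p ^ m, by positivity, ?_⟩
  simpa using h1

end FiniteDimensionalAlgebra

/-! ### Invertibility of contracted coactions -/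

section Unit

variable {k H B : Type*} [Field k] [Ring H] [HopfAlgebra k H] [FiniteDimensional k H]
  [Ring B] [Algebra k B] [FiniteDimensional k B]

/-- The inverse is the same sum with f ∘ S⁻¹. The inverse antipode is needed because coassociativity
pairs the H-legs in the opposite order. This gives the invertibility of braidings and of the
intertwiners below. -/
lemma IsCoact.isUnit_sum {C : Type*} [Ring C] [Algebra k C] {δ : H ⊗[k] C} (hδ : IsCoact δ)
    (j : C →ₐ[k] B) (f : H →ₐ[k] B) (hc : ∀ h i, Commute (f h) (j (cf δ i))) :
    IsUnit (∑ i, j (cf δ i) * f (bas k H i)) := by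
  have h1 := hδ.sum_left (opConv (f.toLinearMap ∘ₗ antipodeInv k H)) (opConv f.toLinearMap)
    ((opLinearEquiv k).toLinearMap ∘ₗ j.toLinearMap)
  rw [opConv_antipodeInv_mul] at h1
  refine isUnit_of_mul_eq_one_of_finite k
    (y := ∑ i, j (cf δ i) * f (antipodeInv k H (bas k H i))) ?_
  have h2 := congrArg unop h1
  simp only [Finset.unop_sum, convOne_apply, ← Algebra.smul_def] at h2
  rw [Finset.sum_mul_sum, Finset.sum_comm]
  refine Eq.trans ?_ (h2.symm.trans ?_)
  · refine Finset.sum_congr rfl fun i _ => Finset.sum_congr rfl fun l _ => ?_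
    change _ = j (_ * _) * (f _ * f _)
    rw [mul_assoc, ← mul_assoc (f _), (hc _ _).eq, map_mul]
    simp only [mul_assoc]
  · have h3 := congrArg j hδ.sum_counit
    rw [map_one] at h3
    rw [← h3, map_sum]
    refine Finset.sum_congr rfl fun i _ => ?_
    rw [map_smul]
    rfl

end Unit

end HopfExponent
end

open scoped TensorProduct

noncomputable section

namespace HopfExponent

open WithConv LinearMap Coalgebra HopfAlgebra MulOpposite

open Algebra.TensorProduct (includeLeft includeRight)

/-! ### Coaction elements in endomorphism algebras -/

section Ev

variable {k P V : Type*} [Field k] [AddCommGroup P] [Module k P]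
  [AddCommGroup V] [Module k V] [FiniteDimensional k V]

variable (k P V) in
/-- The isomorphism `P ⊗ End V ≃ Hom(V, P ⊗ V)`. -/
def ev : P ⊗[k] Module.End k V ≃ₗ[k] (V →ₗ[k] P ⊗[k] V) := lTensorHomEquivHomLTensor k V P V

@[simp] lemma ev_tmul (p : P) (f : Module.End k V) (v : V) : ev k P V (p ⊗ₜ f) v = p ⊗ₜ f v := by
  rw [ev, lTensorHomEquivHomLTensor_apply]; rfl

variable {H : Type*} [Ring H] [HopfAlgebra k H]

lemma cf_apply [FiniteDimensional k H] (δ : H ⊗[k] Module.End k V) (i) (v : V) :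
    cf δ i v = TensorProduct.lid k V (((bas k H).coord i).rTensor V (ev k H V δ v)) := by
  induction δ with
  | zero => simp [cf]
  | tmul a b => simp [cf]
  | add a b ha hb => simp only [cf, map_add, LinearMap.add_apply] at ha hb ⊢; rw [ha, hb]

lemma ev_map {A P' : Type*} [Ring A] [Algebra k A] [Ring P'] [Algebra k P']
    (f : A →ₐ[k] P') (δ : A ⊗[k] Module.End k V) (v : V) :
    ev k P' V (Algebra.TensorProduct.map f (AlgHom.id k _) δ) v =
      f.toLinearMap.rTensor V (ev k A V δ v) := by
  induction δ with
  | zero => simp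
  | tmul a b => simp
  | add a b ha hb => simp only [map_add, LinearMap.add_apply, ha, hb]

lemma ev_mul (δ δ' : H ⊗[k] Module.End k V) (v : V) :
    ev k (H ⊗[k] H) V
      (Algebra.TensorProduct.map (includeRight : H →ₐ[k] H ⊗[k] H) (AlgHom.id k _) δ *
        Algebra.TensorProduct.map (includeLeft : H →ₐ[k] H ⊗[k] H) (AlgHom.id k _) δ') v =
    (TensorProduct.assoc k H H V).symm ((ev k H V δ).lTensor H (ev k H V δ' v)) := by
  induction δ with
  | zero => simp
  | add a b ha hb =>
    simp only [map_add, add_mul, LinearMap.add_apply, ha, hb, LinearMap.lTensor_add]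
  | tmul a b =>
    induction δ' with
    | zero => simp
    | add c d hc hd => simp only [map_add, mul_add, LinearMap.add_apply, hc, hd]
    | tmul c d => simp

lemma ev_mul_one_tmul (δ : H ⊗[k] Module.End k V) (f : Module.End k V) (v : V) :
    ev k H V (δ * (1 ⊗ₜ f)) v = ev k H V δ (f v) := by
  induction δ with
  | zero => simp
  | tmul a b => simp
  | add a b ha hb => simp only [map_add, add_mul, LinearMap.add_apply, ha, hb]

lemma ev_tmul_mul_mul (h h' : H) (f : Module.End k V) (δ : H ⊗[k] Module.End k V) (v : V) :
    ev k H V ((h ⊗ₜ f) * δ * (h' ⊗ₜ 1)) v =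
      TensorProduct.map (LinearMap.mulLeft k h ∘ₗ LinearMap.mulRight k h') f (ev k H V δ v) := by
  induction δ with
  | zero => simp
  | tmul a b => simp [mul_assoc]
  | add a b ha hb => simp only [map_add, mul_add, add_mul, LinearMap.add_apply, ha, hb]

/-- A comodule structure map gives a coaction element. -/
lemma isCoact_of_ev (δ : H ⊗[k] Module.End k V)
    (h1 : ∀ v, TensorProduct.assoc k H H V (comul.rTensor V (ev k H V δ v)) =
      (ev k H V δ).lTensor H (ev k H V δ v))
    (h2 : ∀ v, TensorProduct.lid k V (counit.rTensor V (ev k H V δ v)) = v) : IsCoact δ where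
  coassoc := by
    apply (ev k (H ⊗[k] H) V).injective
    ext v
    rw [ev_mul, ← h1, LinearEquiv.symm_apply_apply]
    rw [ev_map]
    rfl
  counit := by
    ext v
    have h3 (x : k ⊗[k] Module.End k V) : (Algebra.TensorProduct.lid k _ x) v =
        TensorProduct.lid k V (ev k k V x v) := by
      induction x with
      | zero => simp
      | tmul a b => simp
      | add a b ha hb => simp only [map_add, LinearMap.add_apply, ha, hb]
    rw [h3]
    rw [ev_map]
    exact h2 v

end Ev

/-! ### The left and right regular coactions -/

section Regular

variable (k H : Type*) [Field k] [Ring H] [HopfAlgebra k H] [FiniteDimensional k H]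

/-- The coaction element of the left regular comodule `x ↦ x₁ ⊗ x₂`. -/
def δL : H ⊗[k] Module.End k H := (ev k H H).symm comul

/-- The coaction element of the comodule `x ↦ S(x₂) ⊗ x₁`. -/
def δR : H ⊗[k] Module.End k H := (ev k H H).symm
  ((antipode k).rTensor H ∘ₗ (TensorProduct.comm k H H).toLinearMap ∘ₗ comul)

variable {k H}

lemma ev_δL (x : H) : ev k H H (δL k H) x = comul x := by simp [δL]

lemma ev_δR (x : H) : ev k H H (δR k H) x =
    (antipode k).rTensor H (TensorProduct.comm k H H (comul x)) := by simp [δR]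

lemma isCoact_δL : IsCoact (δL k H) := by
  refine isCoact_of_ev _ (fun v => ?_) (fun v => ?_)
  · rw [ev_δL]
    have : ev k H H (δL k H) = comul := by ext; simp [ev_δL]
    rw [this]
    exact coassoc_apply v
  · rw [ev_δL, rTensor_counit_comul]
    simp

lemma isCoact_δR : IsCoact (δR k H) := by
  refine isCoact_of_ev _ (fun v => ?_) (fun v => ?_)
  · rw [ev_δR]
    let Φ : (H ⊗[k] (H ⊗[k] H)) →ₗ[k] H ⊗[k] (H ⊗[k] H) :=
      (TensorProduct.map (antipode k) ((antipode k).rTensor H)) ∘ₗ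
      (TensorProduct.assoc k H H H).toLinearMap ∘ₗ
      (TensorProduct.comm k H (H ⊗[k] H)).toLinearMap ∘ₗ
      ((TensorProduct.comm k H H).toLinearMap).lTensor H
    have h1 (y : H ⊗[k] H) : TensorProduct.assoc k H H H
        (comul.rTensor H ((antipode k).rTensor H (TensorProduct.comm k H H y))) =
        Φ (comul.lTensor H y) := by
      induction y with
      | zero => simp
      | add a b ha hb => simp only [map_add, ha, hb]
      | tmul a b =>
        simp only [TensorProduct.comm_tmul, rTensor_tmul, lTensor_tmul, comul_antipode]
        rw [← (ℛ k b).eq]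
        simp [Φ, TensorProduct.sum_tmul, TensorProduct.tmul_sum]
    have h2 (y : H ⊗[k] H) : (ev k H H (δR k H)).lTensor H
        ((antipode k).rTensor H (TensorProduct.comm k H H y)) =
        Φ (TensorProduct.assoc k H H H (comul.rTensor H y)) := by
      induction y with
      | zero => simp
      | add a b ha hb => simp only [map_add, ha, hb]
      | tmul a b =>
        simp only [TensorProduct.comm_tmul, rTensor_tmul, lTensor_tmul, ev_δR]
        rw [← (ℛ k a).eq]
        simp [Φ, TensorProduct.sum_tmul, TensorProduct.tmul_sum]
    rw [h1, h2, coassoc_apply]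
  · rw [ev_δR, ← LinearMap.rTensor_comp_apply]
    have h1 (y : H ⊗[k] H) : TensorProduct.lid k H ((counit ∘ₗ antipode k).rTensor H
        (TensorProduct.comm k H H y)) = TensorProduct.rid k H (counit.lTensor H y) := by
      induction y with
      | zero => simp
      | add a b ha hb => simp only [map_add, ha, hb]
      | tmul a b => simp
    rw [h1, lTensor_counit_comul]
    simp

/-- Contracting x on the left and contracting it on the right commute; this is coassociativity with
functionals applied to the outer legs. -/
lemma commute_cf_δL_δR (i j) : Commute (cf (δL k H) i) (cf (δR k H) j) := by
  let φ := (bas k H).coord i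
  let ψ := (bas k H).coord j ∘ₗ antipode k
  let Φ : (H ⊗[k] (H ⊗[k] H)) →ₗ[k] H := (TensorProduct.lid k H).toLinearMap ∘ₗ
    TensorProduct.map φ ((TensorProduct.rid k H).toLinearMap ∘ₗ ψ.lTensor H)
  have hL (y : H) : cf (δL k H) i y = ∑ r ∈ (ℛ k y).index,
      φ ((ℛ k y).left r) • (ℛ k y).right r := by
    rw [cf_apply, ev_δL]
    conv_lhs => rw [← (ℛ k y).eq]
    simp [φ]
  have hR (y : H) : cf (δR k H) j y = ∑ r ∈ (ℛ k y).index,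
      ψ ((ℛ k y).right r) • (ℛ k y).left r := by
    rw [cf_apply, ev_δR]
    conv_lhs => rw [← (ℛ k y).eq]
    simp [ψ]
  have h1 (x : H) : cf (δL k H) i (cf (δR k H) j x) =
      Φ (TensorProduct.assoc k H H H (comul.rTensor H (comul x))) := by
    rw [hR, ← (ℛ k x).eq, map_sum, map_sum, map_sum, map_sum]
    refine Finset.sum_congr rfl fun r _ => ?_
    rw [map_smul, hL, rTensor_tmul]
    conv_rhs => rw [← (ℛ k ((ℛ k x).left r)).eq]
    simp [Φ, TensorProduct.sum_tmul, Finset.smul_sum, smul_comm (ψ _) (φ _)]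
  have h2 (x : H) : cf (δR k H) j (cf (δL k H) i x) = Φ (comul.lTensor H (comul x)) := by
    rw [hL, ← (ℛ k x).eq, map_sum, map_sum, map_sum]
    refine Finset.sum_congr rfl fun r _ => ?_
    rw [map_smul, hR, lTensor_tmul]
    conv_rhs => rw [← (ℛ k ((ℛ k x).right r)).eq]
    simp only [Φ, TensorProduct.tmul_sum, map_sum, Finset.smul_sum]
    refine Finset.sum_congr rfl fun q _ => ?_
    simp
    rw [smul_comm]
  refine LinearMap.ext fun x => ?_
  change cf (δL k H) i (cf (δR k H) j x) = cf (δR k H) j (cf (δL k H) i x)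
  rw [h1, h2, coassoc_apply]

lemma δL_mul (h : H) : δL k H * (1 ⊗ₜ Algebra.lmul k H h) =
    Algebra.TensorProduct.map (AlgHom.id k H) (Algebra.lmul k H) (comul h) * δL k H := by
  apply (ev k H H).injective
  ext x
  rw [ev_mul_one_tmul, ev_δL]
  have h1 (y : H ⊗[k] H) : ev k H H (Algebra.TensorProduct.map (AlgHom.id k H)
      (Algebra.lmul k H) y * δL k H) x = y * comul x := by
    induction y with
    | zero => simp
    | add a b ha hb => simp only [map_add, add_mul, LinearMap.add_apply, ha, hb]
    | tmul a b =>
      have := ev_tmul_mul_mul a 1 (Algebra.lmul k H b) (δL k H) x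
      rw [← Algebra.TensorProduct.one_def, mul_one, ev_δL] at this
      simp only [Algebra.TensorProduct.map_tmul, AlgHom.coe_id, id_eq]
      rw [this, ← (ℛ k x).eq]
      simp [Finset.mul_sum]
  rw [h1]
  exact Bialgebra.comul_mul h x

/-- Expand S((hx)₂) ⊗ (hx)₁ with S antimultiplicative: the second leg of h ends up as S(h₂) on the
right of the H-component. -/
lemma conv_δR : cst k H (δR k H) *
      toConv ((includeRight : _ →ₐ[k] H ⊗[k] Module.End k H).comp (Algebra.lmul k H)).toLinearMap =
    toConv ((includeRight : _ →ₐ[k] H ⊗[k] Module.End k H).comp (Algebra.lmul k H)).toLinearMap *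
      cst k H (δR k H) *
      toConv ((includeLeft : H →ₐ[k] H ⊗[k] Module.End k H).toLinearMap ∘ₗ antipode k) := by
  refine conv_ext fun h => ?_
  rw [cst_mul_apply, (ℛ k h).convMul_apply]
  simp only [mul_cst_apply]
  change δR k H * (1 ⊗ₜ Algebra.lmul k H h) = ∑ r ∈ (ℛ k h).index,
    (1 ⊗ₜ Algebra.lmul k H ((ℛ k h).left r)) * δR k H * (antipode k ((ℛ k h).right r) ⊗ₜ 1)
  apply (ev k H H).injective
  ext x
  rw [ev_mul_one_tmul, ev_δR, map_sum, LinearMap.sum_apply]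
  simp only [ev_tmul_mul_mul, ev_δR]
  change (antipode k).rTensor H (TensorProduct.comm k H H (comul (h * x))) = _
  rw [Bialgebra.comul_mul]
  conv_lhs => rw [← (ℛ k h).eq, ← (ℛ k x).eq, Finset.sum_mul_sum]
  conv_rhs => rw [← (ℛ k x).eq]
  simp [antipode_mul_antidistrib]

end Regular

end HopfExponent
end

open scoped TensorProduct

noncomputable section

namespace HopfExponent

open WithConv LinearMap Coalgebra HopfAlgebra MulOpposite

open Algebra.TensorProduct (includeLeft includeRight)

/-! ### The regular Yetter–Drinfeld structure and absorption -/

section Commutation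

variable {k H C B : Type*} [Field k] [Ring H] [HopfAlgebra k H] [FiniteDimensional k H]
  [Ring C] [Algebra k C] [Ring B] [Algebra k B]

lemma cf_mul_one_tmul (δ : H ⊗[k] C) (x : C) (i) : cf (δ * (1 ⊗ₜ x)) i = cf δ i * x := by
  induction δ with
  | zero => simp [cf]
  | tmul a b => simp [cf]
  | add a b ha hb => simp only [cf, map_add, add_mul] at ha hb ⊢; rw [ha, hb]

lemma cf_one_tmul_mul (δ : H ⊗[k] C) (x : C) (i) : cf ((1 ⊗ₜ x) * δ) i = x * cf δ i := by
  induction δ with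
  | zero => simp [cf]
  | tmul a b => simp [cf]
  | add a b ha hb => simp only [cf, map_add, mul_add] at ha hb ⊢; rw [ha, hb]

lemma commute_one_tmul_iff {δ : H ⊗[k] C} {x : C} :
    Commute δ (1 ⊗ₜ x) ↔ ∀ i, Commute (cf δ i) x := by
  refine ⟨fun h i => ?_, fun h => ?_⟩
  · have := congrArg (cf · i) h.eq
    simp only [cf_mul_one_tmul, cf_one_tmul_mul] at this
    exact this
  · rw [← sum_cf δ]
    refine Commute.sum_left _ _ _ fun i _ => ?_
    simp [Commute, SemiconjBy, (h i).eq]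

lemma commute_map_include {δ δ' : H ⊗[k] C} (h : ∀ i l, Commute (cf δ i) (cf δ' l)) :
    Commute
      (Algebra.TensorProduct.map (includeLeft : H →ₐ[k] H ⊗[k] H) (AlgHom.id k C) δ)
      (Algebra.TensorProduct.map (includeRight : H →ₐ[k] H ⊗[k] H) (AlgHom.id k C) δ') := by
  rw [← sum_cf δ, ← sum_cf δ', map_sum, map_sum]
  refine Commute.sum_left _ _ _ fun i _ => Commute.sum_right _ _ _ fun l _ => ?_
  simp [Commute, SemiconjBy, (h i l).eq]

/-- A pentagon relation TX = XRT. Moving T past g creates f * g, which coassociativity splits into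
the two contractions. It makes determinants of braidings computable, and also yields the intertwiner
that absorbs a coaction. -/
lemma IsCoact.mul_sum_eq {δ : H ⊗[k] C} (hδ : IsCoact δ) (f g : H →ₐ[k] B) (m : C →ₐ[k] B)
    (T : B) (hT : ∀ h, T * g h = (toConv f.toLinearMap * toConv g.toLinearMap) h * T)
    (hTm : ∀ i, Commute T (m (cf δ i))) (hfm : ∀ h i, Commute (f h) (m (cf δ i)))
    (hgm : ∀ h i, Commute (g h) (m (cf δ i))) (hfg : ∀ x y, Commute (f x) (g y)) :
    T * ∑ i, m (cf δ i) * g (bas k H i) =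
      (∑ i, m (cf δ i) * g (bas k H i)) * (∑ i, m (cf δ i) * f (bas k H i)) * T := by
  have h1 := hδ.sum_left (toConv f.toLinearMap) (toConv g.toLinearMap) m.toLinearMap
  calc T * ∑ i, m (cf δ i) * g (bas k H i)
      = (∑ i, (toConv f.toLinearMap * toConv g.toLinearMap) (bas k H i) * m (cf δ i)) * T := by
        rw [Finset.mul_sum, Finset.sum_mul]
        refine Finset.sum_congr rfl fun i _ => ?_
        rw [← (hgm _ _).eq, ← mul_assoc, hT, mul_assoc, (hTm i).eq, mul_assoc]
    _ = _ := by
        congr 1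
        refine h1.trans ?_
        rw [Finset.sum_mul_sum, Finset.sum_comm]
        refine Finset.sum_congr rfl fun i _ => Finset.sum_congr rfl fun l _ => ?_
        change f _ * g _ * m (_ * _) = _
        rw [(hfg _ _).eq, map_mul, mul_assoc, ← mul_assoc (f _), (hfm _ _).eq, ← mul_assoc,
          ← mul_assoc, (hgm _ _).eq, mul_assoc, (hfm _ _).eq]

end Commutation

section Regular

variable {k H B : Type*} [Field k] [Ring H] [HopfAlgebra k H] [FiniteDimensional k H]
  [Ring B] [Algebra k B]

lemma map_δL_mul (i : Module.End k H →ₐ[k] B) (h : H) :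
    Algebra.TensorProduct.map (AlgHom.id k H) i (δL k H) * (1 ⊗ₜ i (Algebra.lmul k H h)) =
      (toConv (includeLeft : H →ₐ[k] H ⊗[k] B).toLinearMap *
        toConv ((includeRight : B →ₐ[k] H ⊗[k] B).comp (i.comp (Algebra.lmul k H))).toLinearMap) h *
      Algebra.TensorProduct.map (AlgHom.id k H) i (δL k H) := by
  have h1 := congrArg (Algebra.TensorProduct.map (AlgHom.id k H) i) (δL_mul h)
  rw [map_mul, map_mul, ← (ℛ k h).eq] at h1
  rw [(ℛ k h).convMul_apply]
  simpa using h1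

lemma lift_δL_mul (f : H →ₐ[k] B) (i : Module.End k H →ₐ[k] B)
    (hc : ∀ x y, Commute (f x) (i y)) (h : H) :
    (∑ l, i (cf (δL k H) l) * f (bas k H l)) * i (Algebra.lmul k H h) =
      (toConv f.toLinearMap * toConv (i.comp (Algebra.lmul k H)).toLinearMap) h *
        ∑ l, i (cf (δL k H) l) * f (bas k H l) := by
  have h0 : ∑ l, i (cf (δL k H) l) * f (bas k H l) =
      Algebra.TensorProduct.lift f i hc (δL k H) := by
    conv_rhs => rw [← sum_cf (δL k H)]
    simp [(hc _ _).eq]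
  have h1 := congrArg (Algebra.TensorProduct.lift f i hc) (δL_mul h)
  rw [map_mul, map_mul, ← (ℛ k h).eq] at h1
  rw [(ℛ k h).convMul_apply, h0]
  simpa using h1

namespace YD

/-- The Yetter–Drinfeld structure of the regular type, on `H ⊗ H`, with
`h ↦ h ⊗ 1` and coaction `a ⊗ x ↦ a₁ x₁ S(a₃) ⊗ (a₂ ⊗ x₂)`, where operators on the two factors
are inserted in `B` through `iA` and `iX`. -/
@[simps]
def regular (iA iX : Module.End k H →ₐ[k] B) (hc : ∀ f g, Commute (iA f) (iX g)) : YD k H B where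
  ρ := iA.comp (Algebra.lmul k H)
  δ := Algebra.TensorProduct.map (AlgHom.id k H) iA (δL k H) *
    Algebra.TensorProduct.map (AlgHom.id k H) iX (δL k H) *
    Algebra.TensorProduct.map (AlgHom.id k H) iA (δR k H)
  coact := by
    refine ((isCoact_δL.map iA).mul (isCoact_δL.map iX) ?_).mul (isCoact_δR.map iA) ?_
    · refine commute_map_include fun i l => ?_
      rw [cf_map, cf_map]
      exact hc _ _
    · rw [map_mul]
      refine Commute.mul_left ?_ ?_
      · refine commute_map_include fun i l => ?_
        rw [cf_map, cf_map]
        exact (commute_cf_δL_δR i l).map iA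
      · refine commute_map_include fun i l => ?_
        rw [cf_map, cf_map]
        exact (hc _ _).symm
  compat := by
    refine compat_of_conv _ _ ?_
    set a := toConv (includeLeft : H →ₐ[k] H ⊗[k] B).toLinearMap
    set b := toConv ((includeRight : B →ₐ[k] H ⊗[k] B).comp
      (iA.comp (Algebra.lmul k H))).toLinearMap with hb
    set a' := toConv ((includeLeft : H →ₐ[k] H ⊗[k] B).toLinearMap ∘ₗ antipode k)
    set A := Algebra.TensorProduct.map (AlgHom.id k H) iA (δL k H) with hAdef
    set X := Algebra.TensorProduct.map (AlgHom.id k H) iX (δL k H) with hXdef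
    set R := Algebra.TensorProduct.map (AlgHom.id k H) iA (δR k H) with hRdef
    have haa : a' * a = 1 := antipode_mul_algHom _
    have hA : cst k H A * b = a * b * cst k H A := by
      refine conv_ext fun h => ?_
      rw [cst_mul_apply, mul_cst_apply]
      exact map_δL_mul iA h
    have hX : cst k H X * b = b * cst k H X := by
      refine conv_ext fun h => ?_
      rw [cst_mul_apply, mul_cst_apply]
      refine (commute_one_tmul_iff.2 fun l => ?_).eq
      rw [cf_map]
      exact (hc _ _).symm
    have hR : cst k H R * b = b * cst k H R * a' := by
      refine conv_ext fun h => ?_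
      have h1 := congrArg (Algebra.TensorProduct.map (AlgHom.id k H) iA) congr($(conv_δR) h)
      rw [cst_mul_apply, map_mul, (ℛ k h).convMul_apply, map_sum] at h1
      rw [cst_mul_apply, (ℛ k h).convMul_apply]
      simp only [mul_cst_apply, map_mul] at h1 ⊢
      simpa [b, a', hRdef] using h1
    rw [← cst_mul_cst, ← cst_mul_cst]
    -- Moving the action through A removes the factor h₁ on the left, X does not see it, and moving
    -- it through R creates the antipode factor that cancels the inserted a.
    calc a * b * (cst k H A * cst k H X * cst k H R)
        = (a * b * cst k H A) * cst k H X * cst k H R := by simp only [mul_assoc]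
      _ = cst k H A * (b * cst k H X) * cst k H R := by rw [← hA]; simp only [mul_assoc]
      _ = cst k H A * cst k H X * (b * cst k H R * a') * a := by
        rw [← hX, mul_assoc _ _ a, mul_assoc _ a' a, haa, mul_one]; simp only [mul_assoc]
      _ = _ := by rw [← hR]; simp only [mul_assoc]

lemma semiconj_of_semiconj {Y Z : YD k H B} {θ : B} (hρ : ∀ h, Y.ρ h * θ = θ * Z.ρ h)
    (hδ : Y.δ * (1 ⊗ₜ θ) = (1 ⊗ₜ θ) * Z.δ) : Y.u * θ = θ * Z.u ∧ Y.s * θ = θ * Z.s := by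
  have hd (i) : Y.d i * θ = θ * Z.d i := by
    have := congrArg (cf · i) hδ
    simp only [cf_mul_one_tmul, cf_one_tmul_mul] at this
    exact this
  simp only [u_eq_sum, s_eq_sum, Finset.sum_mul, Finset.mul_sum, mul_assoc, hd, hρ]
  constructor
  · refine Finset.sum_congr rfl fun i _ => ?_
    rw [← mul_assoc, hρ, mul_assoc]
  · refine Finset.sum_congr rfl fun i _ => ?_
    rw [← mul_assoc, hd, mul_assoc]

section Absorb

variable {iA iX : Module.End k H →ₐ[k] B} {hc : ∀ f g, Commute (iA f) (iX g)} {Y : YD k H B}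
  (hρA : ∀ h f, Commute (Y.ρ h) (iA f)) (hρX : ∀ h f, Commute (Y.ρ h) (iX f))
  (hdA : ∀ i f, Commute (Y.d i) (iA f)) (hdX : ∀ i f, Commute (Y.d i) (iX f))

include hρA hρX hdA hdX in
lemma comm_regular : Comm Y (regular iA iX hc) := by
  have h1 (x : B) (hA : ∀ f, Commute x (iA f)) (hX : ∀ f, Commute x (iX f)) (l) :
      Commute x ((regular iA iX hc).d l) := by
    refine (commute_one_tmul_iff.1 ?_ l).symm
    refine (Commute.mul_left ?_ ?_).mul_left ?_ <;> refine commute_one_tmul_iff.2 fun i => ?_ <;>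
      rw [cf_map]
    · exact (hA _).symm
    · exact (hX _).symm
    · exact (hA _).symm
  exact ⟨fun x y => hρA _ _, fun x i => h1 _ (hρA x) (hρX x) i, fun i x => hdA _ _,
    fun i l => h1 _ (hdA i) (hdX i) l⟩

include hρA hdA in
-- Let θ be the contraction of the regular coaction A with the action of Y. By coassociativity θA
-- and Aθ are contractions with the two orders of the convolution product of the inclusion of H and
-- ρ, and the compatibility of Y exchanges these orders across δ.
lemma δ_mul_δA_mul : Y.δ * Algebra.TensorProduct.map (AlgHom.id k H) iA (δL k H) *
      (1 ⊗ₜ ∑ l, iA (cf (δL k H) l) * Y.ρ (bas k H l)) =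
    (1 ⊗ₜ ∑ l, iA (cf (δL k H) l) * Y.ρ (bas k H l)) *
      Algebra.TensorProduct.map (AlgHom.id k H) iA (δL k H) * Y.δ := by
  let f : H →ₐ[k] H ⊗[k] B := includeLeft
  let j : B →ₐ[k] H ⊗[k] B := includeRight
  have hfj (x y) : Commute (f x) (j y) := commute_include x y
  let a := toConv f.toLinearMap
  let b := toConv (j.comp Y.ρ).toLinearMap
  have hY : a * b * cst k H Y.δ = cst k H Y.δ * b * a := by
    have := Y.conv_compat f j hfj
    rwa [lift_include] at this
  have h1 := isCoact_δL.sum_left (k := k) (H := H) a b (j.comp iA).toLinearMap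
  have h2 := isCoact_δL.sum_left (k := k) (H := H) b a (j.comp iA).toLinearMap
  have hA : Algebra.TensorProduct.map (AlgHom.id k H) iA (δL k H) =
      ∑ l, f (bas k H l) * j (iA (cf (δL k H) l)) := by
    conv_lhs => rw [← sum_cf (δL k H)]
    simp [f, j]
  have hθ : (1 : H) ⊗ₜ[k] (∑ l, iA (cf (δL k H) l) * Y.ρ (bas k H l)) =
      ∑ l, j (Y.ρ (bas k H l)) * j (iA (cf (δL k H) l)) := by
    rw [TensorProduct.tmul_sum]
    refine Finset.sum_congr rfl fun l _ => ?_
    rw [← map_mul, (hρA _ _).eq]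
    rfl
  have e1 : (∑ l, j (Y.ρ (bas k H l)) * j (iA (cf (δL k H) l))) *
      (∑ l, f (bas k H l) * j (iA (cf (δL k H) l))) =
      ∑ l, (a * b) (bas k H l) * j (iA (cf (δL k H) l)) := by
    refine Eq.trans ?_ h1.symm
    rw [Finset.sum_mul_sum, Finset.sum_comm]
    refine Finset.sum_congr rfl fun i _ => Finset.sum_congr rfl fun l _ => ?_
    change _ = f _ * j (Y.ρ _) * j (iA (_ * _))
    rw [← mul_assoc, mul_assoc (j _) (j _) (f _), ← (hfj _ _).eq, ← mul_assoc, ← (hfj _ _).eq,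
      map_mul iA, map_mul j]
    simp only [mul_assoc]
  have e2 : (∑ l, f (bas k H l) * j (iA (cf (δL k H) l))) *
      (∑ l, j (Y.ρ (bas k H l)) * j (iA (cf (δL k H) l))) =
      ∑ l, (b * a) (bas k H l) * j (iA (cf (δL k H) l)) := by
    refine Eq.trans ?_ h2.symm
    rw [Finset.sum_mul_sum, Finset.sum_comm]
    refine Finset.sum_congr rfl fun i _ => Finset.sum_congr rfl fun l _ => ?_
    change _ = j (Y.ρ _) * f _ * j (iA (_ * _))
    rw [← (hfj _ _).eq, map_mul iA, map_mul j, mul_assoc, mul_assoc,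
      ← mul_assoc (j (iA _)), (((hρA _ _).map j).symm).eq, mul_assoc]
  rw [hθ, hA, e1, mul_assoc, e2, Finset.mul_sum, Finset.sum_mul]
  refine Finset.sum_congr rfl fun l _ => ?_
  have h3 := congr($hY (bas k H l))
  rw [mul_cst_apply, mul_assoc, cst_mul_apply] at h3
  rw [← mul_assoc, ← h3, mul_assoc, mul_assoc]
  congr 1
  refine (commute_one_tmul_iff.2 fun i => ?_).eq
  exact hdA _ _

include hρA hρX hdA hdX in
/-- Tensoring with the regular structure is isomorphic to the regular structure. -/
theorem exists_semiconj [FiniteDimensional k B] (hT : Comm Y (regular iA iX hc)) :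
    ∃ θ : B, IsUnit θ ∧
      (tensor Y (regular iA iX hc) hT).u * θ = θ * (regular iA iX hc).u ∧
      (tensor Y (regular iA iX hc) hT).s * θ = θ * (regular iA iX hc).s := by
  set A := Algebra.TensorProduct.map (AlgHom.id k H) iA (δL k H) with hAdef
  set X := Algebra.TensorProduct.map (AlgHom.id k H) iX (δL k H) with hXdef
  set R := Algebra.TensorProduct.map (AlgHom.id k H) iA (δR k H) with hRdef
  -- As an operator, ψ is v ⊗ x ↦ v₀ ⊗ v₋₁x, and ψ⁻¹ trivialises the coaction of Y against the
  -- factor X. The contraction θ below is v ⊗ a ↦ a₁v ⊗ a₂, which trivialises the action of Y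
  -- against the factor A.
  obtain ⟨ψ, hψ⟩ := Y.coact.isUnit_sum (AlgHom.id k B) (iX.comp (Algebra.lmul k H))
    (fun h i => (hdX _ _).symm)
  have hθu := (isCoact_δL (k := k) (H := H)).isUnit_sum iA Y.ρ (fun h i => hρA _ _)
  set θ := ∑ l, iA (cf (δL k H) l) * Y.ρ (bas k H l) with hθdef
  have hψc (x : B) (hx : ∀ i, Commute (Y.d i) x) (hx' : ∀ f, Commute x (iX f)) :
      Commute (ψ : B) x := by
    rw [hψ]
    exact Commute.sum_left _ _ _ fun i _ => (hx i).mul_left (hx' _).symm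
  have hψA (f) : Commute (ψ : B) (iA f) := hψc _ (fun i => hdA i f) (fun g => hc f g)
  have hψ1 : X * (1 ⊗ₜ (ψ : B)) = (1 ⊗ₜ (ψ : B)) * Y.δ * X := by
    have h1 := Y.coact.mul_sum_eq (B := H ⊗[k] B) includeLeft
      (includeRight.comp (iX.comp (Algebra.lmul k H))) includeRight X
      (fun h => map_δL_mul iX h)
      (fun i => commute_one_tmul_iff.2 fun l => by rw [cf_map]; exact (hdX _ _).symm)
      (fun h i => commute_include _ _)
      (fun h i => ((hdX _ _).map includeRight).symm) (fun x y => commute_include _ _)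
    have h2 : ∑ i, (includeRight : B →ₐ[k] H ⊗[k] B) (cf Y.δ i) *
        (includeLeft : H →ₐ[k] H ⊗[k] B) (bas k H i) = Y.δ := by
      conv_rhs => rw [← sum_cf Y.δ]
      simp
    have h3 : ∑ i, (includeRight : B →ₐ[k] H ⊗[k] B) (cf Y.δ i) *
        ((includeRight : B →ₐ[k] H ⊗[k] B).comp (iX.comp (Algebra.lmul k H))) (bas k H i) =
        1 ⊗ₜ (ψ : B) := by
      rw [hψ, TensorProduct.tmul_sum]
      simp
    rwa [h2, h3] at h1
  have hψ2 : Y.δ * X * (1 ⊗ₜ (↑ψ⁻¹ : B)) = (1 ⊗ₜ (↑ψ⁻¹ : B)) * X := by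
    have i1 : ((1 : H) ⊗ₜ[k] (↑ψ⁻¹ : B)) * (1 ⊗ₜ (ψ : B)) = 1 := by
      simp [Algebra.TensorProduct.one_def]
    have i2 : ((1 : H) ⊗ₜ[k] (ψ : B)) * (1 ⊗ₜ (↑ψ⁻¹ : B)) = 1 := by
      simp [Algebra.TensorProduct.one_def]
    calc Y.δ * X * (1 ⊗ₜ (↑ψ⁻¹ : B))
        = (1 ⊗ₜ (↑ψ⁻¹ : B)) * ((1 ⊗ₜ (ψ : B)) * Y.δ * X) * (1 ⊗ₜ (↑ψ⁻¹ : B)) := by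
          rw [← mul_assoc, ← mul_assoc, i1, one_mul]
      _ = _ := by rw [← hψ1, mul_assoc, mul_assoc, i2, mul_one]
  have hψR (f : Module.End k H) : Commute (↑ψ⁻¹ : B) (iA f) := (hψA f).units_inv_left
  have hψAA : Commute A (1 ⊗ₜ (↑ψ⁻¹ : B)) :=
    commute_one_tmul_iff.2 fun l => by rw [cf_map]; exact (hψR _).symm
  have hψRR : Commute R (1 ⊗ₜ (↑ψ⁻¹ : B)) :=
    commute_one_tmul_iff.2 fun l => by rw [cf_map]; exact (hψR _).symm
  have hθX : Commute X (1 ⊗ₜ θ) := by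
    refine commute_one_tmul_iff.2 fun l => ?_
    rw [cf_map]
    exact Commute.sum_right _ _ _ fun i _ => (hc _ _).symm.mul_right (hρX _ _).symm
  have hθR : Commute R (1 ⊗ₜ θ) := by
    refine commute_one_tmul_iff.2 fun l => ?_
    rw [cf_map]
    exact Commute.sum_right _ _ _ fun i _ =>
      ((commute_cf_δL_δR i l).symm.map iA).mul_right (hρA _ _).symm
  have hcore : Y.δ * A * (1 ⊗ₜ θ) = (1 ⊗ₜ θ) * A * Y.δ := δ_mul_δA_mul hρA hdA
  refine ⟨θ * ↑ψ⁻¹, hθu.mul ψ⁻¹.isUnit, semiconj_of_semiconj (fun h => ?_) ?_⟩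
  · have h1 := lift_δL_mul Y.ρ iA hρA h
    have h2 : (tensor Y (regular iA iX hc) hT).ρ h =
        (toConv Y.ρ.toLinearMap * toConv (iA.comp (Algebra.lmul k H)).toLinearMap) h :=
      congr($(toConv_convHom Y.ρ (iA.comp (Algebra.lmul k H)) hT.ρρ) h)
    rw [h2, ← mul_assoc, ← h1, mul_assoc, mul_assoc, ← (hψR _).eq]
    rfl
  · have e : (1 : H) ⊗ₜ[k] (θ * ↑ψ⁻¹ : B) = (1 ⊗ₜ θ) * (1 ⊗ₜ (↑ψ⁻¹ : B)) := by simp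
    rw [e, tensor_δ, regular_δ, ← hAdef, ← hXdef, ← hRdef]
    calc Y.δ * (A * X * R) * ((1 ⊗ₜ θ) * (1 ⊗ₜ (↑ψ⁻¹ : B)))
        = Y.δ * A * (X * (R * (1 ⊗ₜ θ))) * (1 ⊗ₜ (↑ψ⁻¹ : B)) := by simp only [mul_assoc]
      _ = Y.δ * A * (1 ⊗ₜ θ) * X * (R * (1 ⊗ₜ (↑ψ⁻¹ : B))) := by
        rw [hθR.eq, ← mul_assoc X, hθX.eq]; simp only [mul_assoc]
      _ = (1 ⊗ₜ θ) * A * (Y.δ * X * (1 ⊗ₜ (↑ψ⁻¹ : B))) * R := by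
        rw [hcore, hψRR.eq]; simp only [mul_assoc]
      _ = (1 ⊗ₜ θ) * (A * (1 ⊗ₜ (↑ψ⁻¹ : B))) * X * R := by rw [hψ2]; simp only [mul_assoc]
      _ = _ := by rw [hψAA.eq]; simp only [mul_assoc]

end Absorb

end YD

end Regular

end HopfExponent
end

open scoped TensorProduct

noncomputable section

namespace HopfExponent

open WithConv LinearMap Coalgebra HopfAlgebra MulOpposite

open Algebra.TensorProduct (includeLeft includeRight)

/-! ### Finiteness of the order of the Drinfeld element -/

variable {k H : Type*} [Field k] [Ring H] [HopfAlgebra k H] [FiniteDimensional k H]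

lemma nontrivial_of_hopfAlgebra (k H : Type*) [Field k] [Ring H] [HopfAlgebra k H] :
    Nontrivial H := by
  by_contra hn
  rw [not_nontrivial_iff_subsingleton] at hn
  have h1 : counit (R := k) (1 : H) = counit (R := k) (0 : H) :=
    congrArg _ (Subsingleton.elim _ _)
  simp at h1

namespace YD

section Norm

variable {B : Type*} [Ring B] [Algebra k B] [FiniteDimensional k B] {Y Z : YD k H B}

lemma isUnit_r (hc : Comm Y Z) : IsUnit (r Y Z) :=
  Y.coact.isUnit_sum (AlgHom.id k B) Z.ρ fun h i => (hc.dρ i h).symm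

/-- In the pentagon relation TX = X(r ⊗ 1)T the units T and X have nonzero determinant, so det(r ⊗
1) = 1. Since det(r ⊗ 1) is a positive power of det r, the latter is a root of unity. -/
lemma isOfFinOrder_norm_r (hc : Comm Y Z) : IsOfFinOrder (Algebra.norm k (r Y Z)) := by
  let f : H →ₐ[k] B ⊗[k] Module.End k H := includeLeft.comp Z.ρ
  let g : H →ₐ[k] B ⊗[k] Module.End k H := includeRight.comp (Algebra.lmul k H)
  let m : B →ₐ[k] B ⊗[k] Module.End k H := includeLeft
  have hi (x : B) (y : Module.End k H) : Commute (m x) (includeRight y) := by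
    simp [Commute, SemiconjBy, m]
  have hθ := (isCoact_δL (k := k) (H := H)).isUnit_sum (B := B ⊗[k] Module.End k H) includeRight f
    (fun h i => hi _ _)
  have hr := Y.coact.isUnit_sum m g (fun h i => (hi _ _).symm)
  have h1 := Y.coact.mul_sum_eq f g m _
    (lift_δL_mul f includeRight (fun x y => hi _ _))
    (fun i => Commute.sum_left _ _ _ fun l _ => Commute.mul_left (hi _ _).symm
      ((hc.dρ i _).symm.map m))
    (fun h i => (hc.dρ i h).symm.map m) (fun h i => (hi _ _).symm) (fun x y => hi _ _)
  have h2 : ∑ i, m (cf Y.δ i) * f (bas k H i) = r Y Z ⊗ₜ 1 := by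
    rw [r, TensorProduct.sum_tmul]
    refine Finset.sum_congr rfl fun i _ => ?_
    simp [m, f, d]
  rw [h2] at h1
  have h3 := congrArg (Algebra.norm k) h1
  rw [map_mul, map_mul, map_mul, mul_comm (Algebra.norm k _), norm_tmul_one] at h3
  have h4 := mul_right_cancel₀ (norm_ne_zero_of_isUnit hθ) h3
  have h5 := mul_left_cancel₀ (norm_ne_zero_of_isUnit hr) ((mul_one _).trans h4)
  have := nontrivial_of_hopfAlgebra k H
  refine isOfFinOrder_iff_pow_eq_one.2 ⟨_, ?_, h5.symm⟩
  exact Module.finrank_pos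

omit [FiniteDimensional k B] in
-- `Y.u` twists the H-leg of the coaction of Y by S², and `Z.u` twists the action of Z by S² in the
-- compensating way.
lemma commute_r_u (hc : Comm Y Z) : Commute (r Y Z) (Y.u * Z.u) := by
  have h1 := congrArg (mul' k B ∘ₗ (TensorProduct.comm k B B).toLinearMap ∘ₗ
    TensorProduct.map Z.ρ.toLinearMap LinearMap.id) Y.δ_mul_u
  rw [← sum_cf Y.δ, Finset.sum_mul, map_sum, map_sum, Finset.mul_sum, map_sum] at h1
  simp only [Algebra.TensorProduct.tmul_mul_tmul, mul_one, one_mul,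
    Algebra.TensorProduct.map_tmul, comp_apply, TensorProduct.map_tmul,
    LinearEquiv.coe_coe, TensorProduct.comm_tmul, mul'_apply, LinearMap.id_apply,
    AlgHom.toLinearMap_apply, AlgHom.coe_id, id_eq, antipodeSq_apply] at h1
  have hu (x : H) : Commute (Z.ρ x) Y.u := by
    rw [u_eq_sum]
    exact Commute.sum_right _ _ _ fun i _ => (hc.ρρ _ _).symm.mul_right (hc.dρ _ _).symm
  calc r Y Z * (Y.u * Z.u) = (∑ i, cf Y.δ i * Y.u * Z.ρ (bas k H i)) * Z.u := by
        rw [r, Finset.sum_mul, Finset.sum_mul]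
        refine Finset.sum_congr rfl fun i _ => ?_
        rw [mul_assoc, ← mul_assoc (Z.ρ _), (hu _).eq, d]
        simp only [mul_assoc]
    _ = ∑ i, Y.u * (cf Y.δ i * Z.u) * Z.ρ (bas k H i) := by
        rw [h1, Finset.sum_mul]
        refine Finset.sum_congr rfl fun i _ => ?_
        rw [mul_assoc, ← Z.u_mul_ρ]
        simp only [mul_assoc]
    _ = _ := by
        rw [r, Finset.mul_sum]
        refine Finset.sum_congr rfl fun i _ => ?_
        rw [← d, (commute_u_right hc i).eq]
        simp only [mul_assoc]

omit [FiniteDimensional k B] in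
lemma commute_u (hc : Comm Y Z) : Commute Y.u Z.u := by
  rw [u_eq_sum]
  refine Commute.sum_left _ _ _ fun i _ => Commute.mul_left ?_ (commute_u_right hc i)
  rw [u_eq_sum]
  exact Commute.sum_right _ _ _ fun l _ => (hc.ρρ _ _).mul_right (hc.ρd _ _)

lemma isUnit_u (Y : YD k H B) : IsUnit Y.u := isUnit_of_mul_eq_one_of_finite k Y.u_mul_inv

lemma isUnit_s (Y : YD k H B) : IsUnit Y.s := isUnit_right_of_mul_eq_one_of_finite k Y.inv_mul_s

end Norm

section Order

variable {E A : Type*} [Ring E] [Algebra k E] [FiniteDimensional k E]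
  [Ring A] [Algebra k A] [FiniteDimensional k A]

/-- `Y` is absorbed by `Z`: up to conjugation the Drinfeld elements of `Y ⊗ Z` are those of `Z`. -/
def IsAbsorbed (Y : YD k H E) (Z : YD k H A) : Prop :=
  ∃ (hc : Comm (Y.map (includeLeft : E →ₐ[k] E ⊗[k] A)) (Z.map includeRight)) (θ : E ⊗[k] A),
    IsUnit θ ∧ (tensor _ _ hc).u * θ = θ * (1 ⊗ₜ Z.u) ∧ (tensor _ _ hc).s * θ = θ * (1 ⊗ₜ Z.s)

/-- Take determinants in Q·u_{Y⊗Z} = u_Y u_Z. Conjugation by θ replaces u_{Y⊗Z} by 1 ⊗ u_Z, which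
cancels, and a power of det u_Y equals det Q. -/
lemma IsAbsorbed.isOfFinOrder_norm_u [Nontrivial A] {Y : YD k H E} {Z : YD k H A}
    (h : IsAbsorbed Y Z) : IsOfFinOrder (Algebra.norm k Y.u) := by
  obtain ⟨hc, θ, hθ, hu, -⟩ := h
  have h1 := congrArg (Algebra.norm k) (Q_mul_tensor_u hc)
  have h2 := congrArg (Algebra.norm k) hu
  rw [map_mul, map_mul, mul_comm (Algebra.norm k θ)] at h2
  have h3 := mul_right_cancel₀ (norm_ne_zero_of_isUnit hθ) h2
  have hu2 : (Z.map (includeRight : _ →ₐ[k] E ⊗[k] A)).u =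
      1 ⊗ₜ Z.u := map_u _ _
  have hu1 : (Y.map (includeLeft : E →ₐ[k] E ⊗[k] A)).u =
      Y.u ⊗ₜ 1 := map_u _ _
  rw [map_mul, map_mul, map_mul, h3, hu2, hu1] at h1
  have hne : Algebra.norm k ((1 : E) ⊗ₜ[k] Z.u) ≠ 0 :=
    norm_ne_zero_of_isUnit ((isUnit_u Z).map
      (includeRight : _ →ₐ[k] E ⊗[k] A))
  have h4 := mul_right_cancel₀ hne h1
  rw [norm_tmul_one] at h4
  refine isOfFinOrder_of_pow (Module.finrank_pos (R := k) (M := A)).ne' ?_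
  rw [← h4]
  exact (Commute.all _ _).isOfFinOrder_mul (isOfFinOrder_norm_r hc.symm) (isOfFinOrder_norm_r hc)

section AlgClosed

variable [IsAlgClosed k] (p : ℕ) [Fact p.Prime] [CharP k p]

include p in
lemma IsAbsorbed.isOfFinOrder_u_mul_inv_s [Nontrivial A] {Y : YD k H E} {F : YD k H A}
    (h : IsAbsorbed Y F) {s' : E} (hs' : Y.s * s' = 1) : IsOfFinOrder (Y.u * s') := by
  obtain ⟨hc, θ, hθ, hu, hs⟩ := h
  obtain ⟨t', ht'⟩ := (isUnit_s F).exists_right_inv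
  set g := F.u * t' with hg
  set T := tensor _ _ hc
  set Q := r (F.map includeRight) (Y.map includeLeft) * r (Y.map includeLeft) (F.map includeRight)
    with hQ
  have hQu : Q * T.u = Y.u ⊗ₜ F.u := by
    have := Q_mul_tensor_u hc
    rw [map_u, map_u] at this
    simpa using this
  have hsQ : T.s * Q = Y.s ⊗ₜ F.s := by
    have := tensor_s_mul_Q hc
    rw [map_s, map_s] at this
    simpa using this
  have hQc : Commute Q (Y.u ⊗ₜ F.u) := by
    have h1 := commute_r_u hc
    have h2 := commute_r_u hc.symm
    rw [(commute_u hc.symm).eq] at h2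
    have h3 := h2.mul_left h1
    rw [map_u, map_u] at h3
    simpa using h3
  have hQunit : IsUnit Q := (isUnit_r hc.symm).mul (isUnit_r hc)
  have e1 : (s' ⊗ₜ[k] t') * T.s * Q = 1 := by
    rw [mul_assoc, hsQ, Algebra.TensorProduct.tmul_mul_tmul, mul_eq_one_symm_of_finite k hs',
      mul_eq_one_symm_of_finite k ht', Algebra.TensorProduct.one_def]
  have e2 : Q * ((s' ⊗ₜ[k] t') * T.s) = 1 := mul_eq_one_symm_of_finite k e1
  -- The factor multiplying u_Y ⊗ u_F is Q⁻¹, by `e1` and `e2`; it can be moved because Q commutes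
  -- with u_Y ⊗ u_F.
  have e3 : (Y.u ⊗ₜ[k] F.u) * ((s' ⊗ₜ[k] t') * T.s) = T.u := by
    refine hQunit.mul_left_cancel ?_
    rw [← mul_assoc, hQc.eq, mul_assoc, e2, mul_one, hQu]
  -- The same θ conjugates both u and s of the tensor product, hence also their quotient.
  have e4 : ((Y.u * s') ⊗ₜ[k] g) * θ = θ * (1 ⊗ₜ g) := by
    have h1 : (Y.u * s') ⊗ₜ[k] g = (Y.u ⊗ₜ[k] F.u) * (s' ⊗ₜ[k] t') := by simp [hg]
    have h2 : ((1 : E) ⊗ₜ[k] F.s) * (1 ⊗ₜ t') = 1 := by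
      simp [ht', Algebra.TensorProduct.one_def]
    calc ((Y.u * s') ⊗ₜ[k] g) * θ
        = (Y.u ⊗ₜ[k] F.u) * (s' ⊗ₜ[k] t') * (θ * (1 ⊗ₜ F.s)) * (1 ⊗ₜ t') := by
          rw [h1, mul_assoc, mul_assoc, mul_assoc, mul_assoc, h2, mul_one]
      _ = (Y.u ⊗ₜ[k] F.u) * ((s' ⊗ₜ[k] t') * T.s) * θ * (1 ⊗ₜ t') := by
          rw [← hs]; simp only [mul_assoc]
      _ = _ := by rw [e3, hu, mul_assoc]; simp [hg]
  have hgunit : IsUnit g := by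
    refine (isUnit_u F).mul ?_
    exact isUnit_right_of_mul_eq_one_of_finite k ht'
  refine isOfFinOrder_of_isEigenvalue (K := k) p _ fun c hcE => ?_
  -- For an eigenvalue d of g, the product cd is an eigenvalue of (u s')_Y ⊗ g, hence of 1 ⊗ g by
  -- `e4`, hence of g.
  refine isOfFinOrder_of_mul_mem (finite_isEigenvalue (K := k) g) (exists_isEigenvalue g)
    (fun h0 => IsEigenvalue.ne_zero hgunit h0 rfl) fun d hd => ?_
  exact isEigenvalue_of_one_tmul (E := E) (IsEigenvalue.of_semiconj hθ e4 (hcE.tmul hd))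

end AlgClosed

variable (k H) in
/-- The regular Yetter–Drinfeld structure on `End H ⊗ End H`. -/
def reg : YD k H (Module.End k H ⊗[k] Module.End k H) :=
  regular includeLeft includeRight fun f g => by simp [Commute, SemiconjBy]

lemma map_regular {B B' : Type*} [Ring B] [Algebra k B] [Ring B'] [Algebra k B']
    (iA iX : Module.End k H →ₐ[k] B) (hc) (j : B →ₐ[k] B') :
    (regular iA iX hc).map j = regular (j.comp iA) (j.comp iX) fun f g => (hc f g).map j := by
  have h (i : Module.End k H →ₐ[k] B) (x : H ⊗[k] Module.End k H) :
      Algebra.TensorProduct.map (AlgHom.id k H) j (Algebra.TensorProduct.map (AlgHom.id k H) i x) =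
        Algebra.TensorProduct.map (AlgHom.id k H) (j.comp i) x := by
    induction x with
    | zero => simp
    | tmul a b => simp
    | add a b ha hb => simp only [map_add, ha, hb]
  simp only [map, regular, map_mul, h, AlgHom.comp_assoc]

/-- Absorption for the tensor product of `Y` with the regular structure. -/
lemma isAbsorbed_reg (Y : YD k H E) :
    IsAbsorbed Y (reg k H) := by
  have hi (x : E) (y : Module.End k H ⊗[k] Module.End k H) : Commute
      ((includeLeft : E →ₐ[k] E ⊗[k] (Module.End k H ⊗[k] Module.End k H)) x)
      ((includeRight : _ →ₐ[k] E ⊗[k] (Module.End k H ⊗[k] Module.End k H)) y) := by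
    simp [Commute, SemiconjBy]
  have h1 : (reg k H).map (includeRight : _ →ₐ[k] E ⊗[k] (Module.End k H ⊗[k] Module.End k H)) =
      _ := map_regular _ _ _ _
  have hd (i) (y : Module.End k H ⊗[k] Module.End k H) : Commute
      ((Y.map (includeLeft : E →ₐ[k] E ⊗[k] (Module.End k H ⊗[k] Module.End k H))).d i)
      ((includeRight : _ →ₐ[k] E ⊗[k] (Module.End k H ⊗[k] Module.End k H)) y) := by
    rw [d, map_δ, cf_map]
    exact hi _ _
  have hu : ((reg k H).map
      (includeRight : _ →ₐ[k] E ⊗[k] (Module.End k H ⊗[k] Module.End k H))).u =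
      1 ⊗ₜ (reg k H).u := map_u _ _
  have hs : ((reg k H).map
      (includeRight : _ →ₐ[k] E ⊗[k] (Module.End k H ⊗[k] Module.End k H))).s =
      1 ⊗ₜ (reg k H).s := map_s _ _
  rw [IsAbsorbed, ← hu, ← hs, h1]
  have hc := comm_regular (Y := Y.map (includeLeft : E →ₐ[k] E ⊗[k] _))
    (iA := includeRight.comp includeLeft) (iX := includeRight.comp includeRight)
    (hc := fun f g => Commute.map (by simp [Commute, SemiconjBy]) includeRight)
    (fun h f => hi _ _) (fun h f => hi _ _) (fun i f => hd _ _) (fun i f => hd _ _)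
  refine ⟨hc, ?_⟩
  exact exists_semiconj (fun h f => hi _ _) (fun h f => hi _ _) (fun i f => hd _ _)
    (fun i f => hd _ _) hc

variable (k H) in
lemma nontrivial_end_tensor_end : Nontrivial (Module.End k H ⊗[k] Module.End k H) := by
  have := nontrivial_of_hopfAlgebra k H
  exact Module.nontrivial_of_finrank_pos (R := k) Module.finrank_pos

end Order

end YD

end HopfExponent
end

open scoped TensorProduct

noncomputable section

namespace HopfExponent

open WithConv LinearMap Coalgebra HopfAlgebra MulOpposite

open Algebra.TensorProduct (includeLeft includeRight)

/-! ### Finite order of us, and then of u -/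

namespace YD

variable {k H E : Type*} [Field k] [Ring H] [HopfAlgebra k H] [FiniteDimensional k H]
  [Ring E] [Algebra k E]

/-- Restriction of a Yetter–Drinfeld structure to a subalgebra. -/
lemma exists_restrict (Y : YD k H E) (E' : Subalgebra k E) (hρ : ∀ h, Y.ρ h ∈ E')
    (hd : ∀ i, Y.d i ∈ E') : ∃ Y' : YD k H E', Y'.map E'.val = Y := by
  let δ' : H ⊗[k] E' := ∑ i, bas k H i ⊗ₜ[k] (⟨Y.d i, hd i⟩ : E')
  let ρ' : H →ₐ[k] E' := Y.ρ.codRestrict E' hρ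
  have h1 : Algebra.TensorProduct.map (AlgHom.id k H) E'.val δ' = Y.δ := by
    conv_rhs => rw [← sum_cf Y.δ]
    simp [δ', d]
  have hinj : Function.Injective (Algebra.TensorProduct.map (AlgHom.id k H) E'.val) :=
    Module.Flat.lTensor_preserves_injective_linearMap (M := H) E'.val.toLinearMap
      Subtype.val_injective
  have h2 : IsCoact δ' := IsCoact.of_map_injective E'.val Subtype.val_injective (h1 ▸ Y.coact)
  have h3 (x : H ⊗[k] H) : Algebra.TensorProduct.map (AlgHom.id k H) E'.val
      (Algebra.TensorProduct.map (AlgHom.id k H) ρ' x) =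
      Algebra.TensorProduct.map (AlgHom.id k H) Y.ρ x := by
    induction x with
    | zero => simp
    | tmul a b => simp [ρ']
    | add a b ha hb => simp only [map_add, ha, hb]
  refine ⟨⟨ρ', δ', h2, fun h => hinj ?_⟩, ?_⟩
  · rw [map_mul, map_mul, h3, h3, h1, Y.compat]
  · have h4 : E'.val.comp ρ' = Y.ρ := by ext; simp [ρ']
    cases Y
    simp only [map, mk.injEq]
    exact ⟨h4, h1⟩

variable [FiniteDimensional k E]

omit [FiniteDimensional k E] in
-- Conjugation by u induces S² on the action and conjugation by s induces S⁻², so the two effects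
-- cancel in the product.
lemma commute_u_mul_s_ρ (Y : YD k H E) (h : H) : Commute (Y.u * Y.s) (Y.ρ h) := by
  have h1 := Y.ρ_mul_s (antipodeInv k H (antipodeInv k H h))
  have h2 := Y.u_mul_ρ (antipodeInv k H (antipodeInv k H h))
  simp only [antipode_antipodeInv] at h1 h2
  rw [Commute, SemiconjBy, mul_assoc, ← h1, ← mul_assoc, h2, mul_assoc]

omit [FiniteDimensional k E] in
lemma commute_u_mul_s_d (Y : YD k H E) (i) : Commute (Y.u * Y.s) (Y.d i) := by
  refine (commute_one_tmul_iff.1 ?_ i).symm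
  have e : (1 : H) ⊗ₜ[k] (Y.u * Y.s) = (1 ⊗ₜ Y.u) * (1 ⊗ₜ Y.s) := by simp
  rw [Commute, SemiconjBy, e, ← mul_assoc, δ_mul_u, mul_assoc, ← s_mul_δ, mul_assoc]

omit [FiniteDimensional k E] in
lemma commute_u_mul_s_u (Y : YD k H E) : Commute (Y.u * Y.s) Y.u := by
  conv => enter [2]; rw [u_eq_sum]
  exact Commute.sum_right _ _ _ fun i _ =>
    (Y.commute_u_mul_s_ρ _).mul_right (Y.commute_u_mul_s_d i)

lemma commute_u_s (Y : YD k H E) : Commute Y.u Y.s := by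
  refine Y.isUnit_u.mul_left_cancel ?_
  have := Y.commute_u_mul_s_u.eq
  rw [← this, mul_assoc]

/-- The action of the centralizer of `z` on an eigenspace of left multiplication by `z`. -/
def eigenspaceHom (z : E) (c : k) : Subalgebra.centralizer k {z} →ₐ[k]
    Module.End k (Module.End.eigenspace (Algebra.lmul k E z) c) :=
  AlgHom.ofLinearMap
    { toFun := fun x => (Algebra.lmul k E (x : E)).restrict fun w hw => by
        rw [Module.End.mem_eigenspace_iff] at hw ⊢
        have hx : z * x = x * z := (Subalgebra.mem_centralizer_iff k).1 x.2 z rfl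
        change z * ((x : E) * w) = c • ((x : E) * w)
        change z * w = c • w at hw
        rw [← mul_assoc, hx, mul_assoc, hw, mul_smul_comm]
      map_add' := fun x y => LinearMap.ext fun w => Subtype.ext (add_mul (x : E) y w)
      map_smul' := fun a x => LinearMap.ext fun w => Subtype.ext (smul_mul_assoc a (x : E) (w : E)) }
    (LinearMap.ext fun w => Subtype.ext (one_mul (w : E)))
    (fun x y => LinearMap.ext fun w => Subtype.ext (mul_assoc (x : E) y w))

variable [IsAlgClosed k] (p : ℕ) [Fact p.Prime] [CharP k p]

include p in
lemma isOfFinOrder_u_mul_s (Y : YD k H E) : IsOfFinOrder (Y.u * Y.s) := by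
  set z := Y.u * Y.s with hz
  refine isOfFinOrder_of_isEigenvalue (K := k) p _ fun c hc => ?_
  set E' := Subalgebra.centralizer k {z}
  have hmem (x : E) (hx : Commute z x) : x ∈ E' := by
    rw [Subalgebra.mem_centralizer_iff]
    rintro _ rfl
    exact hx
  -- The structure lives in the centralizer of z, which acts on each eigenspace of z. On the
  -- c-eigenspace this gives a new structure W whose product us is the scalar c.
  obtain ⟨Y', hY'⟩ := Y.exists_restrict E' (fun h => hmem _ (Y.commute_u_mul_s_ρ h))
    (fun i => hmem _ (Y.commute_u_mul_s_d i))
  let V := Module.End.eigenspace (Algebra.lmul k E z) c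
  have hV : Nontrivial V := Submodule.nontrivial_iff_ne_bot.2 hc
  let W : YD k H (Module.End k V) := Y'.map (E' := Module.End k V) (eigenspaceHom z c)
  have hW : W = Y'.map (E' := Module.End k V) (eigenspaceHom z c) := rfl
  have huW : W.u * W.s = algebraMap k _ c := by
    rw [hW, map_u, map_s, ← map_mul]
    have h1 : ((Y'.u * Y'.s : E') : E) = z := by
      rw [hz, ← hY', map_u, map_s]; rfl
    ext w
    have hw := w.2
    rw [Module.End.mem_eigenspace_iff] at hw
    change ((Y'.u * Y'.s : E') : E) * (w : E) = c • (w : E)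
    rw [h1]
    exact hw
  obtain ⟨t, ht⟩ := W.isUnit_s.exists_right_inv
  have hnt := nontrivial_end_tensor_end k H
  have h1 := (isAbsorbed_reg W).isOfFinOrder_norm_u
  have h2 := (Algebra.norm k).isOfFinOrder ((isAbsorbed_reg W).isOfFinOrder_u_mul_inv_s p ht)
  have h3 := congrArg (Algebra.norm k) huW
  have h4 := congrArg (Algebra.norm k) ht
  rw [Algebra.norm_algebraMap, map_mul] at h3
  rw [map_mul, map_one] at h4
  rw [MonoidHom.map_mul] at h2
  -- This is det(us)·det(u s⁻¹) = det(u)², where det(us) is a power of c.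
  have h5 : c ^ Module.finrank k (Module.End k V) * (Algebra.norm k W.u * Algebra.norm k t) =
      Algebra.norm k W.u ^ 2 := by
    rw [← h3]
    linear_combination (Algebra.norm k W.u) ^ 2 * h4
  refine isOfFinOrder_of_pow (Module.finrank_pos (R := k) (M := Module.End k V)).ne' ?_
  have h6 : Algebra.norm k W.u * Algebra.norm k t ≠ 0 := by
    intro h0
    exact h2.isUnit.ne_zero h0
  have h7 : IsOfFinOrder (Algebra.norm k W.u * Algebra.norm k t)⁻¹ := by
    obtain ⟨n, hn, h⟩ := isOfFinOrder_iff_pow_eq_one.1 h2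
    exact isOfFinOrder_iff_pow_eq_one.2 ⟨n, hn, by rw [inv_pow, h, inv_one]⟩
  rw [eq_div_of_mul_eq h6 h5, div_eq_mul_inv]
  exact (Commute.all _ _).isOfFinOrder_mul h1.pow h7

include p in
/-- Over an algebraically closed field of positive characteristic, the Drinfeld element of a
Yetter–Drinfeld structure on a finite-dimensional algebra has finite order. -/
theorem isOfFinOrder_u (Y : YD k H E) : IsOfFinOrder Y.u := by
  obtain ⟨t, ht⟩ := Y.isUnit_s.exists_right_inv
  have hnt := nontrivial_end_tensor_end k H
  have h1 := (isAbsorbed_reg Y).isOfFinOrder_u_mul_inv_s p ht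
  have h2 := Y.isOfFinOrder_u_mul_s p
  have hts : t * Y.s = 1 := mul_eq_one_symm_of_finite k ht
  have hut : Commute Y.u t := by
    have h := Y.commute_u_s.eq
    calc Y.u * t = t * Y.s * Y.u * t := by rw [hts, one_mul]
      _ = t * (Y.s * Y.u) * t := by rw [mul_assoc t]
      _ = t * Y.u * (Y.s * t) := by rw [← h]; simp only [mul_assoc]
      _ = t * Y.u := by rw [ht, mul_one]
  -- Two commuting elements of finite order, u s⁻¹ and us, have product u².
  have h3 : (Y.u * t) * (Y.u * Y.s) = Y.u ^ 2 := by
    rw [mul_assoc, ← mul_assoc t, ← hut.eq, mul_assoc, hts, mul_one, pow_two]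
  have h4 : Commute (Y.u * t) (Y.u * Y.s) := by
    have ht' : Commute t Y.s := by rw [Commute, SemiconjBy, ht, hts]
    exact ((Commute.refl _).mul_right Y.commute_u_s).mul_left (hut.symm.mul_right ht')
  refine isOfFinOrder_of_pow two_ne_zero ?_
  rw [← h3]
  exact h4.isOfFinOrder_mul h1 h2

end YD

end HopfExponent
end

open scoped TensorProduct

noncomputable section

namespace HopfExponent

open WithConv LinearMap Coalgebra HopfAlgebra MulOpposite

open Algebra.TensorProduct (includeLeft includeRight)

/-! ### The regular Drinfeld element -/

section Operators

variable {k H V : Type*} [Field k] [Ring H] [HopfAlgebra k H] [FiniteDimensional k H]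
  [AddCommGroup V] [Module k V]

variable (k H V) in
/-- The action of `H ⊗ End V` on `H ⊗ V`. -/
def opHom : H ⊗[k] Module.End k V →ₐ[k] Module.End k (H ⊗[k] V) :=
  (Module.endTensorEndAlgHom (R := k) (S := k) (A := k) (M := H) (N := V)).comp
    (Algebra.TensorProduct.map (Algebra.lmul k H) (AlgHom.id k (Module.End k V)))

omit [FiniteDimensional k H] in
lemma opHom_tmul (h : H) (f : Module.End k V) (p : H) (v : V) :
    opHom k H V (h ⊗ₜ f) (p ⊗ₜ v) = (h * p) ⊗ₜ f v := rfl

variable (k H) in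
/-- The action of `End H ⊗ End H` on `H ⊗ H`. -/
def endHom : Module.End k H ⊗[k] Module.End k H →ₐ[k] Module.End k (H ⊗[k] H) :=
  Module.endTensorEndAlgHom

omit [FiniteDimensional k H] in
lemma endHom_tmul (f g : Module.End k H) (a x : H) :
    endHom k H (f ⊗ₜ g) (a ⊗ₜ x) = f a ⊗ₜ g x := rfl

lemma opHom_map_left (δ : H ⊗[k] Module.End k H) (a x : H) :
    opHom k H (H ⊗[k] H) (Algebra.TensorProduct.map (AlgHom.id k H)
      ((endHom k H).comp includeLeft) δ) (1 ⊗ₜ (a ⊗ₜ x)) =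
    TensorProduct.assoc k H H H (ev k H H δ a ⊗ₜ x) := by
  induction δ with
  | zero => simp
  | tmul h f => simp [opHom_tmul, endHom_tmul]
  | add a b ha hb => simp only [map_add, LinearMap.add_apply, TensorProduct.add_tmul, ha, hb]

lemma opHom_map_right (δ : H ⊗[k] Module.End k H) (a x : H) :
    opHom k H (H ⊗[k] H) (Algebra.TensorProduct.map (AlgHom.id k H)
      ((endHom k H).comp includeRight) δ) (1 ⊗ₜ (a ⊗ₜ x)) =
    TensorProduct.leftComm k H H H (a ⊗ₜ ev k H H δ x) := by
  induction δ with
  | zero => simp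
  | tmul h f => simp [opHom_tmul, endHom_tmul]
  | add a b ha hb => simp only [map_add, LinearMap.add_apply, TensorProduct.tmul_add, ha, hb]

omit [FiniteDimensional k H] in
lemma opHom_mulRight (δ : H ⊗[k] Module.End k V) (p : H) (v : V) :
    opHom k H V δ (p ⊗ₜ v) =
      (LinearMap.mulRight k p).rTensor V (opHom k H V δ (1 ⊗ₜ v)) := by
  induction δ with
  | zero => simp
  | tmul h f => simp [opHom_tmul]
  | add a b ha hb => simp only [map_add, LinearMap.add_apply, ha, hb]

end Operators

section RegularElement

variable {k H : Type*} [Field k] [Ring H] [HopfAlgebra k H] [FiniteDimensional k H]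

open YD

/-- The regular coaction on `1 ⊗ x`. -/
lemma opHom_reg_δ (x : H) :
    opHom k H (H ⊗[k] H) (Algebra.TensorProduct.map (AlgHom.id k H) (endHom k H) (reg k H).δ)
      (1 ⊗ₜ (1 ⊗ₜ x)) = (TensorProduct.mk k H H 1).lTensor H (comul x) := by
  have hmap (i : Module.End k H →ₐ[k] Module.End k H ⊗[k] Module.End k H)
      (δ : H ⊗[k] Module.End k H) : Algebra.TensorProduct.map (AlgHom.id k H) (endHom k H)
        (Algebra.TensorProduct.map (AlgHom.id k H) i δ) =
        Algebra.TensorProduct.map (AlgHom.id k H) ((endHom k H).comp i) δ := by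
    induction δ with
    | zero => simp
    | tmul a b => simp
    | add a b ha hb => simp only [map_add, ha, hb]
  have hL : ev k H H (δL k H) 1 = 1 ⊗ₜ 1 := by
    rw [ev_δL, Bialgebra.comul_one, Algebra.TensorProduct.one_def]
  have hR : ev k H H (δR k H) 1 = 1 ⊗ₜ 1 := by
    rw [ev_δR, Bialgebra.comul_one, Algebra.TensorProduct.one_def]
    simp
  have hδ : (reg k H).δ = Algebra.TensorProduct.map (AlgHom.id k H) includeLeft (δL k H) *
    Algebra.TensorProduct.map (AlgHom.id k H) includeRight (δL k H) *
    Algebra.TensorProduct.map (AlgHom.id k H) includeLeft (δR k H) := rfl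
  rw [hδ, map_mul, map_mul, map_mul, map_mul, hmap, hmap, hmap,
    Module.End.mul_apply, Module.End.mul_apply, opHom_map_left, hR, TensorProduct.assoc_tmul,
    opHom_map_right, ev_δL, ← (ℛ k x).eq]
  simp only [TensorProduct.tmul_sum, map_sum, TensorProduct.leftComm_tmul, lTensor_tmul]
  refine Finset.sum_congr rfl fun i _ => ?_
  -- The H-leg x₁ already present sits on the right and is carried along, while the coaction of 1
  -- contributes nothing.
  rw [opHom_mulRight, opHom_map_left, hL]
  simp

/-- The operator on `H ⊗ H` given by the regular Drinfeld element. -/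
def U (k H : Type*) [Field k] [Ring H] [HopfAlgebra k H] [FiniteDimensional k H] :
    Module.End k (H ⊗[k] H) := endHom k H (reg k H).u

lemma U_one_tmul (x : H) : U k H (1 ⊗ₜ x) = (antipode k).rTensor H (comul x) := by
  let K : H ⊗[k] (H ⊗[k] H) →ₗ[k] H ⊗[k] H := (mul' k H).rTensor H ∘ₗ
    (TensorProduct.assoc k H H H).symm.toLinearMap ∘ₗ (antipode k).rTensor (H ⊗[k] H)
  have h1 (δ : H ⊗[k] (Module.End k H ⊗[k] Module.End k H)) (v : H ⊗[k] H) :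
      endHom k H (mul' k _ (TensorProduct.map ((reg k H).ρ.toLinearMap ∘ₗ antipode k)
        LinearMap.id δ)) v =
      K (opHom k H (H ⊗[k] H) (Algebra.TensorProduct.map (AlgHom.id k H) (endHom k H) δ)
        (1 ⊗ₜ v)) := by
    induction δ with
    | zero => simp
    | add a b ha hb => simp only [map_add, LinearMap.add_apply, ha, hb]
    | tmul h f =>
      simp only [TensorProduct.map_tmul, mul'_apply, map_mul, Module.End.mul_apply,
        LinearMap.id_apply, Algebra.TensorProduct.map_tmul, opHom_tmul, mul_one, AlgHom.coe_id,
        id_eq]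
      generalize endHom k H f v = w
      induction w with
      | zero => simp
      | add a b ha hb => simp only [map_add, TensorProduct.tmul_add, ha, hb]
      | tmul a b =>
        change endHom k H (Algebra.lmul k H (antipode k h) ⊗ₜ 1) (a ⊗ₜ b) = _
        rw [endHom_tmul]
        simp [K]
  rw [U, YD.u, h1, opHom_reg_δ, ← (ℛ k x).eq]
  simp [K]

/-- Write a ⊗ x as ρ(a) applied to 1 ⊗ x and commute u past ρ(a), which becomes ρ(S²a). -/
lemma U_tmul (a x : H) : U k H (a ⊗ₜ x) =
    (LinearMap.mulLeft k (antipode k (antipode k a)) ∘ₗ antipode k).rTensor H (comul x) := by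
  have h1 : a ⊗ₜ[k] x = endHom k H ((reg k H).ρ a) (1 ⊗ₜ x) := by
    change _ = endHom k H (Algebra.lmul k H a ⊗ₜ 1) (1 ⊗ₜ x)
    simp [endHom_tmul]
  rw [h1, U, ← Module.End.mul_apply, ← map_mul, u_mul_ρ, map_mul, Module.End.mul_apply]
  change endHom k H (Algebra.lmul k H _ ⊗ₜ 1) (U k H (1 ⊗ₜ x)) = _
  rw [U_one_tmul, ← (ℛ k x).eq]
  simp [endHom_tmul]

/-- The twisted power maps `x ↦ S^{2n-1}(x₁) ⋯ S³(x_{n-1}) S(x_n)`. -/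
def twistedPower (k H : Type*) [Field k] [Ring H] [HopfAlgebra k H] :
    ℕ → WithConv (H →ₗ[k] H)
  | 0 => 1
  | n + 1 => toConv ((antipodeSq k H).toLinearMap ∘ₗ (twistedPower k H n).ofConv) *
      toConv (antipode k)

/-- One application of U to f(x₁) ⊗ x₂ gives S²(f(x₁)) S(x₂) ⊗ x₃; this is the recursion defining
`twistedPower`. -/
lemma U_rTensor_comul (f : WithConv (H →ₗ[k] H)) (x : H) :
    U k H (f.ofConv.rTensor H (comul x)) =
      (toConv ((antipodeSq k H).toLinearMap ∘ₗ f.ofConv) *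
        toConv (antipode k)).ofConv.rTensor H (comul x) := by
  let Φ : H ⊗[k] (H ⊗[k] H) →ₗ[k] H ⊗[k] H := (mul' k H).rTensor H ∘ₗ
    (TensorProduct.assoc k H H H).symm.toLinearMap ∘ₗ
    TensorProduct.map ((antipodeSq k H).toLinearMap ∘ₗ f.ofConv) ((antipode k).rTensor H)
  have h1 : U k H (f.ofConv.rTensor H (comul x)) = Φ (comul.lTensor H (comul x)) := by
    conv_lhs => rw [← (ℛ k x).eq]
    conv_rhs => rw [← (ℛ k x).eq]
    simp only [map_sum, rTensor_tmul, lTensor_tmul, U_tmul]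
    refine Finset.sum_congr rfl fun i _ => ?_
    rw [← (ℛ k ((ℛ k x).right i)).eq]
    simp [Φ, TensorProduct.tmul_sum, antipodeSq_apply]
  have h2 : (toConv ((antipodeSq k H).toLinearMap ∘ₗ f.ofConv) *
        toConv (antipode k)).ofConv.rTensor H (comul x) =
      Φ (TensorProduct.assoc k H H H (comul.rTensor H (comul x))) := by
    conv_lhs => rw [← (ℛ k x).eq]
    conv_rhs => rw [← (ℛ k x).eq]
    simp only [map_sum, rTensor_tmul]
    refine Finset.sum_congr rfl fun i _ => ?_
    rw [(ℛ k ((ℛ k x).left i)).convMul_apply, ← (ℛ k ((ℛ k x).left i)).eq]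
    simp [Φ, TensorProduct.sum_tmul]
  rw [h1, h2, coassoc_apply]

lemma U_pow_one_tmul (n : ℕ) (x : H) :
    (U k H ^ n) (1 ⊗ₜ x) = (twistedPower k H n).ofConv.rTensor H (comul x) := by
  induction n with
  | zero =>
    have h := rTensor_counit_comul (R := k) x
    have h1 := congrArg ((Algebra.linearMap k H).rTensor H) h
    rw [← LinearMap.rTensor_comp_apply] at h1
    refine Eq.trans ?_ h1.symm
    simp
  | succ n ih => rw [pow_succ', Module.End.mul_apply, ih, U_rTensor_comul]; rfl

lemma U_pow_tmul_one (n : ℕ) (a : H) :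
    (U k H ^ n) (a ⊗ₜ 1) = ((antipodeSq k H ^ n) a) ⊗ₜ 1 := by
  induction n with
  | zero => simp
  | succ n ih =>
    rw [pow_succ', Module.End.mul_apply, ih, U_tmul, Bialgebra.comul_one,
      Algebra.TensorProduct.one_def, pow_succ', AlgHom.mul_apply]
    simp [antipodeSq_apply]

/-- Over an algebraically closed field of positive characteristic, the square of the antipode and
the twisted power maps have a common finite exponent. -/
theorem exists_twistedPower_eq_one [IsAlgClosed k] (p : ℕ) [Fact p.Prime] [CharP k p] :
    ∃ n : ℕ, 0 < n ∧ antipodeSq k H ^ n = 1 ∧ twistedPower k H n = 1 := by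
  obtain ⟨n, hn, h⟩ := isOfFinOrder_iff_pow_eq_one.1 (isOfFinOrder_u p (reg k H))
  have hU : U k H ^ n = 1 := by rw [U, ← map_pow, h, map_one]
  refine ⟨n, hn, ?_, conv_ext fun x => ?_⟩
  · ext a
    have h1 := U_pow_tmul_one (k := k) n a
    rw [hU, Module.End.one_apply] at h1
    -- Applying id ⊗ ε isolates the first tensor factor.
    have h2 := congrArg (TensorProduct.rid k H ∘ (counit (R := k)).lTensor H) h1
    simpa using h2.symm
  · have h1 := U_pow_one_tmul (k := k) n x
    rw [hU, Module.End.one_apply] at h1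
    have h2 := congrArg (TensorProduct.rid k H ∘ (counit (R := k)).lTensor H) h1
    have h3 (y : H ⊗[k] H) : TensorProduct.rid k H ((counit (R := k)).lTensor H
        ((twistedPower k H n).ofConv.rTensor H y)) =
        (twistedPower k H n) (TensorProduct.rid k H ((counit (R := k)).lTensor H y)) := by
      induction y with
      | zero => simp
      | tmul a b => simp
      | add a b ha hb => simp only [map_add, ha, hb]
    simp only [Function.comp_apply, h3, lTensor_counit_comul, lTensor_tmul,
      TensorProduct.rid_tmul, one_smul] at h2
    rw [← h2, convOne_apply, Algebra.algebraMap_eq_smul_one]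

end RegularElement

end HopfExponent
end

open scoped TensorProduct

noncomputable section

namespace HopfExponent

open WithConv LinearMap Coalgebra HopfAlgebra

/-! ### The smash product with a group of Hopf algebra automorphisms -/

section Smash

open SkewMonoidAlgebra (single lsingle lsingle_apply lhom_ext single_mul_single)

variable (k G H : Type*) [Field k] [Group G] [Ring H] [HopfAlgebra k H] [MulSemiringAction G H]
  [SMulCommClass G k H]

/-- The action of a group on a Hopf algebra is compatible with the coalgebra structure. -/
class HopfAction : Prop where
  comul_smul : ∀ (g : G) (a : H), comul (R := k) (g • a) = TensorProduct.map
    (DistribSMul.toLinearMap k H g) (DistribSMul.toLinearMap k H g) (comul a)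
  counit_smul : ∀ (g : G) (a : H), counit (R := k) (g • a) = counit (R := k) a

variable {k G H}

/-- Linear maps out of the skew group algebra. -/
def skewLift {M : Type*} [AddCommGroup M] [Module k M] (f : G → H →ₗ[k] M) :
    SkewMonoidAlgebra H G →ₗ[k] M :=
  Finsupp.lsum k f ∘ₗ (SkewMonoidAlgebra.coeffLinearEquiv (S := k)).toLinearMap

omit [Group G] [MulSemiringAction G H] [SMulCommClass G k H] in
@[simp] lemma skewLift_single {M : Type*} [AddCommGroup M] [Module k M] (f : G → H →ₗ[k] M)
    (g : G) (a : H) : skewLift f (single g a) = f g a := by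
  simp [skewLift, SkewMonoidAlgebra.coeffLinearEquiv]

/-- Here `single g a` plays the role of ag, with the group elements group-like. -/
instance : CoalgebraStruct k (SkewMonoidAlgebra H G) where
  comul := skewLift fun g => TensorProduct.map (lsingle k g) (lsingle k g) ∘ₗ comul
  counit := skewLift fun _ => counit

omit [SMulCommClass G k H] in
lemma comul_single (g : G) (a : H) : comul (R := k) (single g a) =
    TensorProduct.map (lsingle k g) (lsingle k g) (comul (R := k) a) := skewLift_single _ _ _

omit [SMulCommClass G k H] in
lemma counit_single (g : G) (a : H) : counit (R := k) (single g a) = counit (R := k) a :=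
  skewLift_single _ _ _

set_option synthInstance.maxHeartbeats 100000 in
instance : Coalgebra k (SkewMonoidAlgebra H G) where
  coassoc := by
    refine lhom_ext fun g a => ?_
    let T := TensorProduct.map (lsingle (M := H) k g)
      (TensorProduct.map (lsingle (M := H) k g) (lsingle (M := H) k g))
    have h1 (y : H ⊗[k] H) : TensorProduct.assoc k _ _ _ (comul.rTensor _
        (TensorProduct.map (lsingle k g) (lsingle k g) y)) =
        T (TensorProduct.assoc k H H H (comul.rTensor H y)) := by
      induction y with
      | zero => simp
      | add a b ha hb => simp only [map_add, ha, hb]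
      | tmul a b =>
        simp only [TensorProduct.map_tmul, rTensor_tmul, lsingle_apply, comul_single]
        rw [← (ℛ k a).eq]
        simp [T, TensorProduct.sum_tmul, lsingle_apply]
    have h2 (y : H ⊗[k] H) : comul.lTensor _
        (TensorProduct.map (lsingle k g) (lsingle k g) y) = T (comul.lTensor H y) := by
      induction y with
      | zero => simp
      | add a b ha hb => simp only [map_add, ha, hb]
      | tmul a b =>
        simp only [TensorProduct.map_tmul, lTensor_tmul, lsingle_apply, comul_single]
        rw [← (ℛ k b).eq]
        simp [T, TensorProduct.tmul_sum, lsingle_apply]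
    change TensorProduct.assoc k _ _ _ (comul.rTensor _ (comul (single g a))) =
      comul.lTensor _ (comul (single g a))
    rw [comul_single, h1, h2, coassoc_apply]
  rTensor_counit_comp_comul := by
    refine lhom_ext fun g a => ?_
    have h1 (y : H ⊗[k] H) : (counit (R := k) (A := SkewMonoidAlgebra H G)).rTensor _
        (TensorProduct.map (lsingle k g) (lsingle k g) y) =
        (lsingle k g).lTensor k (counit.rTensor H y) := by
      induction y with
      | zero => simp
      | add a b ha hb => simp only [map_add, ha, hb]
      | tmul a b => simp [lsingle_apply, counit_single]
    change counit.rTensor _ (comul (single g a)) = _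
    rw [comul_single, h1, rTensor_counit_comul]
    simp [lsingle_apply]
  lTensor_counit_comp_comul := by
    refine lhom_ext fun g a => ?_
    have h1 (y : H ⊗[k] H) : (counit (R := k) (A := SkewMonoidAlgebra H G)).lTensor _
        (TensorProduct.map (lsingle k g) (lsingle k g) y) =
        (lsingle k g).rTensor k (counit.lTensor H y) := by
      induction y with
      | zero => simp
      | add a b ha hb => simp only [map_add, ha, hb]
      | tmul a b => simp [lsingle_apply, counit_single]
    change counit.lTensor _ (comul (single g a)) = _
    rw [comul_single, h1, lTensor_counit_comul]
    simp [lsingle_apply]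

variable [HopfAction k G H]

instance : Bialgebra k (SkewMonoidAlgebra H G) :=
  Bialgebra.mk' k (SkewMonoidAlgebra H G)
    (by rw [SkewMonoidAlgebra.one_def, counit_single, Bialgebra.counit_one])
    (fun {a b} => by
      induction a using SkewMonoidAlgebra.induction_on with
      | zero => simp
      | add x y hx hy => rw [add_mul, map_add, hx, hy, map_add, add_mul]
      | single g a =>
        induction b using SkewMonoidAlgebra.induction_on with
        | zero => simp
        | add x y hx hy => rw [mul_add, map_add, hx, hy, map_add, mul_add]
        | single h b =>
          rw [single_mul_single, counit_single, counit_single, counit_single,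
            Bialgebra.counit_mul, HopfAction.counit_smul])
    (by
      rw [SkewMonoidAlgebra.one_def, comul_single, Bialgebra.comul_one,
        Algebra.TensorProduct.one_def, Algebra.TensorProduct.one_def]
      rfl)
    (fun {a b} => by
      induction a using SkewMonoidAlgebra.induction_on with
      | zero => simp
      | add x y hx hy => rw [add_mul, map_add, hx, hy, map_add, add_mul]
      | single g a =>
        induction b using SkewMonoidAlgebra.induction_on with
        | zero => simp
        | add x y hx hy => rw [mul_add, map_add, hx, hy, map_add, mul_add]
        | single h b =>
          rw [single_mul_single, comul_single, comul_single, comul_single,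
            Bialgebra.comul_mul, HopfAction.comul_smul, ← (ℛ k a).eq, ← (ℛ k b).eq]
          simp [lsingle_apply, Finset.sum_mul_sum, single_mul_single])

/-- S(ag) = g⁻¹S(a), with g⁻¹ moved to the right by the action. -/
instance : HopfAlgebraStruct k (SkewMonoidAlgebra H G) where
  antipode := skewLift fun g =>
    lsingle k g⁻¹ ∘ₗ DistribSMul.toLinearMap k H g⁻¹ ∘ₗ antipode k

lemma antipode_single (g : G) (a : H) :
    antipode k (single g a : SkewMonoidAlgebra H G) = single g⁻¹ (g⁻¹ • antipode k a) :=
  skewLift_single _ _ _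

instance : HopfAlgebra k (SkewMonoidAlgebra H G) where
  mul_antipode_rTensor_comul := by
    refine lhom_ext fun g a => ?_
    have h1 (y : H ⊗[k] H) : mul' k _ ((antipode k).rTensor _
        (TensorProduct.map (lsingle k g) (lsingle k g) y)) =
        (single 1 (g⁻¹ • mul' k H ((antipode k).rTensor H y)) : SkewMonoidAlgebra H G) := by
      induction y with
      | zero => simp
      | add a b ha hb => simp only [map_add, ha, hb, smul_add, SkewMonoidAlgebra.single_add]
      | tmul a b => simp [lsingle_apply, antipode_single, single_mul_single]
    change mul' k _ ((antipode k).rTensor _ (comul (single g a))) =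
      algebraMap k _ (counit (single g a))
    rw [comul_single, h1, counit_single, mul_antipode_rTensor_comul_apply]
    simp
  mul_antipode_lTensor_comul := by
    refine lhom_ext fun g a => ?_
    have h1 (y : H ⊗[k] H) : mul' k _ ((antipode k).lTensor _
        (TensorProduct.map (lsingle k g) (lsingle k g) y)) =
        (single 1 (mul' k H ((antipode k).lTensor H y)) : SkewMonoidAlgebra H G) := by
      induction y with
      | zero => simp
      | add a b ha hb => simp only [map_add, ha, hb, SkewMonoidAlgebra.single_add]
      | tmul a b => simp [lsingle_apply, antipode_single, single_mul_single]
    change mul' k _ ((antipode k).lTensor _ (comul (single g a))) =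
      algebraMap k _ (counit (single g a))
    rw [comul_single, h1, counit_single, mul_antipode_lTensor_comul_apply]
    simp

instance [Finite G] [FiniteDimensional k H] : FiniteDimensional k (SkewMonoidAlgebra H G) :=
  Module.Finite.equiv (SkewMonoidAlgebra.coeffLinearEquiv (S := k) (k := H) (G := G)).symm

end Smash

end HopfExponent
end

open scoped TensorProduct

noncomputable section

namespace HopfExponent

open WithConv LinearMap Coalgebra HopfAlgebra

/-! ### Untwisting the power maps -/

section Untwist

open SkewMonoidAlgebra (single lsingle lsingle_apply single_mul_single)

variable {k G H : Type*} [Field k] [Group G] [Ring H] [HopfAlgebra k H]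

lemma convPow_antipode_one (n : ℕ) :
    ((toConv (antipode k) : WithConv (H →ₗ[k] H)) ^ n) 1 = 1 := by
  induction n with
  | zero => simp [convOne_apply]
  | succ n ih =>
    rw [pow_succ, convMul_apply, Bialgebra.comul_one, Algebra.TensorProduct.one_def,
      TensorProduct.map_tmul, mul'_apply]
    erw [ih]
    simp

variable [MulSemiringAction G H] [SMulCommClass G k H] [HopfAction k G H]

omit [SMulCommClass G k H] [HopfAction k G H] in
lemma conv_apply_single {A : Type*} [Ring A] [Algebra k A]
    (f f' : WithConv (SkewMonoidAlgebra H G →ₗ[k] A)) (g : G) (a : H) :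
    (f * f') (single g a) = ∑ i ∈ (ℛ k a).index,
      f (single g ((ℛ k a).left i)) * f' (single g ((ℛ k a).right i)) := by
  rw [convMul_apply, comul_single, ← (ℛ k a).eq]
  simp [lsingle_apply]

lemma antipodeSq_single_one_right (g : G) :
    antipodeSq k (SkewMonoidAlgebra H G) (single g 1) = single g 1 := by
  simp [antipodeSq_apply, antipode_single]

lemma antipodeSq_single_one_left (a : H) :
    antipodeSq k (SkewMonoidAlgebra H G) (single 1 a) = single 1 (antipodeSq k H a) := by
  simp [antipodeSq_apply, antipode_single]

/-- In the smash product S² on H is conjugation by g. Evaluated on ag⁻¹, each antipode factor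
contributes one g, and moving it to the left undoes the accumulated S²; the twists telescope into
gⁿ. -/
lemma twistedPower_single {g : G} (hg : ∀ a : H, g • a = antipodeSq k H a) (n : ℕ) (a : H) :
    twistedPower k (SkewMonoidAlgebra H G) n (single g⁻¹ a) =
      single (g ^ n) 1 * single 1 ((toConv (antipode k) ^ n : WithConv (H →ₗ[k] H)) a) := by
  induction n generalizing a with
  | zero =>
    change algebraMap k _ (counit (single g⁻¹ a)) =
      (SkewMonoidAlgebra.single (g ^ 0) 1 * SkewMonoidAlgebra.single 1
        (algebraMap k H (counit a)) : SkewMonoidAlgebra H G)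
    rw [counit_single, single_mul_single]
    simp
  | succ n ih =>
    rw [twistedPower, conv_apply_single, pow_succ (toConv (antipode k)), (ℛ k a).convMul_apply]
    have hs {ι : Type _} (f : Finset ι) (x : ι → H) :
        (single 1 (∑ i ∈ f, x i) : SkewMonoidAlgebra H G) = ∑ i ∈ f, single 1 (x i) :=
      map_sum (SkewMonoidAlgebra.singleAddHom 1) x f
    rw [hs, Finset.mul_sum]
    refine Finset.sum_congr rfl fun i _ => ?_
    change antipodeSq k _ (twistedPower k _ n (single g⁻¹ _)) *
      antipode k (single g⁻¹ _ : SkewMonoidAlgebra H G) = _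
    rw [ih, map_mul, antipodeSq_single_one_right, antipodeSq_single_one_left, ← hg,
      antipode_single]
    simp [single_mul_single, pow_succ, mul_smul]

lemma convPow_antipode_eq_one {g : G} (hg : ∀ a : H, g • a = antipodeSq k H a) {n : ℕ}
    (h : twistedPower k (SkewMonoidAlgebra H G) n = 1) :
    (toConv (antipode k) ^ n : WithConv (H →ₗ[k] H)) = 1 := by
  have h1 (a : H) : (single (g ^ n) 1 * single 1
      ((toConv (antipode k) ^ n : WithConv (H →ₗ[k] H)) a) : SkewMonoidAlgebra H G) =
      single 1 (algebraMap k H (counit a)) := by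
    rw [← twistedPower_single hg, h]
    change algebraMap k _ (counit (single g⁻¹ a)) = _
    rw [counit_single]
    simp
  -- The case a = 1 determines gⁿ, after which the untwisted power map is left alone.
  have h2 : (single (g ^ n) 1 : SkewMonoidAlgebra H G) = 1 := by
    have := h1 1
    rw [convPow_antipode_one, Bialgebra.counit_one, map_one, ← SkewMonoidAlgebra.one_def,
      mul_one] at this
    exact this
  refine conv_ext fun a => SkewMonoidAlgebra.single_injective (1 : G) ?_
  rw [← one_mul (single 1 _), ← h2, h1]
  rfl

end Untwist

/-! ### The group generated by the squared antipode -/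

section Automorphism

variable {k H : Type*} [Field k] [Ring H] [HopfAlgebra k H] [FiniteDimensional k H]

variable (k H) in
/-- The square of the antipode as an algebra automorphism. -/
def antipodeSqEquiv : H ≃ₐ[k] H :=
  AlgEquiv.ofBijective (antipodeSq k H)
    ((antipode_bijective k H).comp (antipode_bijective k H))

omit [FiniteDimensional k H] in
lemma comul_antipodeSq (a : H) : comul (R := k) (antipodeSq k H a) =
    TensorProduct.map (antipodeSq k H).toLinearMap (antipodeSq k H).toLinearMap (comul a) := by
  rw [antipodeSq_apply, comul_antipode, comul_antipode, ← (ℛ k a).eq]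
  simp [antipodeSq_apply]

instance : SMulCommClass (Subgroup.zpowers (antipodeSqEquiv k H)) k H where
  smul_comm g c a := map_smul (g : H ≃ₐ[k] H) c a

instance [Finite (Subgroup.zpowers (antipodeSqEquiv k H))] :
    HopfAction k (Subgroup.zpowers (antipodeSqEquiv k H)) H := by
  have h (g : Subgroup.zpowers (antipodeSqEquiv k H)) :
      ∃ n : ℕ, ∀ a : H, g • a = (antipodeSq k H ^ n) a := by
    have hf : IsOfFinOrder (antipodeSqEquiv k H) := finite_zpowers.1 (Set.toFinite _)
    obtain ⟨n, hn⟩ := hf.mem_powers_iff_mem_zpowers.2 g.2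
    refine ⟨n, fun a => ?_⟩
    change (g : H ≃ₐ[k] H) a = _
    rw [← hn]
    clear hn
    change (antipodeSqEquiv k H ^ n) a = _
    induction n generalizing a with
    | zero => rfl
    | succ n ih => rw [pow_succ, pow_succ, AlgHom.mul_apply, ← ih]; rfl
  have h1 (n : ℕ) (a : H) : comul (R := k) ((antipodeSq k H ^ n) a) =
      TensorProduct.map (antipodeSq k H ^ n).toLinearMap (antipodeSq k H ^ n).toLinearMap
        (comul a) := by
    induction n generalizing a with
    | zero =>
      change comul (R := k) a = TensorProduct.map LinearMap.id LinearMap.id (comul a)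
      simp
    | succ n ih =>
      rw [pow_succ, AlgHom.mul_apply, ih, comul_antipodeSq, ← (ℛ k a).eq]
      simp
  have h2 (n : ℕ) (a : H) : counit (R := k) ((antipodeSq k H ^ n) a) = counit (R := k) a := by
    induction n generalizing a with
    | zero => rfl
    | succ n ih => rw [pow_succ, AlgHom.mul_apply, ih, antipodeSq_apply]; simp
  constructor
  · intro g a
    obtain ⟨n, hn⟩ := h g
    have h3 : DistribSMul.toLinearMap k H g = (antipodeSq k H ^ n).toLinearMap :=
      LinearMap.ext hn
    rw [h3, hn, h1]
  · intro g a
    obtain ⟨n, hn⟩ := h g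
    rw [hn, h2]

/-- Over an algebraically closed field of positive characteristic, some convolution power of the
identity of a finite-dimensional Hopf algebra is trivial. -/
theorem exists_convPow_id_eq_one [IsAlgClosed k] (p : ℕ) [Fact p.Prime] [CharP k p] :
    ∃ n : ℕ, 0 < n ∧ (toConv LinearMap.id ^ n : WithConv (H →ₗ[k] H)) = 1 := by
  -- The first application, to H, is used only for the finite order of S². It makes the smash
  -- product finite-dimensional, so that the theorem can be applied to it in turn.
  obtain ⟨m, hm, hS, -⟩ := exists_twistedPower_eq_one (k := k) (H := H) p
  have hfin : Finite (Subgroup.zpowers (antipodeSqEquiv k H)) := by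
    refine Set.Finite.to_subtype (finite_zpowers.2 (isOfFinOrder_iff_pow_eq_one.2 ?_))
    refine ⟨m, hm, AlgEquiv.ext fun a => ?_⟩
    have h1 (n : ℕ) (a : H) : (antipodeSqEquiv k H ^ n) a = (antipodeSq k H ^ n) a := by
      induction n generalizing a with
      | zero => rfl
      | succ n ih => rw [pow_succ, pow_succ, AlgHom.mul_apply, ← ih]; rfl
    rw [h1, hS]
    rfl
  obtain ⟨n, hn, -, ht⟩ := exists_twistedPower_eq_one (k := k)
    (H := SkewMonoidAlgebra H (Subgroup.zpowers (antipodeSqEquiv k H))) p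
  have h1 : (toConv (antipode k) ^ n : WithConv (H →ₗ[k] H)) = 1 :=
    convPow_antipode_eq_one
      (g := (⟨antipodeSqEquiv k H, Subgroup.mem_zpowers _⟩ :
        Subgroup.zpowers (antipodeSqEquiv k H))) (fun a => rfl) ht
  refine ⟨n, hn, ?_⟩
  have h2 : (toConv LinearMap.id : WithConv (H →ₗ[k] H)) * toConv (antipode k) = 1 :=
    algHom_mul_antipode (AlgHom.id k H)
  have h3 : toConv (antipode k) * (toConv LinearMap.id : WithConv (H →ₗ[k] H)) = 1 :=
    antipode_mul_algHom (AlgHom.id k H)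
  have h4 : Commute (toConv LinearMap.id : WithConv (H →ₗ[k] H)) (toConv (antipode k)) :=
    h2.trans h3.symm
  have h5 := h4.mul_pow n
  rw [h2, h1, one_pow, mul_one] at h5
  exact h5.symm

end Automorphism

end HopfExponent
end

open scoped TensorProduct

noncomputable section

namespace HopfExponent

open WithConv LinearMap Coalgebra HopfAlgebra

/-! ### Sweedler powers -/

section Sweedler

variable {k H : Type*} [Field k] [Ring H] [HopfAlgebra k H]

lemma mulN_mulEquiv (n : ℕ) (t : ⨂[k]^n H) (x : H) :
    mulN k H (n + 1) (TensorPower.mulEquiv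
      (t ⊗ₜ[k] (PiTensorProduct.subsingletonEquiv (0 : Fin 1)).symm x)) = mulN k H n t * x := by
  induction t using PiTensorProduct.induction_on with
  | smul_tprod r f =>
    have h : (PiTensorProduct.subsingletonEquiv (0 : Fin 1)).symm x =
        PiTensorProduct.tprod k (fun _ : Fin 1 => x) :=
      PiTensorProduct.subsingletonEquiv_symm_apply' _ _
    have h1 := TensorPower.tprod_mul_tprod k f (fun _ : Fin 1 => x)
    rw [TensorPower.gMul_eq_coe_linearMap] at h1
    rw [h, ← TensorProduct.smul_tmul', map_smul, map_smul, map_smul, smul_mul_assoc]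
    congr 1
    refine (congrArg (mulN k H (n + 1)) h1).trans ?_
    rw [mulN, PiTensorProduct.lift.tprod, MultilinearMap.mkPiAlgebraFin_apply,
      List.ofFn_fin_append, List.prod_append]
    simp [mulN]
  | add a b ha hb => rw [TensorProduct.add_tmul, map_add, map_add, map_add, ha, hb, add_mul]

lemma sweedlerPower_eq_convPow (n : ℕ) :
    sweedlerPower k H n = (toConv LinearMap.id ^ n : WithConv (H →ₗ[k] H)).ofConv := by
  induction n with
  | zero =>
    refine LinearMap.ext fun a => ?_
    change mulN k H 0 ((PiTensorProduct.isEmptyEquiv (Fin 0)).symm (counit a)) =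
      algebraMap k H (counit a)
    simp [mulN, Algebra.algebraMap_eq_smul_one]
  | succ n ih =>
    refine LinearMap.ext fun a => ?_
    have h := fun b => LinearMap.congr_fun ih b
    change _ = (toConv LinearMap.id ^ (n + 1) : WithConv (H →ₗ[k] H)) a
    rw [pow_succ, (ℛ k a).convMul_apply]
    change mulN k H (n + 1) (TensorPower.mulEquiv (TensorProduct.map (comulN k H n)
      (PiTensorProduct.subsingletonEquiv (0 : Fin 1)).symm.toLinearMap (comul a))) = _
    rw [← (ℛ k a).eq, map_sum, map_sum, map_sum]
    refine Finset.sum_congr rfl fun i _ => ?_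
    rw [TensorProduct.map_tmul]
    refine (mulN_mulEquiv n _ _).trans ?_
    exact congrArg (· * _) (h _)

lemma convPow_id_one_tmul (K : Type*) [Field K] [Algebra k K] (n : ℕ) (a : H) :
    (toConv LinearMap.id ^ n : WithConv (K ⊗[k] H →ₗ[K] K ⊗[k] H)) (1 ⊗ₜ[k] a) =
      1 ⊗ₜ[k] (toConv LinearMap.id ^ n : WithConv (H →ₗ[k] H)) a := by
  induction n generalizing a with
  | zero =>
    rw [pow_zero, pow_zero, convOne_apply, convOne_apply, TensorProduct.counit_tmul]
    simp [Algebra.algebraMap_eq_smul_one, Algebra.TensorProduct.one_def]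
  | succ n ih =>
    have h : comul (R := K) ((1 : K) ⊗ₜ[k] a) = ∑ i ∈ (ℛ k a).index,
        ((1 : K) ⊗ₜ[k] (ℛ k a).left i) ⊗ₜ[K] ((1 : K) ⊗ₜ[k] (ℛ k a).right i) := by
      rw [TensorProduct.comul_tmul, CommSemiring.comul_apply, ← (ℛ k a).eq]
      simp [TensorProduct.tmul_sum]
    rw [pow_succ, pow_succ, convMul_apply, h, (ℛ k a).convMul_apply, map_sum, map_sum,
      TensorProduct.tmul_sum]
    refine Finset.sum_congr rfl fun i _ => ?_
    rw [TensorProduct.map_tmul, mul'_apply]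
    erw [ih]
    simp

theorem exists_sweedlerPower_eq [FiniteDimensional k H] (p : ℕ) [Fact p.Prime] [CharP k p] :
    ∃ n : ℕ, 1 ≤ n ∧ sweedlerPower k H n = Algebra.linearMap k H ∘ₗ counit := by
  have : CharP (AlgebraicClosure k) p :=
    charP_of_injective_algebraMap (R := k) (A := AlgebraicClosure k)
      (algebraMap k (AlgebraicClosure k)).injective p
  obtain ⟨n, hn, h⟩ := exists_convPow_id_eq_one (k := AlgebraicClosure k)
    (H := AlgebraicClosure k ⊗[k] H) p
  refine ⟨n, hn, ?_⟩
  rw [sweedlerPower_eq_convPow]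
  -- Since H embeds in its base change, the identity can be checked over the algebraic closure; the
  -- case n = 0 of the base change formula handles the convolution unit.
  refine LinearMap.ext fun a => Algebra.TensorProduct.includeRight_injective (R := k)
    (A := AlgebraicClosure k) (B := H) (algebraMap k (AlgebraicClosure k)).injective ?_
  have h1 := convPow_id_one_tmul (k := k) (AlgebraicClosure k) n a
  have h0 := convPow_id_one_tmul (k := k) (AlgebraicClosure k) 0 a
  rw [h] at h1
  exact h1.symm.trans h0

end Sweedler

end HopfExponent
end

theorem proposition26 (k : Type*) [Field k] (p : ℕ) (hp : 0 < p) [CharP k p]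
    (H : Type*) [Ring H] [HopfAlgebra k H] [FiniteDimensional k H] :
    HopfExponent.exp₀ k H < ⊤ := by
  have : Fact p.Prime := ⟨(CharP.char_is_prime_or_zero k p).resolve_right hp.ne'⟩
  obtain ⟨n, hn, h⟩ := HopfExponent.exists_sweedlerPower_eq (k := k) (H := H) p
  refine lt_of_le_of_lt ?_ (ENat.natCast_lt_top n)
  exact sInf_le ⟨n, hn, h, rfl⟩
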